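/- **Setting.** The input is a metric $w$ on $V=\{0,\dots,n-1\}$, given as an $n\times n$ matrix, with $1\le w(u,v)\le W$ for $u\ne v$, where $W\le n^{c}$ for a constant $c$; each entry is given by one word of $O(\log n)$ bits (a natural number below $n^c$, with a fixed known map from words to real values). In the MPC model, $M$ machines with local space of $S$ words of $O(\log n)$ bits compute in synchronous rounds. In each round every machine applies an arbitrary function to its memory, the messages just received and fresh private randomness (a uniform sample from $[0,1]$), obtaining its new memory and its messages. Memory plus received messages, and the sent messages, of each machine must take at most $S$ words in every round, for all random outcomes. The total space is $M\cdot S$. Initially the entries, stored as triples $(u,v,w(u,v))$, are distributed over the machines arbitrarily within their space; the output is the set of edges written in the final memories. **The algorithm (Algorithm 1).** Let $0<\epsilon\le 1$, let $\alpha=\Theta(\log^2 n/\epsilon)$ with $\alpha\ge 2$, let $r,r'=\Theta(\log\frac1\epsilon+\log\log n)$ be integers, and let $\gamma>0$ be a constant. The levels are $t=1,\alpha,\dots,\alpha^{K}$, where $K\ge 0$ is the least integer with $\alpha^{K}\ge W$. For a partition $\mathcal P$ of $V$ let $G_{\le t}[\mathcal P]$ be the set of edges $uv$ with $w(u,v)\le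 t$ and $u,v$ in the same set of $\mathcal P$. 1. For every level $t$ draw independent exponential delays $\delta_{t,v}$ ($v\in V$) with rate $\gamma\log n/t$; let $\mathcal P^0_t$ put two vertices $u$ together iff they have the same center $\arg\min_v\,(w(u,v)-\delta_{t,v})$. 2. Two vertices are together in $\mathcal P^{\rm MPX}_t$ iff they are together in $\mathcal P^0_{t'}$ for all levels $t'\ge t$. Beyond the last level, $\mathcal P^{\rm MPX}$ is $\{V\}$. 3. For every level $t$ obtain $\widehat{\mathcal P}_t$ as follows. Start with $\mathcal P^{\rm MPX}_t$ and perform $r$ rounds of leader compression along $E=G_{\le t}[\mathcal P^{\rm MPX}_{\alpha t}]$: every component $C$ flips an independent fair coin $x_C\in\{0,1\}$, and every $C$ with $x_C=0$ that has an edge of $E$ to a component with $x=1$ joins one such component (chosen arbitrarily). Then, inside each set of $\mathcal P^{\rm MPX}_{\alpha t}$, join together all components that still have outgoing edges of $E$. Let $\widehat{\mathcal P}_{t/\alpha}$ for $t=1$ be the partition into singletons. 4. For every level $t$ perform $r'$ rounds of the modified Borůvka algorithm, starting with $\widehat{\mathcal P}_{t/\alpha}$ and using $E=G_{\le\alpha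 t}[\widehat{\mathcal P}_t]$: every component $C$ flips an independent fair coin $x_C$ and takes its shortest outgoing edge $e_C\in E$ (ties broken by edge ID); if $x_C=0$ and the component $C'$ at the other end has $x_{C'}=1$, then $e_C$ is output and $C$ joins $C'$. Finally, in each set of $\widehat{\mathcal P}_t$ choose one of the resulting components arbitrarily and output, for each of the other components in that set, an arbitrary edge connecting it to the chosen one. 5. Return the set $T$ of all edges output in step 4, over all levels. **Statement.** Algorithm 1 can be implemented in $O(\log\frac1\epsilon+\log\log n)$ rounds of the MPC model, with $O(n^\delta)$ space per machine and $\widetilde O(n^2)$ total space, where $0<\delta<1$. Precisely: fix $\delta\in(0,1)$, the exponent $c$, the constants of the $\Theta$'s, $\gamma>0$, and $A\in\mathbb N$. There are constants $C,k,\kappa$, depending only on these, such that for all $n\ge 3$, all $0<\epsilon\le1$, all $1\le W\le n^c$, all admissible $\alpha,r,r'$ and every map from words to real values there are an MPC algorithm and a fixed rule that resolves the arbitrary choices from the current state of Algorithm 1, such that the MPC algorithm uses at most $C(\log\frac1\epsilon+\log\log n)$ rounds, local space $S\le C n^\delta$ words (numbers below $n^{\kappa}$) and total space $M S\le C n^2\log^k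 n$, has room for the input ($n^2\le M\lfloor S/3\rfloor$), and, on every input metric and every initial distribution of it, (i) its output is always the output $T$ of Algorithm 1 for some nonnegative delays and some coins, and (ii) the law of its output is within total variation distance $n^{-A}$ of the law of the output $T$ of Algorithm 1. -/

import Mathlib

open MeasureTheory
open scoped Classical

noncomputable section

namespace MetricMST

/-! ## The massively parallel computation model

A word is a natural number below a word bound `B` (the statement takes `B` polynomial in `n`, so
words have `O(log n)` bits).  Local computation is an arbitrary function (machines have unlimited
computing power), but all that a machine carries from one round to the next, sends or receives is a
list of words, and these lists are what the space bound counts. -/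

/-- A randomized algorithm on `M` machines.  In round `r`, machine `i` applies `step r i` to its
memory, to its inbox (one message per sender, `[]` meaning that nothing was sent) and to a fresh
private uniform sample from `[0,1]`; it obtains its new memory and its outbox (one message per
receiver).  The sample is not kept: it influences the future only through the words produced. -/
structure MPCAlgorithm (M : ℕ) where
  rounds : ℕ
  step : Fin rounds → Fin M → List ℕ → (Fin M → List ℕ) → unitInterval →
    List ℕ × (Fin M → List ℕ)
  measurable_step : ∀ r i mem inbox y, MeasurableSet {ξ | step r i mem inbox ξ = y}

/-- A global configuration between rounds: `memory i` is the memory of machine `i`, and `inbox i j`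
is the message that has just been delivered to machine `i` from machine `j`. -/
structure Config (M : ℕ) where
  memory : Fin M → List ℕ
  inbox : Fin M → Fin M → List ℕ

/-- All space constraints, with local space `S` and words below `B`: memory plus received messages
take at most `S` words, and the messages sent by a machine have total size at most `S` words. -/
def Config.Fits {M : ℕ} (S B : ℕ) (c : Config M) : Prop :=
  ∀ i, (c.memory i).length + ∑ j, (c.inbox i j).length ≤ S ∧
    ∑ j, (c.inbox j i).length ≤ S ∧
    (∀ a ∈ c.memory i, a < B) ∧
    ∀ j, ∀ a ∈ c.inbox i j, a < B

/-- One synchronous round: local processing, then delivery of the messages. -/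
def MPCAlgorithm.round {M : ℕ} (𝒜 : MPCAlgorithm M) (r : Fin 𝒜.rounds)
    (ξ : Fin M → unitInterval) (c : Config M) : Config M where
  memory i := (𝒜.step r i (c.memory i) (c.inbox i) (ξ i)).1
  inbox i j := (𝒜.step r j (c.memory j) (c.inbox j) (ξ j)).2 i

/-- The configuration after `r` rounds (constant once `r` reaches `𝒜.rounds`). -/
def MPCAlgorithm.run {M : ℕ} (𝒜 : MPCAlgorithm M) (init : Fin M → List ℕ)
    (ξ : Fin 𝒜.rounds → Fin M → unitInterval) : ℕ → Config M
  | 0 => ⟨init, fun _ _ => []⟩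
  | r + 1 => if h : r < 𝒜.rounds then 𝒜.round ⟨r, h⟩ (ξ ⟨r, h⟩) (𝒜.run init ξ r)
      else 𝒜.run init ξ r

/-- The initial memories when the entry `(u, v)` of the input matrix, stored as the three words
`u, v, x u v`, lies on machine `place (u, v)`. -/
def initialMemory {n M : ℕ} (place : Fin n × Fin n → Fin M) (x : Fin n → Fin n → ℕ)
    (i : Fin M) : List ℕ :=
  (((List.finRange n) ×ˢ (List.finRange n)).filter (fun p => place p = i)).flatMap
    (fun p => [(p.1 : ℕ), (p.2 : ℕ), x p.1 p.2])

/-- The edges written in the memories, each memory being read as a list of consecutive pairs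
`u₀, v₀, u₁, v₁, …` of end points. -/
def writtenEdges {M : ℕ} (n : ℕ) (mem : Fin M → List ℕ) : Finset (Sym2 (Fin n)) :=
  Finset.univ.filter fun e => ∃ (i : Fin M) (u v : Fin n) (j : ℕ),
    (mem i)[2 * j]? = some (u : ℕ) ∧ (mem i)[2 * j + 1]? = some (v : ℕ) ∧ e = s(u, v)

/-- The edge set output by an algorithm: the edges written in the final memories. -/
def MPCAlgorithm.output {M : ℕ} (𝒜 : MPCAlgorithm M) (n : ℕ) (init : Fin M → List ℕ)
    (ξ : Fin 𝒜.rounds → Fin M → unitInterval) : Finset (Sym2 (Fin n)) :=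
  writtenEdges n (𝒜.run init ξ 𝒜.rounds).memory

/-! ## Metrics and partitions of the vertex set `Fin n` -/

/-- `w` is a metric on `Fin n` whose nonzero distances lie in `[1, W]`. -/
structure IsMetricWithin {n : ℕ} (w : Fin n → Fin n → ℝ) (W : ℝ) : Prop where
  self : ∀ u, w u u = 0
  symm : ∀ u v, w u v = w v u
  triangle : ∀ u v z, w u z ≤ w u v + w v z
  one_le : ∀ u v, u ≠ v → 1 ≤ w u v
  le_max : ∀ u v, w u v ≤ W

/-- The least vertex of the set of the partition `P` that contains `u`; it serves as the name of
that set. -/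
def rep {n : ℕ} (P : Setoid (Fin n)) (u : Fin n) : Fin n :=
  (Finset.univ.filter fun v => P u v).min' ⟨u, by simp⟩

/-- The edges of `G_{≤ t}[P]`: those of weight at most `t` that do not cross `P`. -/
def edgesWithin {n : ℕ} (w : Fin n → Fin n → ℝ) (t : ℝ) (P : Setoid (Fin n)) (u v : Fin n) :
    Prop :=
  u ≠ v ∧ w u v ≤ t ∧ P u v

/-- Every set `C` of `P` (named by its least vertex) for which `target C = some b` joins the set
that contains `b`.  (Used only where the sets that are joined do not move themselves.) -/
def hook {n : ℕ} (P : Setoid (Fin n)) (target : Fin n → Option (Fin n)) : Setoid (Fin n) :=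
  Setoid.ker fun u => match target (rep P u) with
    | some b => rep P b
    | none => rep P u

/-! ## The choices that the algorithm leaves open -/

/-- The set `C` of `P` has an edge of `E` to the vertex `b`, which lies in a different set whose
coin shows `1`. -/
def CanJoin {n : ℕ} (P : Setoid (Fin n)) (E : Fin n → Fin n → Prop) (x : Fin n → Bool)
    (C b : Fin n) : Prop :=
  (∃ a, P C a ∧ E a b) ∧ ¬ P C b ∧ x (rep P b) = true

/-- A rule that resolves the arbitrary choices of the algorithm from its current state.
* `leader`: the vertex through which a set joins another one during leader compression;
* `hub`: for a set `A` of `coarse`, a vertex of the set `C*` of `fine` inside `A` to which all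
  other sets of `fine` inside `A` are connected;
* `link`: an edge from the set `C` of `fine` to the set `C*`. -/
structure ArbitraryChoices (n : ℕ) where
  leader : Setoid (Fin n) → (Fin n → Fin n → Prop) → (Fin n → Bool) → Fin n → Fin n
  leader_spec : ∀ P E x C, (∃ b, CanJoin P E x C b) → CanJoin P E x C (leader P E x C)
  hub : Setoid (Fin n) → Setoid (Fin n) → Fin n → Fin n
  hub_spec : ∀ (fine coarse : Setoid (Fin n)) (A : Fin n), coarse A (hub fine coarse A)
  link : Setoid (Fin n) → Setoid (Fin n) → Fin n → Fin n × Fin n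
  link_spec : ∀ (fine coarse : Setoid (Fin n)) (C : Fin n), fine C (link fine coarse C).1 ∧
    fine (hub fine coarse (rep coarse C)) (link fine coarse C).2

/-! ## Leader compression -/

/-- One round of leader compression on `P` along the edges `E`; `x C` is the coin of the set with
least vertex `C`. -/
def leaderStep {n : ℕ} (ch : ArbitraryChoices n) (E : Fin n → Fin n → Prop)
    (P : Setoid (Fin n)) (x : Fin n → Bool) : Setoid (Fin n) :=
  hook P fun C =>
    if x C = false ∧ ∃ b, CanJoin P E x C b then some (ch.leader P E x C) else none

def leaderCompression {n : ℕ} (ch : ArbitraryChoices n) (E : Fin n → Fin n → Prop)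
    (P : Setoid (Fin n)) {r : ℕ} (x : Fin r → Fin n → Bool) : Setoid (Fin n) :=
  Fin.foldl r (fun Q j => leaderStep ch E Q (x j)) P

/-- The set of `Q` containing `u` still has an outgoing edge of `E`. -/
def Incomplete {n : ℕ} (E : Fin n → Fin n → Prop) (Q : Setoid (Fin n)) (u : Fin n) : Prop :=
  ∃ a b, Q u a ∧ ¬ Q u b ∧ E a b

/-- Join the incomplete sets of `Q` that lie in the same set of `R`; complete sets are kept. -/
def joinIncomplete {n : ℕ} (E : Fin n → Fin n → Prop) (Q R : Setoid (Fin n)) :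
    Setoid (Fin n) :=
  Setoid.ker fun u => if Incomplete E Q u then (true, rep R u) else (false, rep Q u)

/-! ## The modified Borůvka algorithm -/

/-- Identifier of the undirected edge `uv`, used to break ties. -/
def edgeId {n : ℕ} (u v : Fin n) : ℕ := n * (min u v : Fin n) + (max u v : Fin n)

/-- `ab` is an edge of `E` with `a` in the set `C` of `P` and `b` outside of it. -/
def IsOutgoing {n : ℕ} (P : Setoid (Fin n)) (E : Fin n → Fin n → Prop) (C a b : Fin n) : Prop :=
  P C a ∧ ¬ P C b ∧ E a b

/-- `ab` is the shortest edge of `E` leaving the set `C` of `P`, ties being broken by identifier. -/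
def IsShortestOutgoing {n : ℕ} (w : Fin n → Fin n → ℝ) (E : Fin n → Fin n → Prop)
    (P : Setoid (Fin n)) (C a b : Fin n) : Prop :=
  IsOutgoing P E C a b ∧ ∀ a' b', IsOutgoing P E C a' b' →
    w a b < w a' b' ∨ (w a b = w a' b' ∧ edgeId a b ≤ edgeId a' b')

/-- The set `C` uses its shortest outgoing edge `ab` in this round. -/
def BoruvkaJoins {n : ℕ} (w : Fin n → Fin n → ℝ) (E : Fin n → Fin n → Prop)
    (P : Setoid (Fin n)) (x : Fin n → Bool) (C a b : Fin n) : Prop :=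
  IsShortestOutgoing w E P C a b ∧ x C = false ∧ x (rep P b) = true

/-- One round of the modified Borůvka algorithm; the state is the current partition together with
the set of edges added so far. -/
def boruvkaStep {n : ℕ} (w : Fin n → Fin n → ℝ) (E : Fin n → Fin n → Prop)
    (s : Setoid (Fin n) × Finset (Sym2 (Fin n))) (x : Fin n → Bool) :
    Setoid (Fin n) × Finset (Sym2 (Fin n)) :=
  (hook s.1 fun C =>
      if h : ∃ b a, BoruvkaJoins w E s.1 x C a b then some h.choose else none,
    s.2 ∪ Finset.univ.filter fun e => ∃ a b, e = s(a, b) ∧ BoruvkaJoins w E s.1 x (rep s.1 a) a b)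

def boruvka {n : ℕ} (w : Fin n → Fin n → ℝ) (E : Fin n → Fin n → Prop) (P : Setoid (Fin n))
    {r : ℕ} (x : Fin r → Fin n → Bool) : Setoid (Fin n) × Finset (Sym2 (Fin n)) :=
  Fin.foldl r (fun s j => boruvkaStep w E s (x j)) (P, ∅)

/-- For every set of `coarse`, connect all sets of `fine` in it to one of them. -/
def linkEdges {n : ℕ} (ch : ArbitraryChoices n) (fine coarse : Setoid (Fin n)) :
    Finset (Sym2 (Fin n)) :=
  Finset.univ.filter fun e => ∃ C, rep fine C = C ∧
    ¬ fine C (ch.hub fine coarse (rep coarse C)) ∧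
    e = s((ch.link fine coarse C).1, (ch.link fine coarse C).2)

/-! ## The approximate MST algorithm -/

/-- Parameters: the ratio `α` between consecutive levels, the numbers of rounds of leader
compression and of the modified Borůvka algorithm, the constant `γ` in the delay distribution, and
the maximum weight `W`. -/
structure Params where
  α : ℝ
  leaderRounds : ℕ
  boruvkaRounds : ℕ
  γ : ℝ
  W : ℝ

/-- The levels are `α ^ k` for `0 ≤ k ≤ p.top`; `p.top` is the least exponent with
`W ≤ α ^ p.top`. -/
def Params.top (p : Params) : ℕ := ⌈Real.logb p.α p.W⌉₊

/-- `α = Θ(log² n / ε)` and both numbers of rounds are `Θ(log (1/ε) + log log n)`, with the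
constants `a` and `b` in the two directions of `Θ`. -/
structure Params.Theta (p : Params) (a b ε : ℝ) (n : ℕ) : Prop where
  two_le : 2 ≤ p.α
  le_alpha : a * (Real.log n ^ 2 / ε) ≤ p.α
  alpha_le : p.α ≤ b * (Real.log n ^ 2 / ε)
  le_leaderRounds : a * (Real.log (1 / ε) + Real.log (Real.log n)) ≤ p.leaderRounds
  leaderRounds_le : p.leaderRounds ≤ b * (Real.log (1 / ε) + Real.log (Real.log n))
  le_boruvkaRounds : a * (Real.log (1 / ε) + Real.log (Real.log n)) ≤ p.boruvkaRounds
  boruvkaRounds_le : p.boruvkaRounds ≤ b * (Real.log (1 / ε) + Real.log (Real.log n))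

/-- The random draws of the algorithm: a delay for every level and vertex and, for every level,
round and component (named by its least vertex), a coin in each of the two phases. -/
structure Draws (n : ℕ) (p : Params) where
  delay : Fin (p.top + 1) → Fin n → ℝ
  leaderCoin : Fin (p.top + 1) → Fin p.leaderRounds → Fin n → Bool
  boruvkaCoin : Fin (p.top + 1) → Fin p.boruvkaRounds → Fin n → Bool

/-- The center of `u`: the vertex `v` minimizing `w u v - d v` (the least one, if several do). -/
def center {n : ℕ} (w : Fin n → Fin n → ℝ) (d : Fin n → ℝ) (u : Fin n) : Fin n :=
  (Finset.univ.filter fun v => ∀ v', w u v - d v ≤ w u v' - d v').min' (by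
    obtain ⟨v, -, hv⟩ := Finset.exists_min_image Finset.univ (fun v => w u v - d v)
      ⟨u, Finset.mem_univ u⟩
    exact ⟨v, by simpa using hv⟩)

/-- The MPX hierarchy: `u` and `v` are together at level `k` if they have the same center at all
levels `i ≥ k`.  For `k` beyond the last level this is the one-set partition. -/
def mpxPartition {n : ℕ} {p : Params} (w : Fin n → Fin n → ℝ) (ω : Draws n p) (k : ℕ) :
    Setoid (Fin n) :=
  ⨅ i : {i : Fin (p.top + 1) // k ≤ (i : ℕ)}, Setoid.ker (center w (ω.delay i))

/-- The final hierarchy of partitions. -/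
def hierarchy {n : ℕ} {p : Params} (ch : ArbitraryChoices n) (w : Fin n → Fin n → ℝ)
    (ω : Draws n p) (k : Fin (p.top + 1)) : Setoid (Fin n) :=
  let R := mpxPartition w ω (k + 1)
  let E := edgesWithin w (p.α ^ (k : ℕ)) R
  joinIncomplete E (leaderCompression ch E (mpxPartition w ω k) (ω.leaderCoin k)) R

/-- The level of the final hierarchy that precedes `k`; before the first level all sets are
singletons. -/
def previousHierarchy {n : ℕ} {p : Params} (ch : ArbitraryChoices n) (w : Fin n → Fin n → ℝ)
    (ω : Draws n p) (k : Fin (p.top + 1)) : Setoid (Fin n) :=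
  if (k : ℕ) = 0 then ⊥ else hierarchy ch w ω ⟨k - 1, by omega⟩

/-- The edges added at level `k`. -/
def levelEdges {n : ℕ} {p : Params} (ch : ArbitraryChoices n) (w : Fin n → Fin n → ℝ)
    (ω : Draws n p) (k : Fin (p.top + 1)) : Finset (Sym2 (Fin n)) :=
  let s := boruvka w (edgesWithin w (p.α ^ ((k : ℕ) + 1)) (hierarchy ch w ω k))
    (previousHierarchy ch w ω k) (ω.boruvkaCoin k)
  s.2 ∪ linkEdges ch s.1 (hierarchy ch w ω k)

/-- The edge set returned by the algorithm. -/
def approxMST {n : ℕ} {p : Params} (ch : ArbitraryChoices n) (w : Fin n → Fin n → ℝ)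
    (ω : Draws n p) : Finset (Sym2 (Fin n)) :=
  Finset.univ.biUnion fun k => levelEdges ch w ω k

/-- The law of a fair coin. -/
def fairCoin : Measure Bool := (PMF.uniformOfFintype Bool).toMeasure

/-- The joint law of the draws, as a product measure: all draws are independent, the delays at
level `t = α ^ k` are exponential with rate `γ * log n / t`, and the coins are fair. -/
def drawsMeasure (n : ℕ) (p : Params) :
    Measure ((Fin (p.top + 1) → Fin n → ℝ) ×
      (Fin (p.top + 1) → Fin p.leaderRounds → Fin n → Bool) ×
      (Fin (p.top + 1) → Fin p.boruvkaRounds → Fin n → Bool)) :=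
  (Measure.pi fun k : Fin (p.top + 1) => Measure.pi fun _ : Fin n =>
      ProbabilityTheory.expMeasure (p.γ * Real.log n / p.α ^ (k : ℕ))).prod
    ((Measure.pi fun _ => Measure.pi fun _ => Measure.pi fun _ => fairCoin).prod
      (Measure.pi fun _ => Measure.pi fun _ => Measure.pi fun _ => fairCoin))

/-- The probability that the algorithm returns a member of `𝒯`. -/
def approxMSTProb {n : ℕ} (p : Params) (ch : ArbitraryChoices n) (w : Fin n → Fin n → ℝ)
    (𝒯 : Set (Finset (Sym2 (Fin n)))) : ℝ :=
  (drawsMeasure n p).real {ω | approxMST ch w (⟨ω.1, ω.2.1, ω.2.2⟩ : Draws n p) ∈ 𝒯}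

/-- The probability, over the private samples of the machines, that the output of `𝒜` is a member
of `𝒯`. -/
def MPCAlgorithm.outputProb {M : ℕ} (𝒜 : MPCAlgorithm M) (n : ℕ) (init : Fin M → List ℕ)
    (𝒯 : Set (Finset (Sym2 (Fin n)))) : ℝ :=
  (volume : Measure (Fin 𝒜.rounds → Fin M → unitInterval)).real
    {ξ | 𝒜.output n init ξ ∈ 𝒯}

end MetricMST

end

noncomputable section

namespace MetricMST

open ProbabilityTheory

set_option linter.unusedSectionVars false

/-! ## Lists of matrix entries -/

/-! Algorithm 1 is simulated exactly, apart from the delays, which must be rounded to fit in a word.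

Deterministic part. The graph is complete, so a row of the matrix lets a vertex hear from every
other vertex. Partitions are stored by giving each vertex the least vertex of its set (`rep`), and
every step of the algorithm becomes an `Instruction`: each vertex selects a least candidate among
digests of its row and of the other vertices' states, then updates its own state. Selecting within
rows and then within a set finds the best edge leaving the set (`best_best`). The hierarchy at a
level depends only on two consecutive MPX partitions, and the Borůvka phase only on two consecutive
final partitions. All `L` levels therefore run simultaneously in a vertex state of `O(L)` words,
with a constant number of instructions per round of the algorithm; the number of levels does not
multiply the number of rounds. `emittedEdges_eq_approxMST` proves equality with `approxMST`, for all
samples, under choices that always take least vertices.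

Communication. Row `u` is spread over machines `(u, j)`, each holding `B` entries, where `B` is
about `n ^ (1 / (h + 1))`. States are broadcast down a `B`-ary tree of depth `h`, exchanged between
rows and columns, and digests are merged back up the tree, since minima can be taken in any grouping
(`pick_biUnion`). An instruction thus costs `2 h + 2` rounds, a constant once `δ` is fixed
(`represents_states`, `exists_algorithm`).

Probability. The root machines draw samples whose joint law is exactly that of the rounded draws
(`map_volume_collectDraws`). The output depends on the delays only through the centers
(`approxMST_congr`), and rounding preserves a center unless a delay exceeds the representable range
or two shifted distances nearly tie. Bounded exponential densities and a union bound make this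
polynomially unlikely (`measure_center_ne_le`, `error_le`). Since every rounded delay is itself a
nonnegative delay, the output is always one the algorithm could produce. -/

/-- The matrix entries at the positions satisfying `s`, each written as three words. -/
def entryList {n : ℕ} (s : Fin n × Fin n → Prop) (x : Fin n → Fin n → ℕ) : List ℕ :=
  (((List.finRange n) ×ˢ (List.finRange n)).filter (fun p => s p)).flatMap
    (fun p => [(p.1 : ℕ), (p.2 : ℕ), x p.1 p.2])

theorem initialMemory_eq_entryList {n M : ℕ} (place : Fin n × Fin n → Fin M)
    (x : Fin n → Fin n → ℕ) (i : Fin M) :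
    initialMemory place x i = entryList (fun p => place p = i) x := by
  unfold initialMemory entryList
  congr 2
  ext p
  simp

/-- Each entry takes exactly three words and begins with its position, so the list can be parsed
back triple by triple. A machine can therefore recover its share of the input from raw words. -/
theorem flatMap_entries_injective {n : ℕ} {x x' : Fin n → Fin n → ℕ} :
    ∀ {l l' : List (Fin n × Fin n)},
      l.flatMap (fun p => [(p.1 : ℕ), (p.2 : ℕ), x p.1 p.2]) =
        l'.flatMap (fun p => [(p.1 : ℕ), (p.2 : ℕ), x' p.1 p.2]) →
      l = l' ∧ ∀ p ∈ l, x p.1 p.2 = x' p.1 p.2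
  | [], [], _ => by simp
  | [], q :: l', h => by simp at h
  | p :: l, [], h => by simp at h
  | p :: l, q :: l', h => by
    simp only [List.flatMap_cons, List.cons_append, List.nil_append, List.cons.injEq] at h
    obtain ⟨h1, h2, h3, h4⟩ := h
    obtain ⟨rfl, h5⟩ := flatMap_entries_injective h4
    have hpq : p = q := Prod.ext (Fin.ext h1) (Fin.ext h2)
    subst hpq
    refine ⟨rfl, ?_⟩
    simpa using ⟨h3, fun a b hab => h5 (a, b) hab⟩

theorem entryList_injective {n : ℕ} {s s' : Fin n × Fin n → Prop} {x x' : Fin n → Fin n → ℕ}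
    (h : entryList s x = entryList s' x') (p : Fin n × Fin n) :
    (s p ↔ s' p) ∧ (s p → x p.1 p.2 = x' p.1 p.2) := by
  obtain ⟨h1, h2⟩ := flatMap_entries_injective h
  have h3 := fun q => congrArg (fun l => q ∈ l) h1
  have hmem : p ∈ (List.finRange n) ×ˢ (List.finRange n) := by
    obtain ⟨a, b⟩ := p
    simp
  constructor
  · have := h3 p
    simpa [hmem, List.mem_filter] using this
  · intro hp
    exact h2 p (by simp [List.mem_filter, hmem, hp])

theorem entryList_congr {n : ℕ} {s s' : Fin n × Fin n → Prop} {x x' : Fin n → Fin n → ℕ}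
    (hs : ∀ p, s p ↔ s' p) (hx : ∀ p, s p → x p.1 p.2 = x' p.1 p.2) :
    entryList s x = entryList s' x' := by
  have : s = s' := funext fun p => propext (hs p)
  subst this
  unfold entryList
  refine List.flatMap_congr fun p hp => ?_
  rw [hx p (by simpa using (List.mem_filter.1 hp).2)]

theorem length_entryList {n : ℕ} (s : Fin n × Fin n → Prop) (x : Fin n → Fin n → ℕ) :
    (entryList s x).length = 3 * (Finset.univ.filter s).card := by
  unfold entryList
  rw [List.length_flatMap]
  have hnd : ((List.finRange n) ×ˢ (List.finRange n)).Nodup :=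
    (List.nodup_finRange n).product (List.nodup_finRange n)
  have : Finset.univ.filter s =
      (((List.finRange n) ×ˢ (List.finRange n)).filter (fun p => s p)).toFinset := by
    ext ⟨a, b⟩
    simp
  rw [this, List.toFinset_card_of_nodup (hnd.filter _)]
  simp [mul_comm]

theorem mem_entryList_lt {n N : ℕ} {s : Fin n × Fin n → Prop} {x : Fin n → Fin n → ℕ}
    (hn : n ≤ N) (hx : ∀ u v, x u v < N) {a : ℕ} (ha : a ∈ entryList s x) : a < N := by
  unfold entryList at ha
  simp only [List.mem_flatMap, List.mem_cons, List.not_mem_nil, or_false] at ha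
  obtain ⟨p, -, rfl | rfl | rfl⟩ := ha
  · exact p.1.2.trans_le hn
  · exact p.2.2.trans_le hn
  · exact hx _ _

theorem MPCAlgorithm.run_succ {M : ℕ} (𝒜 : MPCAlgorithm M) (init : Fin M → List ℕ)
    (ξ : Fin 𝒜.rounds → Fin M → unitInterval) {r : ℕ} (h : r < 𝒜.rounds) :
    𝒜.run init ξ (r + 1) = 𝒜.round ⟨r, h⟩ (ξ ⟨r, h⟩) (𝒜.run init ξ r) := by
  rw [MPCAlgorithm.run, dif_pos h]

/-! ## Typed synchronous networks -/

/-- A synchronous network of machines indexed by `ι` with states in `σ`: in round `t`, machine `j`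
sends `message` of its state to all machines `i` with `link t i j`; then every machine updates its
state by means of what it received and of a fresh sample in `Y`. -/
structure Network (ι σ μ Y : Type) where
  message : σ → μ
  link : ℕ → ι → ι → Prop
  step : ℕ → ι → σ → (ι → Option μ) → Y → σ

namespace Network

variable {ι σ μ Y : Type}

/-- What machine `i` receives in round `t`. -/
def received (net : Network ι σ μ Y) (t : ℕ) (s : ι → σ) (i : ι) : ι → Option μ :=
  fun j => if net.link t i j then some (net.message (s j)) else none

/-- The states after `t` rounds. -/
def run (net : Network ι σ μ Y) (s₀ : ι → σ) (y : ℕ → ι → Y) : ℕ → ι → σ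
  | 0 => s₀
  | t + 1 => fun i =>
      net.step t i (net.run s₀ y t i) (net.received t (net.run s₀ y t) i) (y t i)

/-- How a network is run by machines of the MPC model: encodings of states and messages as lists of
words, a function turning uniform samples into samples in `Y`, the machine that is to hold each
matrix entry, the initial states, and the words finally written. -/
structure Realization (n M : ℕ) (ι σ μ Y : Type) where
  index : ι ≃ Fin M
  encState : σ → List ℕ
  encMessage : μ → List ℕ
  sample : unitInterval → Y
  dest : Fin n × Fin n → ι
  init : ι → (Fin n → Fin n → ℕ) → σ
  final : ι → σ → List ℕ
  encState_injective : Function.Injective encState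
  encMessage_injective : Function.Injective encMessage
  encMessage_ne_nil : ∀ m, encMessage m ≠ []
  measurable_sample : ∀ s : Set Y, MeasurableSet (sample ⁻¹' s)
  init_congr : ∀ i x x', (∀ p, dest p = i → x p.1 p.2 = x' p.1 p.2) → init i x = init i x'

/-! ### Executing a typed network on MPC machines -/

namespace Realization

variable {n M : ℕ} (R : Realization n M ι σ μ Y) (net : Network ι σ μ Y)

/-- The message with which a machine forwards its share of the input. -/
def forward (place : Fin n × Fin n → Fin M) (x : Fin n → Fin n → ℕ) (i j : Fin M) : List ℕ :=
  entryList (fun p => place p = j ∧ R.index (R.dest p) = i) x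

/-- The encoded messages of a round. -/
def outbox (t : ℕ) (j : Fin M) (s : σ) : Fin M → List ℕ := fun i =>
  if net.link t (R.index.symm i) (R.index.symm j) then R.encMessage (net.message s) else []

/-- The state encoded by a list of words. -/
def decState (i : Fin M) (l : List ℕ) : σ :=
  (Function.partialInv R.encState l).getD (R.init (R.index.symm i) fun _ _ => 0)

/-- Local computation in the MPC model. -/
def mpcStep (T : ℕ) : ℕ → Fin M → List ℕ → (Fin M → List ℕ) → unitInterval →
    List ℕ × (Fin M → List ℕ)
  | 0, i, mem, _, _ =>
    ([], fun m => if h : ∃ q : (Fin n × Fin n → Fin M) × (Fin n → Fin n → ℕ),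
        mem = initialMemory q.1 q.2 i then R.forward h.choose.1 h.choose.2 m i else [])
  | 1, i, _, inbox, _ =>
    let s := R.init (R.index.symm i) <|
      if h : ∃ q : (Fin n × Fin n → Fin M) × (Fin n → Fin n → ℕ),
        inbox = R.forward q.1 q.2 i then h.choose.2 else fun _ _ => 0
    (R.encState s, R.outbox net 0 i s)
  | t + 2, i, mem, inbox, ξ =>
    if t < T then
      let s := net.step t (R.index.symm i) (R.decState i mem)
        (fun j => Function.partialInv R.encMessage (inbox (R.index j))) (R.sample ξ)
      (R.encState s, R.outbox net (t + 1) i s)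
    else (R.final (R.index.symm i) (R.decState i mem), fun _ => [])

theorem measurableSet_mpcStep (T r : ℕ) (i : Fin M) (mem : List ℕ) (inbox : Fin M → List ℕ)
    (y : List ℕ × (Fin M → List ℕ)) :
    MeasurableSet {ξ | R.mpcStep net T r i mem inbox ξ = y} := by
  match r with
  | 0 => simp only [mpcStep]; exact MeasurableSet.const _
  | 1 => simp only [mpcStep]; exact MeasurableSet.const _
  | t + 2 =>
    by_cases h : t < T
    · simp only [mpcStep, h, if_true]
      exact R.measurable_sample {z | (R.encState (net.step t (R.index.symm i) (R.decState i mem)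
        (fun j => Function.partialInv R.encMessage (inbox (R.index j))) z), R.outbox net (t + 1) i
        (net.step t (R.index.symm i) (R.decState i mem)
        (fun j => Function.partialInv R.encMessage (inbox (R.index j))) z)) = y}
    · simp only [mpcStep, h, if_false]
      exact MeasurableSet.const _

/-- The MPC algorithm that runs `T` rounds of a network. -/
def algorithm (T : ℕ) : MPCAlgorithm M where
  rounds := T + 3
  step r := R.mpcStep net T r
  measurable_step r := R.measurableSet_mpcStep net T r

/-- The samples in `Y` obtained by the network. -/
def samples {T : ℕ} (ξ : Fin (T + 3) → Fin M → unitInterval) (t : ℕ) (i : ι) : Y :=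
  R.sample (if h : t + 2 < T + 3 then ξ ⟨t + 2, h⟩ (R.index i) else 0)

theorem decState_encState (i : Fin M) (s : σ) : R.decState i (R.encState s) = s := by
  simp [decState, Function.partialInv_left R.encState_injective]

/-- No encoded message is empty, so the empty list decodes to `none`: silence in the MPC model means
exactly a missing link in the network. -/
theorem partialInv_outbox (t : ℕ) (s : ι → σ) (i : Fin M) (j : ι) :
    Function.partialInv R.encMessage (R.outbox net t (R.index j) (s j) i) =
      net.received t s (R.index.symm i) j := by
  unfold outbox received
  simp only [Equiv.symm_apply_apply]
  split_ifs with h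
  · exact Function.partialInv_left R.encMessage_injective _
  · unfold Function.partialInv
    rw [dif_neg]
    rintro ⟨m, hm⟩
    exact R.encMessage_ne_nil m hm

variable (place : Fin n × Fin n → Fin M) (x : Fin n → Fin n → ℕ)

/-- The machine acts on an arbitrarily chosen placement and matrix that explain its memory. By
`entryList_injective` any two explanations agree on the entries actually held, and only these are
forwarded. -/
theorem round_zero (i : Fin M) (inbox : Fin M → List ℕ) (T : ℕ) (ξ : unitInterval) :
    R.mpcStep net T 0 i (initialMemory place x i) inbox ξ =
      ([], fun m => R.forward place x m i) := by
  have h : ∃ q : (Fin n × Fin n → Fin M) × (Fin n → Fin n → ℕ),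
      initialMemory place x i = initialMemory q.1 q.2 i := ⟨(place, x), rfl⟩
  simp only [mpcStep, h, dif_pos, Prod.mk.injEq, true_and]
  funext m
  have hc := h.choose_spec
  have hc : entryList _ _ = entryList _ _ :=
    (initialMemory_eq_entryList _ _ _).symm.trans (hc.trans (initialMemory_eq_entryList _ _ _))
  apply entryList_congr
  · intro p
    rw [(entryList_injective hc p).1]
  · rintro p ⟨hp, -⟩
    have := entryList_injective hc p
    exact (this.2 (this.1.2 hp)).symm

/-- The same argument on the receiving side: an explanation of the inbox agrees with the true matrix
on all entries destined for this machine, and by `init_congr` the initial state depends on nothing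
else. -/
theorem round_one (i : Fin M) (mem : List ℕ) (T : ℕ) (ξ : unitInterval) :
    R.mpcStep net T 1 i mem (R.forward place x i) ξ =
      (R.encState (R.init (R.index.symm i) x),
        R.outbox net 0 i (R.init (R.index.symm i) x)) := by
  have h : ∃ q : (Fin n × Fin n → Fin M) × (Fin n → Fin n → ℕ),
      R.forward place x i = R.forward q.1 q.2 i := ⟨(place, x), rfl⟩
  have key : R.init (R.index.symm i) h.choose.2 = R.init (R.index.symm i) x := by
    apply R.init_congr
    intro p hp
    have hc := congrFun h.choose_spec (place p)
    have := entryList_injective hc p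
    exact (this.2 ⟨rfl, by simp [hp]⟩).symm
  simp only [mpcStep, h, dif_pos, key]

theorem run_one (T : ℕ) (ξ : Fin (T + 3) → Fin M → unitInterval) :
    (R.algorithm net T).run (initialMemory place x) ξ 1 =
      ⟨fun _ => [], fun i j => R.forward place x i j⟩ := by
  have h0 : 0 < (R.algorithm net T).rounds := Nat.succ_pos _
  simp only [MPCAlgorithm.run, h0, dif_pos, MPCAlgorithm.round]
  have h := fun i inbox z => R.round_zero net place x i inbox T z
  simp only [algorithm, h]

/-- The offset two accounts for routing the input and forming the initial states. The messages of
network round `t` are already in transit at this moment, because each MPC round computes a state and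
then sends from it. -/
theorem run_add_two (T : ℕ) (ξ : Fin (T + 3) → Fin M → unitInterval) :
    ∀ t ≤ T, (R.algorithm net T).run (initialMemory place x) ξ (t + 2) =
      let s := net.run (fun i => R.init i x) (R.samples ξ) t
      ⟨fun i => R.encState (s (R.index.symm i)),
        fun i j => R.outbox net t j (s (R.index.symm j)) i⟩
  | 0, _ => by
    have h1 : 1 < (R.algorithm net T).rounds := by simp [algorithm]
    refine (MPCAlgorithm.run_succ _ _ _ h1).trans ?_
    rw [run_one]
    simp only [MPCAlgorithm.round, algorithm, Network.run]
    have h := fun i mem z => R.round_one net place x i mem T z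
    simp only [h]
  | t + 1, ht => by
    have h1 : t + 2 < (R.algorithm net T).rounds := by simp only [algorithm]; omega
    have h2 : t + 2 < T + 3 := by omega
    refine (MPCAlgorithm.run_succ _ _ _ h1).trans ?_
    rw [run_add_two T ξ t (by omega)]
    have key : ∀ i, R.mpcStep net T (t + 2) i
        (R.encState (net.run (fun i => R.init i x) (R.samples ξ) t (R.index.symm i)))
        (fun j => R.outbox net t j
          (net.run (fun i => R.init i x) (R.samples ξ) t (R.index.symm j)) i)
        (ξ ⟨t + 2, h2⟩ i) =
        let s := net.run (fun i => R.init i x) (R.samples ξ) (t + 1) (R.index.symm i)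
        (R.encState s, R.outbox net (t + 1) i s) := by
      intro i
      have ht' : t < T := by omega
      simp only [mpcStep, ht', if_true, decState_encState, Equiv.symm_apply_apply,
        partialInv_outbox, Network.run, samples, h2, dif_pos, Equiv.apply_symm_apply]
    simp only [MPCAlgorithm.round]
    simp only [algorithm] at key ⊢
    simp only [key]

theorem run_last (T : ℕ) (ξ : Fin (T + 3) → Fin M → unitInterval) :
    (R.algorithm net T).run (initialMemory place x) ξ (T + 3) =
      ⟨fun i => R.final (R.index.symm i)
        (net.run (fun i => R.init i x) (R.samples ξ) T (R.index.symm i)), fun _ _ => []⟩ := by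
  have h1 : T + 2 < (R.algorithm net T).rounds := by simp [algorithm]
  refine (MPCAlgorithm.run_succ _ _ _ h1).trans ?_
  rw [run_add_two _ _ _ _ _ _ T le_rfl]
  simp only [MPCAlgorithm.round, algorithm, mpcStep, lt_irrefl, if_false, decState_encState]

/-- Bounds under which a network respects local space `S` with words below `N`. -/
structure Fits (S N lenState lenMessage inDeg outDeg : ℕ) : Prop where
  length_state : ∀ s, (R.encState s).length ≤ lenState
  state_lt : ∀ s, ∀ a ∈ R.encState s, a < N
  length_message : ∀ m, (R.encMessage m).length ≤ lenMessage
  message_lt : ∀ m, ∀ a ∈ R.encMessage m, a < N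
  card_in : ∀ t i, {j | net.link t i j}.ncard ≤ inDeg
  card_out : ∀ t j, {i | net.link t i j}.ncard ≤ outDeg
  in_le : lenState + inDeg * lenMessage ≤ S
  out_le : outDeg * lenMessage ≤ S
  card_dest : ∀ i, 3 * (Finset.univ.filter fun p => R.dest p = i).card ≤ S
  length_final : ∀ i s, (R.final i s).length ≤ S
  final_lt : ∀ i s, ∀ a ∈ R.final i s, a < N
  le_bound : n ≤ N

theorem sum_length_le {len deg : ℕ} (P : ι → Prop) (hP : {j | P j}.ncard ≤ deg)
    (l : Fin M → List ℕ) (hl : ∀ j, (l j).length ≤ if P (R.index.symm j) then len else 0) :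
    ∑ j, (l j).length ≤ deg * len := by
  have : Fintype ι := Fintype.ofEquiv _ R.index.symm
  calc ∑ j, (l j).length ≤ ∑ j, if P (R.index.symm j) then len else 0 :=
        Finset.sum_le_sum fun j _ => hl j
    _ = ∑ j : ι, if P j then len else 0 := R.index.symm.sum_comp (fun j => if P j then len else 0)
    _ = (Finset.univ.filter P).card * len := by
        rw [← Finset.sum_filter, Finset.sum_const, smul_eq_mul]
    _ ≤ deg * len := by
        refine Nat.mul_le_mul_right _ ?_
        rw [Set.ncard_eq_toFinset_card'] at hP
        simpa using hP

/-- Apart from the last configuration, there are three regimes: the given placement; the moment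
after routing, when memories are empty and an inbox is one destination's share; and the simulation,
where degree times message length controls the traffic. -/
theorem fits_run {S N lenState lenMessage inDeg outDeg : ℕ}
    (hF : R.Fits net S N lenState lenMessage inDeg outDeg) (T : ℕ)
    (hx : ∀ u v, x u v < N)
    (hplace : ∀ i, 3 * (Finset.univ.filter fun e => place e = i).card ≤ S)
    (ξ : Fin (T + 3) → Fin M → unitInterval) :
    ∀ r ≤ T + 3, ((R.algorithm net T).run (initialMemory place x) ξ r).Fits S N := by
  intro r hr
  match r with
  | 0 =>
    intro i
    simp only [MPCAlgorithm.run, List.length_nil, Finset.sum_const_zero, add_zero]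
    refine ⟨?_, Nat.zero_le _, ?_, by simp⟩
    · rw [initialMemory_eq_entryList, length_entryList]
      refine le_of_eq_of_le ?_ (hplace i)
      congr 2; ext; simp
    · intro a ha
      rw [initialMemory_eq_entryList] at ha
      exact mem_entryList_lt hF.le_bound hx ha
  | 1 =>
    intro i
    rw [run_one]
    -- The shares exchanged with different machines are disjoint sets of entries, so their total
    -- length is three times the size of a union contained in `g`.
    have hsum : ∀ (f : Fin M → Fin n × Fin n → Prop),
        (∀ j k p, f j p → f k p → j = k) → ∀ g : Fin n × Fin n → Prop, (∀ j p, f j p → g p) →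
        ∑ j, (entryList (f j) x).length ≤ 3 * (Finset.univ.filter g).card := by
      intro f hf g hg
      simp only [length_entryList, ← Finset.mul_sum]
      refine Nat.mul_le_mul_left _ ?_
      rw [← Finset.card_biUnion]
      · refine Finset.card_le_card fun p hp => ?_
        simp only [Finset.mem_biUnion, Finset.mem_filter, Finset.mem_univ, true_and] at hp ⊢
        obtain ⟨j, hj⟩ := hp
        exact hg j p hj
      · intro j _ k _ hjk
        refine Finset.disjoint_left.2 fun p hp hq => hjk ?_
        simp only [Finset.mem_filter, Finset.mem_univ, true_and] at hp hq
        exact hf j k p hp hq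
    refine ⟨?_, ?_, by simp, ?_⟩
    · simp only [List.length_nil, zero_add]
      refine (hsum (fun j p => place p = j ∧ R.index (R.dest p) = i) ?_
        (fun p => R.dest p = R.index.symm i) ?_).trans ?_
      · rintro j k p ⟨rfl, -⟩ ⟨rfl, -⟩; rfl
      · rintro j p ⟨-, rfl⟩; simp
      · refine le_of_eq_of_le ?_ (hF.card_dest (R.index.symm i))
        congr 2
    · refine (hsum (fun j p => place p = i ∧ R.index (R.dest p) = j) ?_
        (fun p => place p = i) ?_).trans ?_
      · rintro j k p ⟨-, rfl⟩ ⟨-, rfl⟩; rfl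
      · rintro j p ⟨h, -⟩; exact h
      · refine le_of_eq_of_le ?_ (hplace i)
        congr 2; ext; simp
    · intro j a ha
      exact mem_entryList_lt hF.le_bound hx ha
  | t + 2 =>
    rcases Nat.lt_or_ge T t with ht | ht
    · obtain rfl : t = T + 1 := by omega
      rw [run_last]
      intro i
      simp only [List.length_nil, Finset.sum_const_zero, add_zero]
      exact ⟨hF.length_final _ _, Nat.zero_le _, hF.final_lt _ _, by simp⟩
    · rw [run_add_two _ _ _ _ _ _ t ht]
      intro i
      simp only
      refine ⟨?_, ?_, fun a ha => hF.state_lt _ a ha, ?_⟩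
      · refine le_trans (Nat.add_le_add (hF.length_state _) ?_) hF.in_le
        refine R.sum_length_le _ (hF.card_in t (R.index.symm i)) _ fun j => ?_
        unfold outbox
        split_ifs
        · exact hF.length_message _
        · simp
      · refine le_trans ?_ hF.out_le
        refine R.sum_length_le _ (hF.card_out t (R.index.symm i)) _ fun j => ?_
        unfold outbox
        split_ifs
        · exact hF.length_message _
        · simp
      · intro j a ha
        unfold outbox at ha
        split_ifs at ha
        · exact hF.message_lt _ a ha
        · simp at ha

end Realization

end Network

/-! ## Writing edges, and encodings by words -/

/-- A list of edges, written as words. -/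
def edgeWords {n : ℕ} (l : List (Fin n × Fin n)) : List ℕ :=
  l.flatMap fun p => [(p.1 : ℕ), (p.2 : ℕ)]

theorem getElem?_edgeWords {n : ℕ} (l : List (Fin n × Fin n)) (j : ℕ) :
    (edgeWords l)[2 * j]? = (l[j]?).map (fun p => (p.1 : ℕ)) ∧
      (edgeWords l)[2 * j + 1]? = (l[j]?).map (fun p => (p.2 : ℕ)) := by
  induction l generalizing j with
  | nil => simp [edgeWords]
  | cons p l ih =>
    cases j with
    | zero => simp [edgeWords]
    | succ j =>
      have := ih j
      simp only [edgeWords, List.flatMap_cons] at this ⊢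
      simpa [Nat.mul_add] using this

theorem writtenEdges_edgeWords {n M : ℕ} (l : Fin M → List (Fin n × Fin n)) :
    writtenEdges n (fun i => edgeWords (l i)) =
      Finset.univ.filter fun e => ∃ i, ∃ p ∈ l i, e = s(p.1, p.2) := by
  unfold writtenEdges
  congr 1
  funext e
  simp only [eq_iff_iff]
  constructor
  · rintro ⟨i, u, v, j, h1, h2, rfl⟩
    rw [(getElem?_edgeWords _ _).1] at h1
    rw [(getElem?_edgeWords _ _).2] at h2
    simp only [Option.map_eq_some_iff] at h1 h2
    obtain ⟨p, hp, h1⟩ := h1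
    obtain ⟨q, hq, h2⟩ := h2
    obtain rfl : p = q := by rw [hp] at hq; exact Option.some.inj hq
    exact ⟨i, p, List.mem_of_getElem? hp, by rw [Fin.ext h1, Fin.ext h2]⟩
  · rintro ⟨i, p, hp, rfl⟩
    obtain ⟨j, hj⟩ := List.mem_iff_getElem?.1 hp
    exact ⟨i, p.1, p.2, j, by simp [(getElem?_edgeWords _ _).1, hj],
      by simp [(getElem?_edgeWords _ _).2, hj], rfl⟩

/-- Pure counting: there are `N ^ m` strings of `m` words below `N`. Encodings need no structure
because local computation is unrestricted. -/
theorem exists_encoding {α : Type} [Finite α] {N m : ℕ} (h : Nat.card α ≤ N ^ m) :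
    ∃ enc : α → List ℕ, Function.Injective enc ∧ (∀ x, (enc x).length = m) ∧
      ∀ x, ∀ a ∈ enc x, a < N := by
  have := Fintype.ofFinite α
  have : Fintype.card α ≤ Fintype.card (Fin m → Fin N) := by
    rw [← Nat.card_eq_fintype_card]
    simpa using h
  obtain ⟨f⟩ := Function.Embedding.nonempty_of_card_le this
  refine ⟨fun x => List.ofFn fun i => (f x i : ℕ), ?_, by simp, ?_⟩
  · intro x y hxy
    apply f.injective
    have := List.ofFn_injective hxy
    funext i
    exact Fin.ext (congrFun this i)
  · intro x a ha
    simp only [List.mem_ofFn] at ha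
    obtain ⟨i, rfl⟩ := ha
    exact (f x i).2

/-! ## Vertex programs -/

/-- One instruction of a vertex program.  Every vertex has a state in `A`.  For all `u` and `v`, a
digest in `G` of the entry `(u, v)` and the states of `u` and `v` is computed, and possibly the edge
`uv` is output; the merged digests of the row of `u` then serve to update the state of `u`. -/
structure Instruction (n : ℕ) (A G Y : Type) where
  digest : Fin n → Fin n → ℕ → A → A → G
  merge : Finset G → G
  merge_biUnion : ∀ (s : Finset ℕ) (f : ℕ → Finset G),
    merge (s.biUnion f) = merge (s.image fun i => merge (f i))
  emit : Fin n → Fin n → ℕ → A → A → Prop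
  update : Fin n → A → G → Y → A

section VertexProgram

variable {n : ℕ} {A G Y : Type}

/-- The states after the first `s` instructions. -/
def vertexRun (I : ℕ → Instruction n A G Y) (x : Fin n → Fin n → ℕ) (a₀ : Fin n → A)
    (y : ℕ → Fin n → Y) : ℕ → Fin n → A
  | 0 => a₀
  | s + 1 => fun u =>
    let a := vertexRun I x a₀ y s
    (I s).update u (a u)
      ((I s).merge (Finset.univ.image fun v => (I s).digest u v (x u v) (a u) (a v))) (y s u)

/-- The edge `uv` is output by one of the first `s` instructions. -/
def Emitted (I : ℕ → Instruction n A G Y) (x : Fin n → Fin n → ℕ) (a₀ : Fin n → A)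
    (y : ℕ → Fin n → Y) (s : ℕ) (u v : Fin n) : Prop :=
  ∃ t < s, (I t).emit u v (x u v) (vertexRun I x a₀ y t u) (vertexRun I x a₀ y t v)

end VertexProgram

/-! ## Running a vertex program on a grid of machines -/

/-- The state of a machine: its `B` matrix entries with their output flags, a vertex state and a
digest. -/
structure GridState (B N : ℕ) (A G : Type) where
  word : Fin B → Fin N
  flag : Fin B → Bool
  state : A
  digest : G

/-- The data of a vertex program run on machines `(u, j)` with `u < n` and `j < B ^ h`, machine
`(u, j)` holding the entries `(u, v)` with `v / B = j`. -/
structure Grid (n B h N : ℕ) (A G Y : Type) where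
  program : ℕ → Instruction n A G Y
  start : Fin n → A
  blank : G
  pos : 0 < B
  bound_pos : 0 < N
  le_pow : n ≤ B ^ h * B

namespace Grid

variable {n B h N : ℕ} {A G Y : Type} (g : Grid n B h N A G Y)
include g in
theorem div_lt (v : Fin n) : (v : ℕ) / B < B ^ h :=
  Nat.div_lt_of_lt_mul (by rw [mul_comm]; exact v.2.trans_le g.le_pow)

/-- The block containing a vertex. -/
def blockOf (v : Fin n) : Fin (B ^ h) := ⟨v / B, g.div_lt v⟩

/-- The parent of a block. -/
def parent (j : Fin (B ^ h)) : Fin (B ^ h) := ⟨j / B, (Nat.div_le_self _ _).trans_lt j.2⟩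

/-- The index of a vertex inside its block. -/
def offset (v : Fin n) : Fin B := ⟨v % B, Nat.mod_lt _ g.pos⟩

/-- Whether machine `i` hears from machine `j` in phase `p` of an instruction: states are handed
down the rows, then exchanged with the columns, then digests are handed up the rows. -/
def phaseLink (p : ℕ) (i j : Fin n × Fin (B ^ h)) : Prop :=
  if p < h then i.1 = j.1 ∧ j.2 = parent i.2
  else if p = h then g.blockOf j.1 = i.2 ∧ g.blockOf i.1 = j.2
  else if p < 2 * h + 1 then i.1 = j.1 ∧ parent j.2 = i.2
  else False

/-- The update of machine `i` in phase `p` of instruction `I`. -/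
def phaseStep (I : Instruction n A G Y) (p : ℕ) (i : Fin n × Fin (B ^ h)) (s : GridState B N A G)
    (recv : Fin n × Fin (B ^ h) → Option (A × G)) (y : Y) : GridState B N A G :=
  let state (j : Fin n × Fin (B ^ h)) : A := ((recv j).map Prod.fst).getD s.state
  let digest (j : Fin n × Fin (B ^ h)) : G := ((recv j).map Prod.snd).getD s.digest
  if p < h then { s with state := state (i.1, parent i.2) }
  else if p = h then
    { s with
      digest := I.merge ((Finset.univ.filter fun v => g.blockOf v = i.2).image fun v =>
        I.digest i.1 v (s.word (g.offset v)) s.state (state (v, g.blockOf i.1)))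
      flag := fun b => s.flag b || decide (∃ v, g.blockOf v = i.2 ∧ g.offset v = b ∧
        I.emit i.1 v (s.word b) s.state (state (v, g.blockOf i.1))) }
  else if p < 2 * h + 1 then
    { s with digest := I.merge ((Finset.univ.filter fun j => parent j = i.2).image fun j =>
        digest (i.1, j)) }
  else { s with state := I.update i.1 s.state s.digest y }

/-- The network simulating each instruction in `2 h + 2` rounds. -/
def network : Network (Fin n × Fin (B ^ h)) (GridState B N A G) (A × G) Y where
  message s := (s.state, s.digest)
  link t := g.phaseLink (t % (2 * h + 2))
  step t := g.phaseStep (g.program (t / (2 * h + 2))) (t % (2 * h + 2))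

/-- The initial states of the machines. -/
def init (i : Fin n × Fin (B ^ h)) (x : Fin n → Fin n → ℕ) : GridState B N A G where
  word b := if hv : i.2 * B + b < n then
      ⟨x i.1 ⟨i.2 * B + b, hv⟩ % N, Nat.mod_lt _ g.bound_pos⟩
    else ⟨0, g.bound_pos⟩
  flag _ := false
  state := g.start i.1
  digest := g.blank

theorem blockOf_offset (v : Fin n) : (g.blockOf v : ℕ) * B + g.offset v = v := by
  simp only [blockOf, offset]
  rw [mul_comm]
  exact Nat.div_add_mod _ _

theorem blockOf_eq_of {v : ℕ} (hv : v < n) {j : Fin (B ^ h)} {b : Fin B}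
    (hjb : (j : ℕ) * B + b = v) : g.blockOf ⟨v, hv⟩ = j ∧ g.offset ⟨v, hv⟩ = b := by
  subst hjb
  constructor <;> ext <;> simp only [blockOf, offset]
  · rw [mul_comm, Nat.mul_add_div g.pos, Nat.div_eq_of_lt b.2, add_zero]
  · rw [mul_comm, Nat.mul_add_mod, Nat.mod_eq_of_lt b.2]

variable (x : Fin n → Fin n → ℕ) (y : ℕ → Fin n × Fin (B ^ h) → Y)

/-- The states of the machines after `t` rounds. -/
abbrev states (t : ℕ) : Fin n × Fin (B ^ h) → GridState B N A G :=
  g.network.run (fun i => g.init i x) y t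

theorem states_succ (s p : ℕ) (hp : p < 2 * h + 2) (i : Fin n × Fin (B ^ h)) :
    g.states x y (s * (2 * h + 2) + (p + 1)) i =
      g.phaseStep (g.program s) p i (g.states x y (s * (2 * h + 2) + p) i)
        (fun j => if g.phaseLink p i j then
          some ((g.states x y (s * (2 * h + 2) + p) j).state,
            (g.states x y (s * (2 * h + 2) + p) j).digest) else none)
        (y (s * (2 * h + 2) + p) i) := by
  have h1 : (s * (2 * h + 2) + p) / (2 * h + 2) = s := by
    rw [mul_comm, Nat.mul_add_div (by omega), Nat.div_eq_of_lt hp, add_zero]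
  have h2 : (s * (2 * h + 2) + p) % (2 * h + 2) = p := by
    rw [mul_comm, Nat.mul_add_mod, Nat.mod_eq_of_lt hp]
  have h3 : g.network.step (s * (2 * h + 2) + p) = g.phaseStep (g.program s) p := by
    simp only [network, h1, h2]
  have h4 : g.network.link (s * (2 * h + 2) + p) = g.phaseLink p := by
    simp only [network, h2]
  rw [← h3, ← h4]
  rfl

/-- The sample used by a vertex in an instruction. -/
def rootSample (hpos : 0 < B ^ h) (s : ℕ) (u : Fin n) : Y :=
  y (s * (2 * h + 2) + (2 * h + 1)) (u, ⟨0, hpos⟩)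

/-- The meaning of the states at the beginning of an instruction, given the states of the vertices
and the edges output so far. -/
structure Represents (st : Fin n × Fin (B ^ h) → GridState B N A G) (a : Fin n → A)
    (out : Fin n → Fin n → Prop) : Prop where
  word : ∀ u v, ((st (u, g.blockOf v)).word (g.offset v) : ℕ) = x u v
  flag : ∀ u v, (st (u, g.blockOf v)).flag (g.offset v) = true ↔ out u v
  state : ∀ u (j : Fin (B ^ h)), (j : ℕ) = 0 → (st (u, j)).state = a u

/-! ### Correctness of the simulation of an instruction -/

variable {x y}

/-- Each round replaces a block's state by that of its parent, so after `p` rounds block `j` shows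
what block `j / B ^ p` had at the start. Block `0` is its own parent, and at `p = h` every block
shows the state of block `0`. -/
theorem states_down (s : ℕ) {p : ℕ} (hp : p ≤ h) (u : Fin n) (j : Fin (B ^ h)) :
    (g.states x y (s * (2 * h + 2) + p) (u, j)).word =
        (g.states x y (s * (2 * h + 2)) (u, j)).word ∧
      (g.states x y (s * (2 * h + 2) + p) (u, j)).flag =
        (g.states x y (s * (2 * h + 2)) (u, j)).flag ∧
      (g.states x y (s * (2 * h + 2) + p) (u, j)).state =
        (g.states x y (s * (2 * h + 2))
          (u, ⟨j / B ^ p, (Nat.div_le_self _ _).trans_lt j.2⟩)).state := by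
  induction p generalizing j with
  | zero => simp
  | succ p ih =>
    have hp' : p < h := hp
    rw [g.states_succ x y s p (by omega)]
    simp only [phaseStep, phaseLink, hp', if_true]
    refine ⟨(ih hp'.le j).1, (ih hp'.le j).2.1, ?_⟩
    simp only [and_self, if_true, Option.map_some, Option.getD_some]
    rw [(ih hp'.le (parent j)).2.2]
    congr 4
    simp only [parent]
    rw [Nat.div_div_eq_div_mul, pow_succ']

/-- A merge over the children of `j` turns coverage of `v / B ^ (p + 1) = k`, for all `k` with `k /
B = j`, into coverage of `v / B ^ (p + 2) = j`. At `p = h` block `0` covers the whole row, as `n ≤ B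
^ (h + 1)`. -/
theorem states_up (s : ℕ) (f : Fin n → Fin n → G)
    (hf : ∀ u j, (g.states x y (s * (2 * h + 2) + (h + 1)) (u, j)).digest =
      (g.program s).merge ((Finset.univ.filter fun v => g.blockOf v = j).image (f u)))
    {p : ℕ} (hp : p ≤ h) (u : Fin n) (j : Fin (B ^ h)) :
    (g.states x y (s * (2 * h + 2) + (h + 1 + p)) (u, j)).word =
        (g.states x y (s * (2 * h + 2) + (h + 1)) (u, j)).word ∧
      (g.states x y (s * (2 * h + 2) + (h + 1 + p)) (u, j)).flag =
        (g.states x y (s * (2 * h + 2) + (h + 1)) (u, j)).flag ∧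
      (g.states x y (s * (2 * h + 2) + (h + 1 + p)) (u, j)).state =
        (g.states x y (s * (2 * h + 2) + (h + 1)) (u, j)).state ∧
      (g.states x y (s * (2 * h + 2) + (h + 1 + p)) (u, j)).digest =
        (g.program s).merge
          ((Finset.univ.filter fun v : Fin n => (v : ℕ) / B ^ (p + 1) = j).image (f u)) := by
  induction p generalizing j with
  | zero =>
    refine ⟨rfl, rfl, rfl, ?_⟩
    rw [add_zero, hf]
    congr 2
    ext v
    simp [blockOf, Fin.ext_iff]
  | succ p ih =>
    have hp' : p ≤ h := Nat.le_of_succ_le hp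
    have h1 : ¬ h + 1 + p < h := by omega
    have h2 : h + 1 + p ≠ h := by omega
    have h3 : h + 1 + p < 2 * h + 1 := by omega
    rw [← add_assoc (h + 1) p 1, g.states_succ x y s (h + 1 + p) (by omega)]
    simp only [phaseStep, phaseLink, h1, h2, h3, if_true, if_false]
    refine ⟨(ih hp' j).1, (ih hp' j).2.1, (ih hp' j).2.2.1, ?_⟩
    -- The children are passed to `ℕ` through `Fin.val` because `merge_biUnion` is indexed by
    -- natural numbers.
    have h4 : (Finset.univ.filter fun v : Fin n => (v : ℕ) / B ^ (p + 1 + 1) = j).image (f u) =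
        (((Finset.univ.filter fun k : Fin (B ^ h) => parent k = j).image Fin.val).biUnion fun k =>
          (Finset.univ.filter fun v : Fin n => (v : ℕ) / B ^ (p + 1) = k).image (f u)) := by
      ext z
      simp only [Finset.mem_image, Finset.mem_biUnion, Finset.mem_filter, Finset.mem_univ,
        true_and]
      constructor
      · rintro ⟨v, hv, rfl⟩
        have hlt : (v : ℕ) / B ^ (p + 1) < B ^ h := by
          refine lt_of_le_of_lt ?_ (g.div_lt v)
          rw [pow_succ', ← Nat.div_div_eq_div_mul]
          exact Nat.div_le_self _ _
        refine ⟨_, ⟨⟨_, hlt⟩, Fin.ext ?_, rfl⟩, v, rfl, rfl⟩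
        simp only [parent]
        rw [← hv, pow_succ _ (p + 1), Nat.div_div_eq_div_mul]
      · rintro ⟨_, ⟨k, hk, rfl⟩, v, hv, rfl⟩
        refine ⟨v, ?_, rfl⟩
        rw [← hk, pow_succ _ (p + 1), ← Nat.div_div_eq_div_mul, hv]
        rfl
    rw [h4, Instruction.merge_biUnion, Finset.image_image]
    congr 1
    refine Finset.image_congr fun k hk => ?_
    have hk' : parent k = j := by simpa using hk
    simp only [hk', and_self, if_true, Option.map_some, Option.getD_some, Function.comp]
    exact (ih hp' k).2.2.2

/-- Only the root block `0` is guaranteed the digest of the full row. Other blocks may update with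
partial digests and samples of their own, but the next broadcast overwrites their states. Hence
`Represents` constrains states only at the root, and only the root's sample enters the vertex
program. -/
theorem represents_succ (hpos : 0 < B ^ h) (s : ℕ) (a : Fin n → A) (out : Fin n → Fin n → Prop)
    (hr : g.Represents x (g.states x y (s * (2 * h + 2))) a out) :
    g.Represents x (g.states x y ((s + 1) * (2 * h + 2)))
      (fun u => (g.program s).update u (a u) ((g.program s).merge (Finset.univ.image fun v =>
        (g.program s).digest u v (x u v) (a u) (a v))) (rootSample y hpos s u))
      (fun u v => out u v ∨ (g.program s).emit u v (x u v) (a u) (a v)) := by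
  have hdown : ∀ u j, (g.states x y (s * (2 * h + 2) + h) (u, j)).state = a u := by
    intro u j
    rw [(g.states_down s le_rfl u j).2.2]
    exact hr.state _ _ (Nat.div_eq_of_lt j.2)
  have hword : ∀ u v, ((g.states x y (s * (2 * h + 2) + h) (u, g.blockOf v)).word
      (g.offset v) : ℕ) = x u v := by
    intro u v
    rw [(g.states_down s le_rfl u _).1, hr.word]
  have hexch := fun i => g.states_succ x y s h (by omega) i
  simp only [phaseStep, phaseLink, lt_irrefl, if_false, if_true] at hexch
  have hdig : ∀ u j, (g.states x y (s * (2 * h + 2) + (h + 1)) (u, j)).digest =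
      (g.program s).merge ((Finset.univ.filter fun v => g.blockOf v = j).image fun v =>
        (g.program s).digest u v (x u v) (a u) (a v)) := by
    intro u j
    rw [hexch]
    dsimp only
    congr 1
    refine Finset.image_congr fun v hv => ?_
    have hv' : g.blockOf v = j := by simpa using hv
    subst hv'
    simp only [and_self, if_true, Option.map_some, Option.getD_some, hdown, hword]
  have hup := fun u j => g.states_up s _ hdig le_rfl u j
  have hfin := fun i => g.states_succ x y s (2 * h + 1) (by omega) i
  have e1 : ¬ 2 * h + 1 < h := by omega
  have e2 : 2 * h + 1 ≠ h := by omega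
  simp only [phaseStep, phaseLink, e1, e2, lt_irrefl, if_false] at hfin
  have e3 : (s + 1) * (2 * h + 2) = s * (2 * h + 2) + (2 * h + 1 + 1) := by ring
  have e4 : h + 1 + h = 2 * h + 1 := by ring
  rw [e4] at hup
  constructor
  · intro u v
    rw [e3, hfin]
    dsimp only
    rw [(hup u _).1, hexch]
    exact hword u v
  · intro u v
    rw [e3, hfin]
    dsimp only
    rw [(hup u _).2.1, hexch]
    dsimp only
    rw [(g.states_down s le_rfl u _).2.1, Bool.or_eq_true, hr.flag]
    refine or_congr_right ?_
    rw [decide_eq_true_iff]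
    constructor
    · rintro ⟨v', hb, ho, he⟩
      have : v' = v := by
        ext
        rw [← g.blockOf_offset v', ← g.blockOf_offset v, hb, ho]
      subst this
      simpa [hdown, hword] using he
    · intro he
      exact ⟨v, rfl, rfl, by simpa [hdown, hword] using he⟩
  · intro u j hj
    rw [e3, hfin]
    dsimp only
    rw [(hup u _).2.2.1, (hup u _).2.2.2, hexch]
    dsimp only
    rw [hdown]
    have e5 : j = ⟨0, hpos⟩ := Fin.ext hj
    subst e5
    congr 3
    · ext v
      have : (v : ℕ) / B ^ (h + 1) = 0 :=
        Nat.div_eq_of_lt (by rw [pow_succ]; exact v.2.trans_le g.le_pow)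
      simp only [this, Finset.mem_filter, Finset.mem_univ, and_self]

theorem represents_states (hpos : 0 < B ^ h) (hx : ∀ u v, x u v < N) (s : ℕ) :
    g.Represents x (g.states x y (s * (2 * h + 2)))
      (vertexRun g.program x g.start (rootSample y hpos) s)
      (Emitted g.program x g.start (rootSample y hpos) s) := by
  induction s with
  | zero =>
    rw [zero_mul]
    constructor
    · intro u v
      simp only [Network.run, init, g.blockOf_offset]
      simp [Nat.mod_eq_of_lt (hx u v)]
    · simp [Network.run, init, Emitted]
    · intro u j _
      rfl
  | succ s ih =>
    have := g.represents_succ hpos s _ _ ih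
    constructor
    · exact this.word
    · intro u v
      rw [this.flag]
      simp only [Emitted, Nat.lt_succ_iff_lt_or_eq, or_and_right, exists_or, exists_eq_left]
    · exact this.state

/-! ### Bounds on the communication -/

theorem ncard_le_of_injOn {α : Type} {s : Set α} {k : ℕ} (f : α → Fin k) (hf : Set.InjOn f s) :
    s.ncard ≤ k := by
  have := Set.ncard_le_ncard (Set.subset_univ (f '' s)) Set.finite_univ
  rw [hf.ncard_image] at this
  simpa using this

theorem eq_of_div_mod {k l : ℕ} (h1 : k / B = l / B) (h2 : k % B = l % B) : k = l := by
  rw [← Nat.div_add_mod k B, ← Nat.div_add_mod l B, h1, h2]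

/-- In each phase a sender is determined by the receiver and one residue modulo `B`: nothing at all
for the parent, the offset of the vertex in the exchange, the residue of the block for a child.
`ncard_out` is the mirror image. -/
theorem ncard_in (t : ℕ) (i : Fin n × Fin (B ^ h)) : {j | g.network.link t i j}.ncard ≤ B := by
  simp only [network, phaseLink]
  have hB := g.pos
  split_ifs
  · refine ncard_le_of_injOn (fun _ => ⟨0, hB⟩) ?_
    rintro ⟨j, k⟩ ⟨rfl, h1⟩ ⟨j', k'⟩ ⟨h2, h3⟩ -
    dsimp only at *
    rw [h1, h3, ← h2]
  · refine ncard_le_of_injOn (fun j => g.offset j.1) ?_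
    rintro ⟨j, k⟩ ⟨h0, h1⟩ ⟨j', k'⟩ ⟨h2, h3⟩ h4
    refine Prod.ext (Fin.ext (eq_of_div_mod ?_ (Fin.ext_iff.1 h4))) (h1.symm.trans h3)
    exact Fin.ext_iff.1 (h0.trans h2.symm)
  · refine ncard_le_of_injOn (fun j => ⟨j.2 % B, Nat.mod_lt _ hB⟩) ?_
    rintro ⟨j, k⟩ ⟨h0, h1⟩ ⟨j', k'⟩ ⟨h2, h3⟩ h4
    refine Prod.ext (h0.symm.trans h2) (Fin.ext (eq_of_div_mod ?_ (Fin.ext_iff.1 h4)))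
    exact Fin.ext_iff.1 (h1.trans h3.symm)
  · simp

theorem ncard_out (t : ℕ) (j : Fin n × Fin (B ^ h)) : {i | g.network.link t i j}.ncard ≤ B := by
  simp only [network, phaseLink]
  have hB := g.pos
  split_ifs
  · refine ncard_le_of_injOn (fun i => ⟨i.2 % B, Nat.mod_lt _ hB⟩) ?_
    rintro ⟨i, k⟩ ⟨h0, h1⟩ ⟨i', k'⟩ ⟨h2, h3⟩ h4
    refine Prod.ext (h0.trans h2.symm) (Fin.ext (eq_of_div_mod ?_ (Fin.ext_iff.1 h4)))
    exact Fin.ext_iff.1 (h1.symm.trans h3)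
  · refine ncard_le_of_injOn (fun i => g.offset i.1) ?_
    rintro ⟨i, k⟩ ⟨h0, h1⟩ ⟨i', k'⟩ ⟨h2, h3⟩ h4
    refine Prod.ext (Fin.ext (eq_of_div_mod ?_ (Fin.ext_iff.1 h4))) (h0.symm.trans h2)
    exact Fin.ext_iff.1 (h1.trans h3.symm)
  · refine ncard_le_of_injOn (fun _ => ⟨0, hB⟩) ?_
    rintro ⟨i, k⟩ ⟨h0, h1⟩ ⟨i', k'⟩ ⟨h2, h3⟩ -
    dsimp only at *
    rw [h0, h2, ← h1, h3]
  · simp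

/-! ### Realization by words -/

/-- The machine that holds an entry. -/
def dest (p : Fin n × Fin n) : Fin n × Fin (B ^ h) := (p.1, g.blockOf p.2)

theorem card_dest (i : Fin n × Fin (B ^ h)) :
    (Finset.univ.filter fun p => g.dest p = i).card ≤ B := by
  have : (Finset.univ.filter fun p => g.dest p = i).card ≤ (Finset.univ : Finset (Fin B)).card := by
    refine Finset.card_le_card_of_injOn (fun p => g.offset p.2) (fun _ _ => Finset.mem_univ _) ?_
    rintro ⟨u, v⟩ hp ⟨u', v'⟩ hq h4
    have h5 : g.dest (u, v) = g.dest (u', v') := by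
      rw [(Finset.mem_filter.1 hp).2, (Finset.mem_filter.1 hq).2]
    have h6 : u = u' := congrArg Prod.fst h5
    refine Prod.ext h6 (Fin.ext (eq_of_div_mod ?_ (Fin.ext_iff.1 h4)))
    exact Fin.ext_iff.1 (congrArg Prod.snd h5)
  simpa using this

theorem init_congr (i : Fin n × Fin (B ^ h)) (x x' : Fin n → Fin n → ℕ)
    (hx : ∀ p, g.dest p = i → x p.1 p.2 = x' p.1 p.2) : g.init i x = g.init i x' := by
  unfold init
  congr 1
  funext b
  split_ifs with hv
  · congr 2
    refine hx (i.1, ⟨i.2 * B + b, hv⟩) ?_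
    simp only [dest]
    rw [(g.blockOf_eq_of hv rfl).1]
  · rfl

/-- The edges marked by a machine. -/
def marked (i : Fin n × Fin (B ^ h)) (s : GridState B N A G) : List (Fin n × Fin n) :=
  (List.finRange B).filterMap fun b =>
    if hb : s.flag b = true ∧ (i.2 : ℕ) * B + b < n then some (i.1, ⟨i.2 * B + b, hb.2⟩) else none

theorem mem_marked {i : Fin n × Fin (B ^ h)} {s : GridState B N A G} {p : Fin n × Fin n} :
    p ∈ marked i s ↔ g.dest p = i ∧ s.flag (g.offset p.2) = true := by
  simp only [marked, List.mem_filterMap, List.mem_finRange, true_and,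
    Option.dite_none_right_eq_some, Option.some.injEq]
  constructor
  · rintro ⟨b, ⟨hb, hv⟩, rfl⟩
    obtain ⟨h1, h2⟩ := g.blockOf_eq_of hv rfl
    exact ⟨by simp only [dest, h1], by simp only [h2, hb]⟩
  · rintro ⟨rfl, hf⟩
    refine ⟨g.offset p.2, ⟨hf, ?_⟩, ?_⟩
    · simp only [dest, g.blockOf_offset, Fin.is_lt]
    · simp only [dest, g.blockOf_offset]

theorem length_marked_le (i : Fin n × Fin (B ^ h)) (s : GridState B N A G) :
    (marked i s).length ≤ B := by
  refine le_of_le_of_eq ?_ (List.length_finRange (n := B))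
  exact List.length_filterMap_le (fun b : Fin B =>
    if hb : s.flag b = true ∧ (i.2 : ℕ) * B + b < n then
      some (i.1, (⟨i.2 * B + b, hb.2⟩ : Fin n)) else none) (List.finRange B)

/-- The edges output by the first `s` instructions of a vertex program. -/
def emittedEdges (I : ℕ → Instruction n A G Y) (x : Fin n → Fin n → ℕ) (a₀ : Fin n → A)
    (y : ℕ → Fin n → Y) (s : ℕ) : Finset (Sym2 (Fin n)) :=
  Finset.univ.filter fun e => ∃ u v, e = s(u, v) ∧ Emitted I x a₀ y s u v

/-- The realization of the grid by machines of the MPC model. -/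
def realization (encState : GridState B N A G → List ℕ) (encMessage : A × G → List ℕ)
    (sample : unitInterval → Y) (h₁ : Function.Injective encState)
    (h₂ : Function.Injective encMessage) (h₃ : ∀ m, encMessage m ≠ [])
    (h₄ : ∀ s : Set Y, MeasurableSet (sample ⁻¹' s)) :
    Network.Realization n (n * B ^ h) (Fin n × Fin (B ^ h)) (GridState B N A G) (A × G) Y where
  index := finProdFinEquiv
  encState := encState
  encMessage := encMessage
  sample := sample
  dest := g.dest
  init := g.init
  final i s := edgeWords (marked i s)
  encState_injective := h₁
  encMessage_injective := h₂
  encMessage_ne_nil := h₃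
  measurable_sample := h₄
  init_congr := g.init_congr

/-- A flag costs at most a word since `2 ≤ N`, so the entries with flags take `2 * B` words, and the
vertex state and the digest `D` words each. -/
theorem finite_gridState [Finite A] [Finite G] {D : ℕ} (hN : 2 ≤ N) (hA : Nat.card A ≤ N ^ D)
    (hG : Nat.card G ≤ N ^ D) :
    Finite (GridState B N A G) ∧ Nat.card (GridState B N A G) ≤ N ^ (2 * B + 2 * D) := by
  let f : GridState B N A G → (Fin B → Fin N) × (Fin B → Bool) × A × G :=
    fun s => (s.word, s.flag, s.state, s.digest)
  have hf : Function.Injective f := by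
    rintro ⟨a, b, c, d⟩ ⟨a', b', c', d'⟩ h
    simpa [f] using h
  refine ⟨Finite.of_injective f hf, (Nat.card_le_card_of_injective f hf).trans ?_⟩
  have h1 : Nat.card (Fin B → Bool) ≤ N ^ B := by
    simpa using Nat.pow_le_pow_left hN B
  have h2 : Nat.card (Fin B → Fin N) = N ^ B := by simp
  rw [Nat.card_prod, Nat.card_prod, Nat.card_prod, h2]
  calc _ ≤ N ^ B * (N ^ B * (N ^ D * N ^ D)) := by gcongr
    _ = N ^ (2 * B + 2 * D) := by ring

/-- The space must cover a state of `2 * B + 2 * D` words together with `B` messages of `2 * D`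
words, and also the `B` input triples delivered to a machine. The maps `time` and `root` expose
which uniform samples matter; their injectivity will give independence. -/
theorem exists_algorithm [Finite A] [Finite G] {D : ℕ} (hD : 0 < D) (hN : 2 ≤ N)
    (hnN : n ≤ N) (hA : Nat.card A ≤ N ^ D) (hG : Nat.card G ≤ N ^ D)
    (sample : unitInterval → Y) (hsample : ∀ s : Set Y, MeasurableSet (sample ⁻¹' s))
    {S : ℕ} (hS : 3 * B + 2 * D + B * (2 * D) ≤ S) (s : ℕ) :
    ∃ (𝒜 : MPCAlgorithm (n * B ^ h)) (time : Fin s → Fin 𝒜.rounds) (root : Fin n → Fin (n * B ^ h)),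
      𝒜.rounds = s * (2 * h + 2) + 3 ∧ Function.Injective time ∧ Function.Injective root ∧
      ∀ x : Fin n → Fin n → ℕ, (∀ u v, x u v < N) → ∀ place : Fin n × Fin n → Fin (n * B ^ h),
        (∀ i, 3 * (Finset.univ.filter fun e => place e = i).card ≤ S) → ∀ ξ,
        (∀ r ≤ 𝒜.rounds, (𝒜.run (initialMemory place x) ξ r).Fits S N) ∧
        𝒜.output n (initialMemory place x) ξ = emittedEdges g.program x g.start
          (fun t u => sample (if ht : t < s then ξ (time ⟨t, ht⟩) (root u) else 0)) s := by
  obtain ⟨hfin, hcard⟩ := finite_gridState (B := B) hN hA hG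
  obtain ⟨encS, hS1, hS2, hS3⟩ := exists_encoding hcard
  have hcardM : Nat.card (A × G) ≤ N ^ (2 * D) := by
    rw [Nat.card_prod, two_mul, pow_add]
    exact Nat.mul_le_mul hA hG
  obtain ⟨encM, hM1, hM2, hM3⟩ := exists_encoding hcardM
  have hne : ∀ m, encM m ≠ [] := fun m hm => by
    have := hM2 m
    rw [hm] at this
    simp only [List.length_nil] at this
    omega
  have hpos : 0 < B ^ h := Nat.pow_pos g.pos
  have htime : ∀ t < s, t * (2 * h + 2) + (2 * h + 1) + 2 < s * (2 * h + 2) + 3 := fun t ht => by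
    have := Nat.mul_le_mul_right (2 * h + 2) (Nat.succ_le_of_lt ht)
    rw [Nat.succ_mul] at this
    omega
  let R := g.realization encS encM sample hS1 hM1 hne hsample
  have hF : R.Fits g.network S N (2 * B + 2 * D) (2 * D) B B :=
    { length_state := fun s => (hS2 s).le
      state_lt := hS3
      length_message := fun m => (hM2 m).le
      message_lt := hM3
      card_in := g.ncard_in
      card_out := g.ncard_out
      in_le := by omega
      out_le := by omega
      card_dest := fun i => by
        have h1 : 3 * B ≤ S := by omega
        refine le_trans (le_of_eq ?_) ((Nat.mul_le_mul_left 3 (g.card_dest i)).trans h1)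
        congr!
      length_final := fun i s => by
        have h1 := length_marked_le i s
        have h2 : (edgeWords (marked i s)).length = 2 * (marked i s).length := by
          simp [edgeWords, List.length_flatMap, mul_comm]
        change (edgeWords (marked i s)).length ≤ S
        omega
      final_lt := by
        intro i s a ha
        change a ∈ edgeWords (marked i s) at ha
        simp only [edgeWords, List.mem_flatMap, List.mem_cons, List.not_mem_nil, or_false] at ha
        obtain ⟨p, -, rfl | rfl⟩ := ha
        · exact p.1.2.trans_le hnN
        · exact p.2.2.trans_le hnN
      le_bound := hnN }
  refine ⟨R.algorithm g.network (s * (2 * h + 2)),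
    -- The sample of instruction `t` is used in its last phase, numbered `2 * h + 1`; the final `+
    -- 2` skips the input rounds.
    fun t => ⟨t * (2 * h + 2) + (2 * h + 1) + 2, htime t t.2⟩,
    fun u => finProdFinEquiv (u, ⟨0, hpos⟩), rfl, ?_, ?_, ?_⟩
  · intro t t' ht
    have : (t : ℕ) * (2 * h + 2) = t' * (2 * h + 2) := by
      have := Fin.ext_iff.1 ht
      simp only at this
      omega
    exact Fin.ext (Nat.eq_of_mul_eq_mul_right (by omega) this)
  · intro u u' hu
    exact congrArg Prod.fst (finProdFinEquiv.injective hu)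
  · intro x hx place hplace ξ
    refine ⟨R.fits_run g.network place x hF _ hx hplace ξ, ?_⟩
    have hrep := g.represents_states (x := x) (y := R.samples ξ) hpos hx s
    have hy : rootSample (R.samples ξ) hpos = fun t u => sample (if ht : t < s then
        ξ ⟨t * (2 * h + 2) + (2 * h + 1) + 2, htime t ht⟩ (finProdFinEquiv (u, ⟨0, hpos⟩))
        else 0) := by
      funext t u
      simp only [rootSample, Network.Realization.samples]
      change sample _ = sample _
      congr 1
      by_cases ht : t < s
      · rw [dif_pos ht, dif_pos (htime t ht)]
        rfl
      · rw [dif_neg ht, dif_neg]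
        have := Nat.mul_le_mul_right (2 * h + 2) (Nat.le_of_not_lt ht)
        omega
    rw [hy] at hrep
    have hrun := R.run_last g.network place x (s * (2 * h + 2)) ξ
    have hout : (R.algorithm g.network (s * (2 * h + 2))).output n (initialMemory place x) ξ =
        writtenEdges n (fun i => edgeWords (marked (R.index.symm i)
          (g.states x (R.samples ξ) (s * (2 * h + 2)) (R.index.symm i)))) :=
      congrArg (fun c : Config (n * B ^ h) => writtenEdges n c.memory) hrun
    rw [hout, writtenEdges_edgeWords]
    unfold emittedEdges
    congr 1
    funext e
    simp only [eq_iff_iff, g.mem_marked]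
    constructor
    · rintro ⟨i, p, ⟨h1, h2⟩, rfl⟩
      refine ⟨p.1, p.2, rfl, (hrep.flag p.1 p.2).1 ?_⟩
      rw [← h1] at h2
      exact h2
    · rintro ⟨u, v, rfl, huv⟩
      refine ⟨R.index (g.dest (u, v)), (u, v), ⟨by simp, ?_⟩, rfl⟩
      rw [Equiv.symm_apply_apply]
      exact (hrep.flag u v).2 huv

end Grid

/-! ## Selecting a minimal candidate -/

/-- A candidate: up to two words, three vertices and a bit. -/
structure Candidate (n N : ℕ) where
  word : Fin N
  delay : Fin N
  source : Fin n
  target : Fin n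
  label : Fin n
  bit : Bool

namespace Candidate

variable {n N : ℕ}

theorem toProd_injective : Function.Injective fun c : Candidate n N =>
    (c.word, c.delay, c.source, c.target, c.label, c.bit) := by
  rintro ⟨_, _, _, _, _, _⟩ ⟨_, _, _, _, _, _⟩ h
  simpa using h

instance : Finite (Candidate n N) := Finite.of_injective _ toProd_injective

/-- Six fields with at most `N` values each; a seventh factor pays for `none`. -/
theorem card_option_le (hN : 2 ≤ N) (hn : n ≤ N) : Nat.card (Option (Candidate n N)) ≤ N ^ 7 := by
  have h : Nat.card (Candidate n N) ≤ N ^ 6 := by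
    refine (Nat.card_le_card_of_injective _ toProd_injective).trans ?_
    simp only [Nat.card_prod, Nat.card_eq_fintype_card (α := Fin _),
      Nat.card_eq_fintype_card (α := Bool), Fintype.card_fin, Fintype.card_bool]
    calc _ ≤ N * (N * (N * (N * (N * N)))) := by gcongr
      _ = N ^ 6 := by ring
  rw [Finite.card_option]
  have : 1 ≤ N ^ 6 := Nat.one_le_pow _ _ (by omega)
  calc _ ≤ N ^ 6 * 2 := by omega
    _ ≤ N ^ 6 * N := by gcongr
    _ = N ^ 7 := by ring

/-- A key refined to an injective one. -/
def fullKey (key : Candidate n N → ℝ ×ₗ ℕ) (c : Candidate n N) : (ℝ ×ₗ ℕ) ×ₗ ℕ :=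
  toLex (key c, (Finite.equivFin (Candidate n N) c : ℕ))

theorem fullKey_injective (key : Candidate n N → ℝ ×ₗ ℕ) : Function.Injective (fullKey key) := by
  intro c c' h
  have := congrArg (fun z => (ofLex z).2) h
  exact (Finite.equivFin (Candidate n N)).injective (Fin.ext this)

theorem key_le_of_fullKey_le {key : Candidate n N → ℝ ×ₗ ℕ} {c c' : Candidate n N}
    (h : fullKey key c ≤ fullKey key c') : key c ≤ key c' := by
  rcases Prod.Lex.toLex_le_toLex.1 h with h | h
  · exact h.le
  · exact h.1.le

/-- The candidate with the least key in a set of possible candidates. -/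
def pick (key : Candidate n N → ℝ ×ₗ ℕ) (s : Finset (Option (Candidate n N))) :
    Option (Candidate n N) :=
  if h : ∃ c, some c ∈ s ∧ ∀ c', some c' ∈ s → fullKey key c ≤ fullKey key c' then
    some h.choose else none

/-- The refined key is injective, so the minimizer is unique and the choice in `pick` is forced. -/
theorem pick_eq_some_iff {key : Candidate n N → ℝ ×ₗ ℕ} {s : Finset (Option (Candidate n N))}
    {c : Candidate n N} : pick key s = some c ↔
      some c ∈ s ∧ ∀ c', some c' ∈ s → fullKey key c ≤ fullKey key c' := by
  unfold pick
  constructor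
  · intro h
    split_ifs at h with hex
    obtain rfl := Option.some.inj h
    exact hex.choose_spec
  · intro h
    have hex : ∃ c, some c ∈ s ∧ ∀ c', some c' ∈ s → fullKey key c ≤ fullKey key c' := ⟨c, h⟩
    rw [dif_pos hex]
    congr 1
    exact fullKey_injective key (le_antisymm (hex.choose_spec.2 _ h.1) (h.2 _ hex.choose_spec.1))

theorem exists_pick_eq_some {key : Candidate n N → ℝ ×ₗ ℕ} {s : Finset (Option (Candidate n N))}
    {c : Candidate n N} (hc : some c ∈ s) :
    ∃ c', pick key s = some c' ∧ fullKey key c' ≤ fullKey key c := by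
  have hne : s.eraseNone.Nonempty := ⟨c, Finset.mem_eraseNone.2 hc⟩
  obtain ⟨c', h1, h2⟩ := Finset.exists_min_image _ (fullKey key) hne
  simp only [Finset.mem_eraseNone] at h1 h2
  exact ⟨c', pick_eq_some_iff.2 ⟨h1, h2⟩, h2 c hc⟩

/-- The minimum of a union is the minimum of the minima, with `none` for empty parts. This is the
law that lets a selection be evaluated along a tree. -/
theorem pick_biUnion (key : Candidate n N → ℝ ×ₗ ℕ) {ι : Type} (s : Finset ι)
    (f : ι → Finset (Option (Candidate n N))) :
    pick key (s.biUnion f) = pick key (s.image fun i => pick key (f i)) := by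
  ext c
  rw [← Option.some_inj, Option.some_inj, pick_eq_some_iff, pick_eq_some_iff]
  simp only [Finset.mem_biUnion, Finset.mem_image]
  constructor
  · rintro ⟨⟨i, hi, hc⟩, hmin⟩
    refine ⟨⟨i, hi, pick_eq_some_iff.2 ⟨hc, fun c' hc' => hmin c' ⟨i, hi, hc'⟩⟩⟩, ?_⟩
    rintro c' ⟨j, hj, hc'⟩
    exact hmin c' ⟨j, hj, (pick_eq_some_iff.1 hc').1⟩
  · rintro ⟨⟨i, hi, hc⟩, hmin⟩
    refine ⟨⟨i, hi, (pick_eq_some_iff.1 hc).1⟩, ?_⟩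
    rintro c' ⟨j, hj, hc'⟩
    obtain ⟨c'', h1, h2⟩ := exists_pick_eq_some (key := key) hc'
    exact (hmin c'' ⟨j, hj, h1⟩).trans h2

variable {V : Type} [Fintype V]

/-- The candidate with the least key among the values of `f`. -/
def best (key : Candidate n N → ℝ ×ₗ ℕ) (f : V → Option (Candidate n N)) :
    Option (Candidate n N) := pick key (Finset.univ.image f)

theorem best_eq_some {key : Candidate n N → ℝ ×ₗ ℕ} {f : V → Option (Candidate n N)}
    {c : Candidate n N} (h : best key f = some c) :
    (∃ v, f v = some c) ∧ ∀ v c', f v = some c' → key c ≤ key c' := by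
  obtain ⟨h1, h2⟩ := pick_eq_some_iff.1 h
  refine ⟨by simpa using h1, fun v c' hc' => key_le_of_fullKey_le (h2 c' ?_)⟩
  simpa using ⟨v, hc'⟩

theorem best_eq_none {key : Candidate n N → ℝ ×ₗ ℕ} {f : V → Option (Candidate n N)} :
    best key f = none ↔ ∀ v, f v = none := by
  constructor
  · intro h v
    by_contra hv
    obtain ⟨c, hc⟩ := Option.ne_none_iff_exists'.1 hv
    obtain ⟨c', h1, -⟩ := exists_pick_eq_some (key := key)
      (Finset.mem_image.2 ⟨v, Finset.mem_univ v, hc⟩)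
    simp [best, h1] at h
  · intro h
    by_contra hv
    obtain ⟨c, hc⟩ := Option.ne_none_iff_exists'.1 hv
    obtain ⟨⟨v, hv⟩, -⟩ := best_eq_some hc
    simp [h v] at hv

/-- The candidate consisting of a vertex with a label and a bit. -/
def ofVertex [NeZero N] (v l : Fin n) (b : Bool) : Candidate n N := ⟨0, 0, v, v, l, b⟩

/-- Candidates ordered by their target. -/
def targetKey (c : Candidate n N) : ℝ ×ₗ ℕ := toLex (0, (c.target : ℕ))

theorem targetKey_le {c c' : Candidate n N} : targetKey c ≤ targetKey c' ↔ c.target ≤ c'.target := by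
  simp [targetKey, Prod.Lex.toLex_le_toLex]

end Candidate

/-! ## The vertex program -/

/-- What a vertex remembers about one level. -/
structure LevelState (n N : ℕ) where
  delay : Fin N
  center : Fin n
  mpx : Fin n
  label : Fin n
  hier : Fin n
  incomplete : Bool
  coin : Bool
  repCoin : Bool
  best : Option (Candidate n N)

namespace LevelState

variable {n N : ℕ}

theorem toProd_injective : Function.Injective fun s : LevelState n N =>
    (s.delay, s.center, s.mpx, s.label, s.hier, s.incomplete, s.coin, s.repCoin, s.best) := by
  rintro ⟨_, _, _, _, _, _, _, _, _⟩ ⟨_, _, _, _, _, _, _, _, _⟩ h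
  simpa using h

instance : Finite (LevelState n N) := Finite.of_injective _ toProd_injective

theorem card_le (hN : 2 ≤ N) (hn : n ≤ N) : Nat.card (LevelState n N) ≤ N ^ 15 := by
  refine (Nat.card_le_card_of_injective _ toProd_injective).trans ?_
  have := Candidate.card_option_le hN hn
  simp only [Nat.card_prod, Nat.card_eq_fintype_card (α := Fin _),
    Nat.card_eq_fintype_card (α := Bool), Fintype.card_fin, Fintype.card_bool]
  calc _ ≤ N * (N * (N * (N * (N * (N * (N * (N * N ^ 7))))))) := by gcongr
    _ = N ^ 15 := by ring

end LevelState

/-- The state of a vertex: one record for each level. -/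
abbrev VertexState (n N L : ℕ) : Type := Fin L → LevelState n N

/-- The samples of a vertex: a delay code and a coin for each level. -/
abbrev VertexSample (N L : ℕ) : Type := (Fin L → Fin N) × (Fin L → Bool)

/-- The instructions that occur in the program. -/
abbrev LevelInstruction (n N L : ℕ) : Type :=
  Instruction n (VertexState n N L) (Fin L → Option (Candidate n N)) (VertexSample N L)

/-- An instruction that, for each level, selects a candidate with minimal key. -/
def selectInstruction {n N L : ℕ} (key : Fin L → Candidate n N → ℝ ×ₗ ℕ)
    (f : Fin n → Fin n → ℕ → VertexState n N L → VertexState n N L → Fin L →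
      Option (Candidate n N))
    (emit : Fin n → Fin n → ℕ → VertexState n N L → VertexState n N L → Prop)
    (update : Fin n → VertexState n N L → (Fin L → Option (Candidate n N)) → VertexSample N L →
      VertexState n N L) : LevelInstruction n N L where
  digest := f
  merge s k := Candidate.pick (key k) (s.image fun g => g k)
  merge_biUnion s g := by
    funext k
    -- Stated for an arbitrary decidability instance, so that it matches the one carried by the
    -- structure field.
    have h1 (inst : DecidableEq (Fin L → Option (Candidate n N))) :
        (@Finset.biUnion _ _ inst s g).image (fun d => d k) =
          s.biUnion fun i => (g i).image fun d => d k := by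
      ext c
      simp only [Finset.mem_image, Finset.mem_biUnion]
      exact ⟨fun ⟨d, ⟨i, hi, hd⟩, h⟩ => ⟨i, hi, d, hd, h⟩, fun ⟨i, hi, d, hd, h⟩ =>
        ⟨d, ⟨i, hi, hd⟩, h⟩⟩
    refine (congrArg _ (h1 _)).trans ((Candidate.pick_biUnion _ _ _).trans (congrArg _ ?_))
    ext c
    simp only [Finset.mem_image, exists_exists_and_eq_and]
  emit := emit
  update := update

/-! ### Effect of one instruction on states and output -/

section Exec

variable {n : ℕ} {A G Y : Type}

/-- The effect of an instruction on the states of the vertices. -/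
def Instruction.exec (I : Instruction n A G Y) (x : Fin n → Fin n → ℕ) (a : Fin n → A)
    (y : Fin n → Y) (u : Fin n) : A :=
  I.update u (a u) (I.merge (Finset.univ.image fun v => I.digest u v (x u v) (a u) (a v))) (y u)

/-- The edges output by an instruction. -/
def Instruction.emitted (I : Instruction n A G Y) (x : Fin n → Fin n → ℕ) (a : Fin n → A) :
    Finset (Sym2 (Fin n)) :=
  Finset.univ.filter fun e => ∃ u v, e = s(u, v) ∧ I.emit u v (x u v) (a u) (a v)

theorem vertexRun_succ (I : ℕ → Instruction n A G Y) (x : Fin n → Fin n → ℕ) (a₀ : Fin n → A)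
    (y : ℕ → Fin n → Y) (s : ℕ) :
    vertexRun I x a₀ y (s + 1) = (I s).exec x (vertexRun I x a₀ y s) (y s) := rfl

theorem mem_emittedEdges {I : ℕ → Instruction n A G Y} {x : Fin n → Fin n → ℕ} {a₀ : Fin n → A}
    {y : ℕ → Fin n → Y} {s : ℕ} {e : Sym2 (Fin n)} : e ∈ Grid.emittedEdges I x a₀ y s ↔
      ∃ u v, e = s(u, v) ∧ Emitted I x a₀ y s u v := by
  simp [Grid.emittedEdges]

theorem Instruction.mem_emitted {I : Instruction n A G Y} {x : Fin n → Fin n → ℕ} {a : Fin n → A}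
    {e : Sym2 (Fin n)} : e ∈ I.emitted x a ↔
      ∃ u v, e = s(u, v) ∧ I.emit u v (x u v) (a u) (a v) := by
  simp [Instruction.emitted]

theorem emittedEdges_zero (I : ℕ → Instruction n A G Y) (x : Fin n → Fin n → ℕ) (a₀ : Fin n → A)
    (y : ℕ → Fin n → Y) : Grid.emittedEdges I x a₀ y 0 = ∅ := by
  simp [Grid.emittedEdges, Emitted]

theorem emittedEdges_succ (I : ℕ → Instruction n A G Y) (x : Fin n → Fin n → ℕ) (a₀ : Fin n → A)
    (y : ℕ → Fin n → Y) (s : ℕ) :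
    Grid.emittedEdges I x a₀ y (s + 1) =
      Grid.emittedEdges I x a₀ y s ∪ (I s).emitted x (vertexRun I x a₀ y s) := by
  ext e
  simp only [Finset.mem_union, mem_emittedEdges, Instruction.mem_emitted, Emitted,
    Nat.lt_succ_iff_lt_or_eq, or_and_right, exists_or, exists_eq_left, and_or_left]

end Exec

theorem exec_selectInstruction {n N L : ℕ} (key : Fin L → Candidate n N → ℝ ×ₗ ℕ)
    (f : Fin n → Fin n → ℕ → VertexState n N L → VertexState n N L → Fin L →
      Option (Candidate n N))
    (emit : Fin n → Fin n → ℕ → VertexState n N L → VertexState n N L → Prop)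
    (update : Fin n → VertexState n N L → (Fin L → Option (Candidate n N)) → VertexSample N L →
      VertexState n N L) (x : Fin n → Fin n → ℕ) (a : Fin n → VertexState n N L)
    (y : Fin n → VertexSample N L) (u : Fin n) :
    (selectInstruction key f emit update).exec x a y u = update u (a u)
      (fun k => Candidate.best (key k) fun v => f u v (x u v) (a u) (a v) k) (y u) := by
  simp only [Instruction.exec, selectInstruction, Candidate.best]
  congr 1
  funext k
  congr 1
  ext c
  simp only [Finset.mem_image, exists_exists_eq_and, Finset.mem_univ, true_and]

/-! ### Representing partitions by labels -/

section Rep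

variable {n : ℕ}

theorem rep_eq_iff (P : Setoid (Fin n)) (u v : Fin n) :
    rep P u = v ↔ P u v ∧ ∀ z, P u z → v ≤ z := by
  unfold rep
  constructor
  · rintro rfl
    refine ⟨by simpa using Finset.min'_mem (Finset.univ.filter fun v => P u v) _, fun z hz => ?_⟩
    exact Finset.min'_le _ _ (by simpa using hz)
  · rintro ⟨h1, h2⟩
    refine le_antisymm (Finset.min'_le _ _ (by simpa using h1)) (Finset.le_min' _ _ _ fun z hz => ?_)
    exact h2 z (by simpa using hz)

theorem rel_rep (P : Setoid (Fin n)) (u : Fin n) : P u (rep P u) := ((rep_eq_iff P u _).1 rfl).1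

theorem rep_eq_rep_iff (P : Setoid (Fin n)) (u v : Fin n) : rep P u = rep P v ↔ P u v := by
  constructor
  · intro h
    exact P.trans (rel_rep P u) (h ▸ P.symm (rel_rep P v))
  · intro h
    rw [rep_eq_iff]
    exact ⟨P.trans h (rel_rep P v), fun z hz =>
      ((rep_eq_iff P v _).1 rfl).2 z (P.trans (P.symm h) hz)⟩

theorem rep_rep (P : Setoid (Fin n)) (u : Fin n) : rep P (rep P u) = rep P u :=
  (rep_eq_rep_iff P _ _).2 (P.symm (rel_rep P u))

theorem rep_bot (u : Fin n) : rep (⊥ : Setoid (Fin n)) u = u := by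
  rw [rep_eq_iff]
  exact ⟨rfl, fun z hz => le_of_eq (by simpa [Setoid.bot_def] using hz)⟩

theorem rep_left_iff (P : Setoid (Fin n)) (u v : Fin n) : P (rep P u) v ↔ P u v :=
  ⟨P.trans (rel_rep P u), P.trans (P.symm (rel_rep P u))⟩

end Rep

open Candidate (ofVertex targetKey best)

/-! ### The individual instructions and what they compute -/

section Program

variable {n N L : ℕ} [NeZero N] (val : ℕ → ℝ) (scale : Fin L → ℝ) (α : ℝ)

/-- The name of the set of the next coarser MPX partition that contains a vertex. -/
def coarseLabel (s : VertexState n N L) (k : Fin L) : Option (Fin n) :=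
  if h : (k : ℕ) + 1 < L then some (s ⟨k + 1, h⟩).mpx else none

/-- Store the delays. -/
def drawDelays : LevelInstruction n N L :=
  selectInstruction (fun _ => targetKey) (fun _ _ _ _ _ _ => none) (fun _ _ _ _ _ => False)
    (fun _ s _ y k => { s k with delay := y.1 k })

/-- Compute the centers. -/
def findCenters : LevelInstruction n N L :=
  selectInstruction (fun k c => toLex (val c.word - scale k * c.delay, (c.target : ℕ)))
    (fun _ v w _ s' k => if hw : w < N then some ⟨⟨w, hw⟩, (s' k).delay, v, v, v, false⟩ else none)
    (fun _ _ _ _ _ => False)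
    (fun u s g _ k => { s k with center := (g k).elim u Candidate.target })

/-- Name the sets of the MPX partitions. -/
def nameMpx : LevelInstruction n N L :=
  selectInstruction (fun _ => targetKey)
    (fun _ v _ s s' k => if ∀ i, k ≤ i → (s i).center = (s' i).center then
      some (ofVertex v v false) else none)
    (fun _ _ _ _ _ => False)
    (fun u s g _ k => { s k with
      mpx := (g k).elim u Candidate.target, label := (g k).elim u Candidate.target })

/-- Flip the coins. -/
def drawCoins : LevelInstruction n N L :=
  selectInstruction (fun _ => targetKey) (fun _ _ _ _ _ _ => none) (fun _ _ _ _ _ => False)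
    (fun _ s _ y k => { s k with coin := y.2 k })

/-- Fetch the coin of the set that contains the vertex. -/
def fetchCoins : LevelInstruction n N L :=
  selectInstruction (fun _ => targetKey)
    (fun _ v _ s s' k => if (s k).label = v then some (ofVertex v v (s' k).coin) else none)
    (fun _ _ _ _ _ => False)
    (fun _ s g _ k => { s k with repCoin := (g k).elim false Candidate.bit })

/-- The best candidate of a set is the best one of its vertices. -/
def selectInSet (key : Candidate n N → ℝ ×ₗ ℕ) : LevelInstruction n N L :=
  selectInstruction (fun _ => key)
    (fun _ _ _ s s' k => if (s k).label = (s' k).label then (s' k).best else none)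
    (fun _ _ _ _ _ => False)
    (fun _ s g _ k => { s k with best := g k })

/-- The edges available in leader compression. -/
def LeaderEdge (s s' : VertexState n N L) (w : ℕ) (u v : Fin n) (k : Fin L) : Prop :=
  u ≠ v ∧ val w ≤ α ^ (k : ℕ) ∧ coarseLabel s k = coarseLabel s' k

/-- The least neighbor through which a vertex could join another set. -/
def findLeader : LevelInstruction n N L :=
  selectInstruction (fun _ => targetKey)
    (fun u v w s s' k => if LeaderEdge val α s s' w u v k ∧ (s k).label ≠ (s' k).label ∧
      (s' k).repCoin = true then some (ofVertex v (s' k).label true) else none)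
    (fun _ _ _ _ _ => False)
    (fun _ s g _ k => { s k with best := g k })

/-- The name of the set that the set of a vertex joins, or else its own name. -/
def newLabel (s : LevelState n N) : Fin n :=
  if s.repCoin = false then
    s.best.elim s.label fun c => if c.bit = true then c.label else s.label
  else s.label

/-- The edge `uv` is used by the modified Borůvka algorithm. -/
def JoinEdge (s : LevelState n N) (u v : Fin n) : Prop :=
  s.repCoin = false ∧ ∃ c, s.best = some c ∧ c.source = u ∧ c.target = v ∧ c.bit = true

/-- Name the sets after a round of joining, possibly outputting the edges used. -/
def relabel (out : Bool) : LevelInstruction n N L :=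
  selectInstruction (fun _ => targetKey)
    (fun _ v _ s s' k => if newLabel (s k) = newLabel (s' k) then some (ofVertex v v false) else none)
    (fun u v _ s _ => out = true ∧ ∃ k, JoinEdge (s k) u v)
    (fun u s g _ k => { s k with label := (g k).elim u Candidate.target })

/-- Find the vertices with outgoing edges. -/
def findIncomplete : LevelInstruction n N L :=
  selectInstruction (fun _ => targetKey)
    (fun u v w s s' k => if LeaderEdge val α s s' w u v k ∧ (s k).label ≠ (s' k).label then
      some (ofVertex v v false) else none)
    (fun _ _ _ _ _ => False)
    (fun _ s g _ k => { s k with incomplete := (g k).isSome })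

/-- Find the sets with outgoing edges. -/
def spreadIncomplete : LevelInstruction n N L :=
  selectInstruction (fun _ => targetKey)
    (fun _ v _ s s' k => if (s k).label = (s' k).label ∧ (s' k).incomplete = true then
      some (ofVertex v v false) else none)
    (fun _ _ _ _ _ => False)
    (fun _ s g _ k => { s k with incomplete := (g k).isSome })

/-- Two vertices are in the same set after the incomplete sets have been joined. -/
def SameJoined (s s' : VertexState n N L) (k : Fin L) : Prop :=
  (s k).incomplete = (s' k).incomplete ∧
    if (s k).incomplete = true then coarseLabel s k = coarseLabel s' k
    else (s k).label = (s' k).label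

/-- Name the sets of the final hierarchy, and prepare the modified Borůvka algorithm. -/
def nameHierarchy : LevelInstruction n N L :=
  selectInstruction (fun _ => targetKey)
    (fun _ v _ s s' k => if SameJoined s s' k then some (ofVertex v v false) else none)
    (fun _ _ _ _ _ => False)
    (fun u s g _ k => { s k with
      hier := (g k).elim u Candidate.target
      label := if (k : ℕ) = 0 then u else
        (g ⟨k - 1, (Nat.sub_le _ _).trans_lt k.2⟩).elim u Candidate.target })

/-- Candidate edges ordered by weight and identifier. -/
def edgeKey (c : Candidate n N) : ℝ ×ₗ ℕ := toLex (val c.word, edgeId c.source c.target)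

/-- The edges available to the modified Borůvka algorithm. -/
def BoruvkaEdge (s s' : VertexState n N L) (w : ℕ) (u v : Fin n) (k : Fin L) : Prop :=
  u ≠ v ∧ val w ≤ α ^ ((k : ℕ) + 1) ∧ (s k).hier = (s' k).hier

/-- The shortest edge from a vertex out of its set. -/
def findShortest : LevelInstruction n N L :=
  selectInstruction (fun _ => edgeKey val)
    (fun u v w s s' k => if hw : w < N then
      if BoruvkaEdge val α s s' w u v k ∧ (s k).label ≠ (s' k).label then
        some ⟨⟨w, hw⟩, 0, u, v, (s' k).label, (s' k).repCoin⟩ else none else none)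
    (fun _ _ _ _ _ => False)
    (fun _ s g _ k => { s k with best := g k })

/-- Output the final edges. -/
def outputLinks : LevelInstruction n N L :=
  selectInstruction (fun _ => targetKey) (fun _ _ _ _ _ _ => none)
    (fun u v _ s s' => ∃ k, (s k).label = u ∧ (s k).hier = v ∧ (s' k).label ≠ u)
    (fun _ s _ _ => s)

/-- A round of leader compression. -/
def leaderRound : ℕ → LevelInstruction n N L
  | 0 => drawCoins
  | 1 => fetchCoins
  | 2 => findLeader val α
  | 3 => selectInSet targetKey
  | _ => relabel false

/-- The end of leader compression. -/
def joinRound : ℕ → LevelInstruction n N L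
  | 0 => findIncomplete val α
  | 1 => spreadIncomplete
  | _ => nameHierarchy

/-- A round of the modified Borůvka algorithm. -/
def boruvkaRound : ℕ → LevelInstruction n N L
  | 0 => drawCoins
  | 1 => fetchCoins
  | 2 => findShortest val α
  | 3 => selectInSet (edgeKey val)
  | _ => relabel true

/-- The vertex program of the approximate MST algorithm with `r` rounds of leader compression and
`r'` rounds of the modified Borůvka algorithm. -/
def program (r r' : ℕ) (s : ℕ) : LevelInstruction n N L :=
  if s = 0 then drawDelays
  else if s = 1 then findCenters val scale
  else if s = 2 then nameMpx
  else if s < 3 + 5 * r then leaderRound val α ((s - 3) % 5)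
  else if s < 6 + 5 * r then joinRound val α (s - (3 + 5 * r))
  else if s < 6 + 5 * r + 5 * r' then boruvkaRound val α ((s - (6 + 5 * r)) % 5)
  else outputLinks

/-- The initial state of a vertex. -/
def startState (u : Fin n) : VertexState n N L := fun _ => ⟨0, u, u, u, u, false, false, false, none⟩

/-! ### Effects of the single instructions -/

variable (x : Fin n → Fin n → ℕ) (a : Fin n → VertexState n N L) (y : Fin n → VertexSample N L)

variable {val scale α x a y}

theorem exec_drawDelays (u : Fin n) (k : Fin L) :
    drawDelays.exec x a y u k = { a u k with delay := (y u).1 k } := by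
  rw [drawDelays, exec_selectInstruction]

theorem exec_drawCoins (u : Fin n) (k : Fin L) :
    drawCoins.exec x a y u k = { a u k with coin := (y u).2 k } := by
  rw [drawCoins, exec_selectInstruction]

/-- The second component of the lexicographic key reproduces the tie rule of `center`, which takes
the least minimizer. -/
theorem center_eq_of {w : Fin n → Fin n → ℝ} {d : Fin n → ℝ} {u c : Fin n}
    (h : ∀ v, toLex (w u c - d c, (c : ℕ)) ≤ toLex (w u v - d v, (v : ℕ))) :
    center w d u = c := by
  have hle : ∀ v, w u c - d c ≤ w u v - d v := fun v => by
    rcases Prod.Lex.toLex_le_toLex.1 (h v) with h | h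
    · exact h.le
    · exact h.1.le
  unfold center
  refine le_antisymm (Finset.min'_le _ _ (by simpa using hle)) (Finset.le_min' _ _ _ fun v hv => ?_)
  simp only [Finset.mem_filter, Finset.mem_univ, true_and] at hv
  rcases Prod.Lex.toLex_le_toLex.1 (h v) with h | h
  · exact absurd (hv c) (not_le.2 h)
  · exact h.2

theorem exec_findCenters (hx : ∀ u v, x u v < N) (u : Fin n) (k : Fin L) :
    (findCenters val scale).exec x a y u k = { a u k with
      center := center (fun u v => val (x u v)) (fun v => scale k * ((a v k).delay : ℕ)) u } := by
  rw [findCenters, exec_selectInstruction]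
  dsimp only
  congr 1
  simp only [hx, dif_pos]
  rcases hb : best (fun c : Candidate n N => toLex (val c.word - scale k * (c.delay : ℕ),
    (c.target : ℕ))) (fun v => some ⟨⟨x u v, hx u v⟩, (a v k).delay, v, v, v, false⟩) with _ | c
  -- Every vertex, `u` included, supplies a candidate, so the default value is never used.
  · have := Candidate.best_eq_none.1 hb u
    simp at this
  · obtain ⟨⟨v, hv⟩, hmin⟩ := Candidate.best_eq_some hb
    obtain rfl := Option.some.inj hv
    refine (center_eq_of fun v' => ?_).symm
    exact hmin v' _ rfl

/-- Naming the classes of a partition. -/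
theorem elim_best_eq_rep (P : Setoid (Fin n)) (p : Fin n → Prop) [DecidablePred p] (u : Fin n)
    (hp : ∀ v, p v ↔ P u v) :
    (best (N := N) targetKey fun v => if p v then some (ofVertex v v false) else none).elim u
      Candidate.target = rep P u := by
  rcases hb : best (N := N) targetKey (fun v => if p v then some (ofVertex v v false) else none)
    with _ | c
  · have := Candidate.best_eq_none.1 hb u
    simp [hp] at this
  · obtain ⟨⟨v, hv⟩, hmin⟩ := Candidate.best_eq_some hb
    split_ifs at hv with h
    obtain rfl := Option.some.inj hv
    refine ((rep_eq_iff P u _).2 ⟨(hp v).1 h, fun z hz => ?_⟩).symm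
    exact Candidate.targetKey_le.1 (hmin z _ (if_pos ((hp z).2 hz)))

theorem exec_nameMpx (P : Fin L → Setoid (Fin n))
    (hP : ∀ k u v, (∀ i, k ≤ i → (a u i).center = (a v i).center) ↔ P k u v) (u : Fin n)
    (k : Fin L) :
    nameMpx.exec x a y u k = { a u k with mpx := rep (P k) u, label := rep (P k) u } := by
  rw [nameMpx, exec_selectInstruction]
  have h := elim_best_eq_rep (N := N) (P k) _ u (hP k u)
  simp only [h]

/-- A set's coin is the coin of the vertex naming it, and that vertex is the only one supplying a
candidate. -/
theorem exec_fetchCoins (u : Fin n) (k : Fin L) :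
    fetchCoins.exec x a y u k = { a u k with repCoin := (a (a u k).label k).coin } := by
  rw [fetchCoins, exec_selectInstruction]
  dsimp only
  congr 1
  rcases hb : best (N := N) targetKey (fun v => if (a u k).label = v then
    some (ofVertex v v (a v k).coin) else none) with _ | c
  · have := Candidate.best_eq_none.1 hb (a u k).label
    simp at this
  · obtain ⟨⟨v, hv⟩, -⟩ := Candidate.best_eq_some hb
    split_ifs at hv with h
    obtain rfl := Option.some.inj hv
    subst h
    rfl

theorem exec_relabel (out : Bool) (P : Fin L → Setoid (Fin n))
    (hP : ∀ k u v, newLabel (a u k) = newLabel (a v k) ↔ P k u v) (u : Fin n) (k : Fin L) :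
    (relabel out).exec x a y u k = { a u k with label := rep (P k) u } := by
  rw [relabel, exec_selectInstruction]
  have h := elim_best_eq_rep (N := N) (P k) _ u (hP k u)
  simp only [h]

theorem exec_nameHierarchy (P : Fin L → Setoid (Fin n))
    (hP : ∀ k u v, SameJoined (a u) (a v) k ↔ P k u v) (u : Fin n) (k : Fin L) :
    nameHierarchy.exec x a y u k = { a u k with
      hier := rep (P k) u
      label := if (k : ℕ) = 0 then u else
        rep (P ⟨k - 1, (Nat.sub_le _ _).trans_lt k.2⟩) u } := by
  rw [nameHierarchy, exec_selectInstruction]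
  have h := fun k => elim_best_eq_rep (N := N) (P k) _ u (hP k u)
  simp only [h]

theorem isSome_best {f : Fin n → Option (Candidate n N)} {key : Candidate n N → ℝ ×ₗ ℕ} :
    (best key f).isSome = decide (∃ v, f v ≠ none) := by
  rcases hb : best key f with _ | c
  · simp [Candidate.best_eq_none.1 hb]
  · obtain ⟨⟨v, hv⟩, -⟩ := Candidate.best_eq_some hb
    simp only [Option.isSome_some, true_eq_decide_iff]
    exact ⟨v, by simp [hv]⟩

theorem exec_findIncomplete (u : Fin n) (k : Fin L) :
    (findIncomplete val α).exec x a y u k = { a u k with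
      incomplete := decide (∃ v, LeaderEdge val α (a u) (a v) (x u v) u v k ∧
        (a u k).label ≠ (a v k).label) } := by
  rw [findIncomplete, exec_selectInstruction]
  simp only [isSome_best, ne_eq, ite_eq_right_iff, reduceCtorEq, imp_false, not_not]

theorem exec_spreadIncomplete (u : Fin n) (k : Fin L) :
    spreadIncomplete.exec x a y u k = { a u k with
      incomplete := decide (∃ v, (a u k).label = (a v k).label ∧ (a v k).incomplete = true) } := by
  rw [spreadIncomplete, exec_selectInstruction]
  simp only [isSome_best, ne_eq, ite_eq_right_iff, reduceCtorEq, imp_false, not_not]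

/-- Selection first in the rows and then in the sets amounts to one selection over all pairs. -/
theorem best_best (key : Candidate n N → ℝ ×ₗ ℕ) (p : Fin n → Prop) [DecidablePred p]
    (f : Fin n → Fin n → Option (Candidate n N)) :
    best key (fun v => if p v then best key (f v) else none) =
      best key (fun q : Fin n × Fin n => if p q.1 then f q.1 q.2 else none) := by
  have h1 : ∀ v, (if p v then best key (f v) else none) =
      Candidate.pick key (Finset.univ.image fun b => if p v then f v b else none) := by
    intro v
    split_ifs with h
    · rfl
    · refine ((Candidate.best_eq_none (key := key) (f := fun _ : Fin n => none)).2 ?_).symm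
      exact fun _ => rfl
  simp only [h1]
  unfold best
  rw [← Candidate.pick_biUnion]
  congr 1
  ext c
  simp

end Program

/-! ## Resolving the arbitrary choices -/

/-- The least vertex with a property, or a default vertex if there is none. -/
def leastVertex {n : ℕ} (p : Fin n → Prop) (c : Fin n) : Fin n :=
  if h : (Finset.univ.filter p).Nonempty then (Finset.univ.filter p).min' h else c

theorem leastVertex_spec {n : ℕ} {p : Fin n → Prop} {c b : Fin n} (hb : p b) :
    p (leastVertex p c) ∧ leastVertex p c ≤ b := by
  have h : (Finset.univ.filter p).Nonempty := ⟨b, by simpa using hb⟩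
  rw [leastVertex, dif_pos h]
  exact ⟨by simpa using Finset.min'_mem _ h, Finset.min'_le _ _ (by simpa using hb)⟩

theorem leastVertex_eq {n : ℕ} {p : Fin n → Prop} {c b : Fin n} (hb : p b)
    (hmin : ∀ b', p b' → b ≤ b') : leastVertex p c = b :=
  le_antisymm (leastVertex_spec hb).2 (hmin _ (leastVertex_spec hb).1)

/-- Least leaders, and all links lead to the least vertex of the coarse set. -/
def canonicalChoices (n : ℕ) : ArbitraryChoices n where
  leader P E x C := leastVertex (CanJoin P E x C) C
  leader_spec _ _ _ _ := fun ⟨_, hb⟩ => (leastVertex_spec hb).1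
  hub _ coarse A := rep coarse A
  hub_spec _ coarse A := rel_rep coarse A
  link _ coarse C := (C, rep coarse C)
  link_spec fine coarse C := ⟨fine.refl C, by rw [rep_rep]⟩

/-! ### Simulation of the rounds of each phase -/

section Rounds

variable {n N L : ℕ} [NeZero N] {val : ℕ → ℝ} {α : ℝ}
variable {x : Fin n → Fin n → ℕ} {a : Fin n → VertexState n N L}

theorem exec_findLeader (y : Fin n → VertexSample N L) (u : Fin n) (k : Fin L) :
    (findLeader val α).exec x a y u k = { a u k with
      best := best targetKey fun v =>
        if LeaderEdge val α (a u) (a v) (x u v) u v k ∧ (a u k).label ≠ (a v k).label ∧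
        (a v k).repCoin = true then some (ofVertex v (a v k).label true) else none } := by
  rw [findLeader, exec_selectInstruction]

theorem exec_findShortest (hx : ∀ u v, x u v < N) (y : Fin n → VertexSample N L) (u : Fin n)
    (k : Fin L) :
    (findShortest val α).exec x a y u k = { a u k with
      best := best (edgeKey val) fun v =>
        if BoruvkaEdge val α (a u) (a v) (x u v) u v k ∧ (a u k).label ≠ (a v k).label then
        some ⟨⟨x u v, hx u v⟩, 0, u, v, (a v k).label, (a v k).repCoin⟩ else none } := by
  rw [findShortest, exec_selectInstruction]
  simp only [hx, dif_pos]

theorem exec_selectInSet (key : Candidate n N → ℝ ×ₗ ℕ) (y : Fin n → VertexSample N L) (u : Fin n)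
    (k : Fin L) :
    (selectInSet key).exec x a y u k = { a u k with
      best := best key fun v =>
        if (a u k).label = (a v k).label then (a v k).best else none } := by
  rw [selectInSet, exec_selectInstruction]

/-- The states represent the coarser partitions `R` and the current partitions `P`. -/
structure Labelled (a : Fin n → VertexState n N L) (R P : Fin L → Setoid (Fin n)) : Prop where
  coarse : ∀ k u v, coarseLabel (a u) k = coarseLabel (a v) k ↔ R k u v
  label : ∀ k u, (a u k).label = rep (P k) u

theorem coarseLabel_congr {s s' : VertexState n N L} (h : ∀ k, (s k).mpx = (s' k).mpx) (k : Fin L) :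
    coarseLabel s k = coarseLabel s' k := by
  simp only [coarseLabel, h]

theorem Labelled.label_eq_iff {R P : Fin L → Setoid (Fin n)} (h : Labelled a R P) (k : Fin L)
    (u v : Fin n) : (a u k).label = (a v k).label ↔ P k u v := by
  rw [h.label, h.label, rep_eq_rep_iff]

theorem Labelled.leaderEdge_iff {R P : Fin L → Setoid (Fin n)} (h : Labelled a R P) (k : Fin L)
    (u v : Fin n) : LeaderEdge val α (a u) (a v) (x u v) u v k ↔
      edgesWithin (fun u v => val (x u v)) (α ^ (k : ℕ)) (R k) u v := by
  simp only [LeaderEdge, edgesWithin, h.coarse]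

theorem leaderEdge_congr {s s' t t' : VertexState n N L} (h : ∀ k, (s k).mpx = (s' k).mpx)
    (h' : ∀ k, (t k).mpx = (t' k).mpx) {w : ℕ} {u v : Fin n} {k : Fin L} :
    LeaderEdge val α s t w u v k ↔ LeaderEdge val α s' t' w u v k := by
  simp only [LeaderEdge, coarseLabel_congr h, coarseLabel_congr h']

/-- Expresses joining as a search over pairs with one end in the set of `u`, the form in which the
nested selections see it. -/
theorem canJoin_rep_iff {P : Setoid (Fin n)} {E : Fin n → Fin n → Prop} {z : Fin n → Bool}
    {u b : Fin n} : CanJoin P E z (rep P u) b ↔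
      ∃ a, P u a ∧ E a b ∧ ¬ P a b ∧ z (rep P b) = true := by
  unfold CanJoin
  simp only [rep_left_iff]
  constructor
  · rintro ⟨⟨c, h1, h2⟩, h3, h4⟩
    exact ⟨c, h1, h2, fun h => h3 (P.trans h1 h), h4⟩
  · rintro ⟨c, h1, h2, h3, h4⟩
    exact ⟨⟨c, h1, h2⟩, fun h => h3 (P.trans (P.symm h1) h), h4⟩

/-- The effect of a round of leader compression on the states. -/
def execLeaderRound (val : ℕ → ℝ) (α : ℝ) (x : Fin n → Fin n → ℕ) (a : Fin n → VertexState n N L)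
    (y : ℕ → Fin n → VertexSample N L) : ℕ → Fin n → VertexState n N L
  | 0 => a
  | i + 1 => (leaderRound val α i).exec x (execLeaderRound val α x a y i) (y i)

/-- The effect of a round of the modified Borůvka algorithm on the states. -/
def execBoruvkaRound (val : ℕ → ℝ) (α : ℝ) (x : Fin n → Fin n → ℕ) (a : Fin n → VertexState n N L)
    (y : ℕ → Fin n → VertexSample N L) : ℕ → Fin n → VertexState n N L
  | 0 => a
  | i + 1 => (boruvkaRound val α i).exec x (execBoruvkaRound val α x a y i) (y i)

/-- Flipping and fetching coins leave `mpx` unchanged, hence also the available edges; the row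
selection and the set selection then merge into one by `best_best`. -/
theorem execLeaderRound_four (y : ℕ → Fin n → VertexSample N L) (u : Fin n) (k : Fin L) :
    execLeaderRound val α x a y 4 u k = { a u k with
      coin := (y 0 u).2 k
      repCoin := (y 0 (a u k).label).2 k
      best := best targetKey fun q : Fin n × Fin n =>
        if (a u k).label = (a q.1 k).label then
          if LeaderEdge val α (a q.1) (a q.2) (x q.1 q.2) q.1 q.2 k ∧
            (a q.1 k).label ≠ (a q.2 k).label ∧ (y 0 (a q.2 k).label).2 k = true then
            some (ofVertex q.2 (a q.2 k).label true) else none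
        else none } := by
  have h : ∀ v b, LeaderEdge val α (execLeaderRound val α x a y 2 v)
      (execLeaderRound val α x a y 2 b) (x v b) v b k ↔
      LeaderEdge val α (a v) (a b) (x v b) v b k := fun v b => by
    refine leaderEdge_congr ?_ ?_ <;> intro j <;>
    simp only [execLeaderRound, leaderRound, exec_drawCoins, exec_fetchCoins]
  simp only [execLeaderRound, leaderRound] at h
  simp only [execLeaderRound, leaderRound, exec_drawCoins, exec_fetchCoins, exec_findLeader,
    exec_selectInSet, h]
  congr 1
  exact best_best _ _ _

/-- The least target over all pairs leaving a set is the leader taken by `canonicalChoices`. Thus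
`newLabel` is the very function whose kernel is `hook`, and relabelling restores least vertices as
names. -/
theorem labelled_leaderRound {R P : Fin L → Setoid (Fin n)} (h : Labelled a R P)
    (y : ℕ → Fin n → VertexSample N L) :
    Labelled (execLeaderRound val α x a y 5) R fun k =>
      leaderStep (canonicalChoices n)
        (edgesWithin (fun u v => val (x u v)) (α ^ (k : ℕ)) (R k)) (P k) fun u => (y 0 u).2 k := by
  have key : ∀ k u v, newLabel (execLeaderRound val α x a y 4 u k) =
      newLabel (execLeaderRound val α x a y 4 v k) ↔
      leaderStep (canonicalChoices n)
        (edgesWithin (fun u v => val (x u v)) (α ^ (k : ℕ)) (R k)) (P k) (fun u => (y 0 u).2 k)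
        u v := by
    intro k u v
    set E := edgesWithin (fun u v => val (x u v)) (α ^ (k : ℕ)) (R k) with hE
    set z : Fin n → Bool := fun u => (y 0 u).2 k with hz
    have hnew : ∀ u, newLabel (execLeaderRound val α x a y 4 u k) =
        match (if z (rep (P k) u) = false ∧ ∃ b, CanJoin (P k) E z (rep (P k) u) b then
          some ((canonicalChoices n).leader (P k) E z (rep (P k) u)) else none) with
        | some b => rep (P k) b
        | none => rep (P k) u := by
      intro u
      rw [execLeaderRound_four]
      simp only [newLabel, ne_eq, h.label_eq_iff, h.leaderEdge_iff, ← hE]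
      simp only [h.label]
      change (if z (rep (P k) u) = false then _ else _) = _
      by_cases h0 : z (rep (P k) u) = false
      · simp only [h0, if_true, true_and]
        set β := best targetKey fun q : Fin n × Fin n => if P k u q.1 then
          if E q.1 q.2 ∧ ¬ P k q.1 q.2 ∧ (y 0 (rep (P k) q.2)).2 k = true then
            some (ofVertex (N := N) q.2 (rep (P k) q.2) true) else none else none with hβ
        clear_value β
        rcases β with _ | c
        · have hnone := Candidate.best_eq_none.1 hβ.symm
          rw [if_neg]
          · rfl
          · rintro ⟨b, hb⟩
            obtain ⟨v, h1, h2, h3, h4⟩ := canJoin_rep_iff.1 hb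
            have := hnone (v, b)
            rw [if_pos h1, if_pos ⟨h2, h3, h4⟩] at this
            cases this
        · obtain ⟨⟨⟨v, b⟩, hv⟩, hmin⟩ := Candidate.best_eq_some hβ.symm
          split_ifs at hv with h1 h2
          obtain rfl := Option.some.inj hv
          have hb : CanJoin (P k) E z (rep (P k) u) b := canJoin_rep_iff.2 ⟨v, h1, h2⟩
          have hlead : (canonicalChoices n).leader (P k) E z (rep (P k) u) = b := by
            refine leastVertex_eq hb fun b' hb' => ?_
            obtain ⟨v', h3⟩ := canJoin_rep_iff.1 hb'
            exact Candidate.targetKey_le.1 (hmin (v', b') _ (by rw [if_pos h3.1, if_pos h3.2]))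
          rw [if_pos ⟨b, hb⟩, hlead]
          rfl
      · simp [h0]
    rw [hnew, hnew]
    rfl
  constructor
  · intro k u v
    rw [← h.coarse k u v]
    have := fun u => coarseLabel_congr (s := execLeaderRound val α x a y 5 u) (s' := a u) (by
      intro j
      rw [execLeaderRound, leaderRound, exec_relabel false _ key, execLeaderRound_four]
      all_goals simp) k
    rw [this, this]
  · intro k u
    rw [execLeaderRound, leaderRound, exec_relabel false _ key]
    all_goals simp

/-- The effect of joining the incomplete sets. -/
def execJoin (val : ℕ → ℝ) (α : ℝ) (x : Fin n → Fin n → ℕ) (a : Fin n → VertexState n N L)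
    (y : ℕ → Fin n → VertexSample N L) : ℕ → Fin n → VertexState n N L
  | 0 => a
  | i + 1 => (joinRound val α i).exec x (execJoin val α x a y i) (y i)

/-- The states represent the final hierarchy `H` and the current partitions `P`. -/
structure Nested (a : Fin n → VertexState n N L) (H P : Fin L → Setoid (Fin n)) : Prop where
  hier : ∀ k u, (a u k).hier = rep (H k) u
  label : ∀ k u, (a u k).label = rep (P k) u

theorem joinIncomplete_iff {E : Fin n → Fin n → Prop} {Q R : Setoid (Fin n)} {u v : Fin n} :
    joinIncomplete E Q R u v ↔
      (if Incomplete E Q u then (true, rep R u) else (false, rep Q u)) =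
        if Incomplete E Q v then (true, rep R v) else (false, rep Q v) := Iff.rfl

/-- The first instruction marks vertices that have an outgoing edge themselves, the second spreads
the mark over their sets. -/
theorem execJoin_two {R P : Fin L → Setoid (Fin n)} (h : Labelled a R P)
    (y : ℕ → Fin n → VertexSample N L) (u : Fin n) (k : Fin L) :
    execJoin val α x a y 2 u k = { a u k with
      incomplete := decide (Incomplete
        (edgesWithin (fun u v => val (x u v)) (α ^ (k : ℕ)) (R k)) (P k) u) } := by
  simp only [execJoin, joinRound, exec_findIncomplete, exec_spreadIncomplete, ne_eq,
    h.label_eq_iff, h.leaderEdge_iff]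
  congr 1
  simp only [decide_eq_true_eq, Incomplete]
  refine decide_eq_decide.2 ?_
  constructor
  · rintro ⟨v, h1, b, h2, h3⟩
    exact ⟨v, b, h1, fun h4 => h3 ((P k).trans ((P k).symm h1) h4), h2⟩
  · rintro ⟨v, b, h1, h2, h3⟩
    exact ⟨v, h1, b, h3, fun h4 => h2 ((P k).trans h1 h4)⟩

/-- The new name at level `k` is taken from the digest at level `k - 1`, or is the vertex itself at
level `0`. This prepares the Borůvka phase at all levels at once. -/
theorem nested_execJoin {R P : Fin L → Setoid (Fin n)} (h : Labelled a R P)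
    (y : ℕ → Fin n → VertexSample N L) (H : Fin L → Setoid (Fin n))
    (hH : ∀ k, H k = joinIncomplete (edgesWithin (fun u v => val (x u v)) (α ^ (k : ℕ)) (R k))
      (P k) (R k)) :
    Nested (execJoin val α x a y 3) H fun k => if (k : ℕ) = 0 then ⊥ else
      H ⟨k - 1, (Nat.sub_le _ _).trans_lt k.2⟩ := by
  have hmpx : ∀ u k, coarseLabel (execJoin val α x a y 2 u) k = coarseLabel (a u) k := fun u k =>
    coarseLabel_congr (fun j => by rw [execJoin_two h]) k
  have key : ∀ k u v, SameJoined (execJoin val α x a y 2 u) (execJoin val α x a y 2 v) k ↔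
      H k u v := by
    intro k u v
    rw [hH]
    simp only [SameJoined, hmpx]
    simp only [execJoin_two h, h.label_eq_iff, h.coarse, joinIncomplete_iff,
      decide_eq_decide, decide_eq_true_eq]
    by_cases h1 : Incomplete (edgesWithin (fun u v => val (x u v)) (α ^ (k : ℕ)) (R k)) (P k) u <;>
    by_cases h2 : Incomplete (edgesWithin (fun u v => val (x u v)) (α ^ (k : ℕ)) (R k)) (P k) v <;>
    simp [h1, h2, rep_eq_rep_iff]
  constructor
  · intro k u
    rw [execJoin, joinRound, exec_nameHierarchy _ key]
    all_goals simp
  · intro k u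
    rw [execJoin, joinRound, exec_nameHierarchy _ key]
    · dsimp only
      split_ifs
      · rw [rep_bot]
      · rfl
    all_goals simp

theorem Nested.label_eq_iff {H P : Fin L → Setoid (Fin n)} (h : Nested a H P) (k : Fin L)
    (u v : Fin n) : (a u k).label = (a v k).label ↔ P k u v := by
  rw [h.label, h.label, rep_eq_rep_iff]

theorem Nested.boruvkaEdge_iff {H P : Fin L → Setoid (Fin n)} (h : Nested a H P) (k : Fin L)
    (u v : Fin n) : BoruvkaEdge val α (a u) (a v) (x u v) u v k ↔
      edgesWithin (fun u v => val (x u v)) (α ^ ((k : ℕ) + 1)) (H k) u v := by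
  simp only [BoruvkaEdge, edgesWithin, h.hier, rep_eq_rep_iff]

/-- The smaller and larger end points are the two base-`n` digits of the identifier. -/
theorem edgeId_eq_iff {u v u' v' : Fin n} (h : edgeId u v = edgeId u' v') :
    u = u' ∧ v = v' ∨ u = v' ∧ v = u' := by
  have hn : 0 < n := u.pos
  unfold edgeId at h
  have h1 : (min u v : Fin n) = min u' v' := by
    have := congrArg (· / n) h
    simp only [Nat.mul_add_div hn, Nat.div_eq_of_lt (Fin.is_lt _), add_zero] at this
    exact Fin.ext this
  have h2 : (max u v : Fin n) = max u' v' := by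
    have := congrArg (· % n) h
    simp only [Nat.mul_add_mod, Nat.mod_eq_of_lt (Fin.is_lt _)] at this
    exact Fin.ext this
  rcases le_total u v with h3 | h3 <;> rcases le_total u' v' with h4 | h4 <;>
    simp only [h3, h4, min_eq_left, min_eq_right, max_eq_left, max_eq_right] at h1 h2 <;>
    tauto

/-- Comparing both ways forces equal identifiers, hence the same undirected edge; reversing it would
place its outer end inside the set. Uniqueness makes arbitrary choices of this edge harmless. -/
theorem isShortestOutgoing_unique {w : Fin n → Fin n → ℝ} {E : Fin n → Fin n → Prop}
    {P : Setoid (Fin n)} {C u v u' v' : Fin n} (h : IsShortestOutgoing w E P C u v)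
    (h' : IsShortestOutgoing w E P C u' v') : u = u' ∧ v = v' := by
  have h1 := h.2 _ _ h'.1
  have h2 := h'.2 _ _ h.1
  have h3 : edgeId u v = edgeId u' v' := by
    rcases h1 with h1 | h1 <;> rcases h2 with h2 | h2
    · exact absurd h1 (not_lt.2 h2.le)
    · exact absurd h1 (by rw [h2.1]; exact lt_irrefl _)
    · exact absurd h2 (by rw [h1.1]; exact lt_irrefl _)
    · exact le_antisymm h1.2 h2.2
  rcases edgeId_eq_iff h3 with h4 | h4
  · exact h4
  · exact absurd (h4.1 ▸ h.1.1) h'.1.2.1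

theorem execBoruvkaRound_four (hx : ∀ u v, x u v < N) (y : ℕ → Fin n → VertexSample N L)
    (u : Fin n) (k : Fin L) :
    execBoruvkaRound val α x a y 4 u k = { a u k with
      coin := (y 0 u).2 k
      repCoin := (y 0 (a u k).label).2 k
      best := best (edgeKey val) fun q : Fin n × Fin n =>
        if (a u k).label = (a q.1 k).label then
          if BoruvkaEdge val α (a q.1) (a q.2) (x q.1 q.2) q.1 q.2 k ∧
            (a q.1 k).label ≠ (a q.2 k).label then
            some ⟨⟨x q.1 q.2, hx q.1 q.2⟩, 0, q.1, q.2, (a q.2 k).label, (y 0 (a q.2 k).label).2 k⟩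
          else none
        else none } := by
  have h : ∀ v b, BoruvkaEdge val α (execBoruvkaRound val α x a y 2 v)
      (execBoruvkaRound val α x a y 2 b) (x v b) v b k ↔
      BoruvkaEdge val α (a v) (a b) (x v b) v b k := fun v b => by
    simp only [BoruvkaEdge, execBoruvkaRound, boruvkaRound, exec_drawCoins, exec_fetchCoins]
  simp only [execBoruvkaRound, boruvkaRound] at h
  simp only [execBoruvkaRound, boruvkaRound, exec_drawCoins, exec_fetchCoins,
    exec_findShortest hx, exec_selectInSet, h]
  congr 1
  exact best_best _ _ _

/-- The selected edge is the shortest outgoing one. -/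
theorem execBoruvkaRound_best (hx : ∀ u v, x u v < N) {H P : Fin L → Setoid (Fin n)}
    (h : Nested a H P) (y : ℕ → Fin n → VertexSample N L) (u : Fin n) (k : Fin L) :
    (∀ c, (execBoruvkaRound val α x a y 4 u k).best = some c →
      IsShortestOutgoing (fun u v => val (x u v))
        (edgesWithin (fun u v => val (x u v)) (α ^ ((k : ℕ) + 1)) (H k)) (P k) (rep (P k) u)
        c.source c.target ∧ c.label = rep (P k) c.target ∧
        c.bit = (y 0 (rep (P k) c.target)).2 k) ∧
    ((execBoruvkaRound val α x a y 4 u k).best = none → ∀ v b, ¬ IsOutgoing (P k)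
        (edgesWithin (fun u v => val (x u v)) (α ^ ((k : ℕ) + 1)) (H k)) (rep (P k) u) v b) := by
  rw [execBoruvkaRound_four hx]
  simp only [ne_eq, h.label_eq_iff, h.boruvkaEdge_iff]
  simp only [h.label]
  set E := edgesWithin (fun u v => val (x u v)) (α ^ ((k : ℕ) + 1)) (H k) with hE
  have hout : ∀ v b, IsOutgoing (P k) E (rep (P k) u) v b ↔ P k u v ∧ E v b ∧ ¬ P k v b := by
    intro v b
    simp only [IsOutgoing, rep_left_iff]
    constructor
    · rintro ⟨h1, h2, h3⟩
      exact ⟨h1, h3, fun h4 => h2 ((P k).trans h1 h4)⟩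
    · rintro ⟨h1, h2, h3⟩
      exact ⟨h1, fun h4 => h3 ((P k).trans ((P k).symm h1) h4), h2⟩
  constructor
  · intro c hc
    obtain ⟨⟨⟨v, b⟩, hv⟩, hmin⟩ := Candidate.best_eq_some hc
    split_ifs at hv with h1 h2
    obtain rfl := Option.some.inj hv
    refine ⟨⟨(hout v b).2 ⟨h1, h2⟩, fun v' b' h' => ?_⟩, rfl, rfl⟩
    obtain ⟨h3, h4⟩ := (hout v' b').1 h'
    exact Prod.Lex.toLex_le_toLex.1 (hmin (v', b') _ (by rw [if_pos h3, if_pos h4]))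
  · intro hc v b hvb
    obtain ⟨h3, h4⟩ := (hout v b).1 hvb
    have := Candidate.best_eq_none.1 hc (v, b)
    rw [if_pos h3, if_pos h4] at this
    cases this

/-- Every vertex of a set knows the selected edge, and by uniqueness it is the edge named in
`BoruvkaJoins`. Both the relabelling and the output rest on this. -/
theorem joinEdge_iff (hx : ∀ u v, x u v < N) {H P : Fin L → Setoid (Fin n)}
    (h : Nested a H P) (y : ℕ → Fin n → VertexSample N L) (u v b : Fin n) (k : Fin L) :
    JoinEdge (execBoruvkaRound val α x a y 4 u k) v b ↔
      BoruvkaJoins (fun u v => val (x u v))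
        (edgesWithin (fun u v => val (x u v)) (α ^ ((k : ℕ) + 1)) (H k)) (P k)
        (fun u => (y 0 u).2 k) (rep (P k) u) v b := by
  have hrep : (execBoruvkaRound val α x a y 4 u k).repCoin = (y 0 (rep (P k) u)).2 k := by
    rw [execBoruvkaRound_four hx]
    simp only [h.label]
  obtain ⟨hs, hn⟩ := execBoruvkaRound_best (val := val) (α := α) hx h y u k
  unfold JoinEdge BoruvkaJoins
  rw [hrep]
  constructor
  · rintro ⟨h0, c, hc, rfl, rfl, hbit⟩
    obtain ⟨h1, h2, h3⟩ := hs c hc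
    exact ⟨h1, h0, h3.symm.trans hbit⟩
  · rintro ⟨h1, h0, h2⟩
    refine ⟨h0, ?_⟩
    rcases hb : (execBoruvkaRound val α x a y 4 u k).best with _ | c
    · exact absurd h1.1 (hn hb v b)
    · obtain ⟨h3, h4, h5⟩ := hs c hb
      obtain ⟨h6, h7⟩ := isShortestOutgoing_unique h3 h1
      exact ⟨c, rfl, h6, h7, h5.trans (by rw [h7]; exact h2)⟩

/-- Counterpart of `labelled_leaderRound`, with `joinEdge_iff` in the role of the least leader. The
edge sets `s` do not influence the partition; they are there because `boruvkaStep` acts on pairs. -/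
theorem nested_boruvkaRound (hx : ∀ u v, x u v < N) {H P : Fin L → Setoid (Fin n)}
    (h : Nested a H P) (y : ℕ → Fin n → VertexSample N L) (s : Fin L → Finset (Sym2 (Fin n))) :
    Nested (execBoruvkaRound val α x a y 5) H (fun k =>
      (boruvkaStep (fun u v => val (x u v))
        (edgesWithin (fun u v => val (x u v)) (α ^ ((k : ℕ) + 1)) (H k)) (P k, s k)
        fun u => (y 0 u).2 k).1) := by
  have key : ∀ k u v, newLabel (execBoruvkaRound val α x a y 4 u k) =
      newLabel (execBoruvkaRound val α x a y 4 v k) ↔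
      (boruvkaStep (fun u v => val (x u v))
        (edgesWithin (fun u v => val (x u v)) (α ^ ((k : ℕ) + 1)) (H k)) (P k, s k)
        fun u => (y 0 u).2 k).1 u v := by
    intro k u v
    set E := edgesWithin (fun u v => val (x u v)) (α ^ ((k : ℕ) + 1)) (H k) with hE
    set w := fun u v => val (x u v) with hw
    set z : Fin n → Bool := fun u => (y 0 u).2 k with hz
    have hnew : ∀ u, newLabel (execBoruvkaRound val α x a y 4 u k) =
        match (if h : ∃ b a, BoruvkaJoins w E (P k) z (rep (P k) u) a b then some h.choose
          else none) with
        | some b => rep (P k) b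
        | none => rep (P k) u := by
      intro u
      have hj := fun v b => joinEdge_iff (val := val) (α := α) hx h y u v b k
      obtain ⟨hs, -⟩ := execBoruvkaRound_best (val := val) (α := α) hx h y u k
      have hlab : (execBoruvkaRound val α x a y 4 u k).label = rep (P k) u := by
        rw [execBoruvkaRound_four hx]
        simp only [h.label]
      by_cases hex : ∃ b a, BoruvkaJoins w E (P k) z (rep (P k) u) a b
      · rw [dif_pos hex]
        -- Whatever target `choose` returns, `joinEdge_iff` identifies it with the target of the
        -- selected candidate.
        obtain ⟨v, hv⟩ := hex.choose_spec
        obtain ⟨h0, c, hc, h1, h2, h3⟩ := (hj _ _).2 hv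
        simp only [newLabel, h0, hc, if_true, h3, Option.elim_some]
        rw [(hs c hc).2.1, h2]
      · rw [dif_neg hex]
        simp only [newLabel, hlab]
        split_ifs with h0
        · rcases hb : (execBoruvkaRound val α x a y 4 u k).best with _ | c
          · rfl
          · simp only [Option.elim_some]
            refine if_neg fun h3 => hex ⟨c.target, c.source, (hj _ _).1 ⟨h0, c, hb, rfl, rfl, h3⟩⟩
        · rfl
    rw [hnew, hnew]
    rfl
  constructor
  · intro k u
    rw [execBoruvkaRound, boruvkaRound, exec_relabel true _ key]
    · dsimp only
      rw [execBoruvkaRound_four hx]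
      exact h.hier k u
    all_goals simp
  · intro k u
    rw [execBoruvkaRound, boruvkaRound, exec_relabel true _ key]
    all_goals simp

/-- Starting from `∅` isolates the edges added in this round. An edge is emitted by its source,
which holds the selected candidate of its set. -/
theorem emitted_boruvkaRound (hx : ∀ u v, x u v < N) {H P : Fin L → Setoid (Fin n)}
    (h : Nested a H P) (y : ℕ → Fin n → VertexSample N L) :
    (boruvkaRound val α 4).emitted x (execBoruvkaRound val α x a y 4) =
      Finset.univ.biUnion fun k : Fin L => (boruvkaStep (fun u v => val (x u v))
        (edgesWithin (fun u v => val (x u v)) (α ^ ((k : ℕ) + 1)) (H k)) (P k, ∅)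
        fun u => (y 0 u).2 k).2 := by
  ext e
  rw [Instruction.mem_emitted]
  simp only [boruvkaRound, relabel, selectInstruction, joinEdge_iff hx h, true_and, boruvkaStep,
    Finset.empty_union, Finset.mem_biUnion, Finset.mem_univ, Finset.mem_filter]
  constructor
  · rintro ⟨u, v, h1, k, h2⟩
    exact ⟨k, u, v, h1, h2⟩
  · rintro ⟨k, u, v, h1, h2⟩
    exact ⟨u, v, h1, k, h2⟩

/-- Canonical links join the least vertex of a fine set to the least vertex of the coarse set, so
both ends are recognized from labels without further search. -/
theorem emitted_outputLinks {H P : Fin L → Setoid (Fin n)} (h : Nested a H P) :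
    outputLinks.emitted x a =
      Finset.univ.biUnion fun k => linkEdges (canonicalChoices n) (P k) (H k) := by
  ext e
  rw [Instruction.mem_emitted]
  simp only [outputLinks, selectInstruction, linkEdges, canonicalChoices,
    Finset.mem_biUnion, Finset.mem_univ, true_and, Finset.mem_filter, h.label, h.hier, rep_rep]
  constructor
  · rintro ⟨u, v, h1, k, h2, h3, h4⟩
    refine ⟨k, u, h2, ?_, by rw [h3, h1]⟩
    rw [h3, ← rep_eq_rep_iff, h2]
    exact fun h5 => h4 h5.symm
  · rintro ⟨k, u, h1, h2, h3⟩
    refine ⟨u, rep (H k) u, h3, k, h1, rfl, fun h4 => h2 ?_⟩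
    rw [← rep_eq_rep_iff, h4, h1]

end Rounds

/-! ## The vertex program computes the approximate MST -/

/-- The states of an iteration. -/
def iterateWith {S C : Type} (F : S → C → S) (s : S) (z : ℕ → C) : ℕ → S
  | 0 => s
  | j + 1 => F (iterateWith F s z j) (z j)

/-- Turns the fold in the algorithm into a recursion that can be followed along program time. -/
theorem foldl_eq_iterateWith {S C : Type} (F : S → C → S) (s : S) (z : ℕ → C) (r : ℕ) :
    Fin.foldl r (fun q j => F q (z j)) s = iterateWith F s z r := by
  induction r with
  | zero => simp [iterateWith]
  | succ r ih =>
    rw [Fin.foldl_succ_last]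
    simp only [Fin.val_castSucc, Fin.val_last, ih, iterateWith]

section Correct

variable {n N : ℕ} [NeZero N] (p : Params) (val : ℕ → ℝ) (scale : Fin (p.top + 1) → ℝ)
variable (x : Fin n → Fin n → ℕ) (y : ℕ → Fin n → VertexSample N (p.top + 1))

/-- The draws of the algorithm given by the samples of the vertices. -/
def drawsOf : Draws n p where
  delay k u := scale k * ((y 0 u).1 k : ℕ)
  leaderCoin k j u := (y (3 + 5 * j) u).2 k
  boruvkaCoin k j u := (y (6 + 5 * p.leaderRounds + 5 * j) u).2 k

/-- The program for the parameters `p`. -/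
abbrev mstProgram : ℕ → LevelInstruction n N (p.top + 1) :=
  program val scale p.α p.leaderRounds p.boruvkaRounds

/-- The states of the vertices after `s` instructions. -/
abbrev mstStates (s : ℕ) : Fin n → VertexState n N (p.top + 1) :=
  vertexRun (mstProgram p val scale) x startState y s

theorem mpxPartition_iff {w : Fin n → Fin n → ℝ} {ω : Draws n p} {k : ℕ} {u v : Fin n} :
    mpxPartition w ω k u v ↔
      ∀ i : Fin (p.top + 1), k ≤ i → center w (ω.delay i) u = center w (ω.delay i) v := by
  unfold mpxPartition
  rw [iInf, Setoid.sInf_def]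
  simp [Setoid.ker_def]

variable {p val scale x y}

theorem labelled_start (hx : ∀ u v, x u v < N) :
    Labelled (mstStates p val scale x y 3)
      (fun k => mpxPartition (fun u v => val (x u v)) (drawsOf p scale y) ((k : ℕ) + 1))
      (fun k => mpxPartition (fun u v => val (x u v)) (drawsOf p scale y) k) := by
  have h0 : mstProgram p val scale 0 = (drawDelays : LevelInstruction n N _) := by
    simp [mstProgram, program]
  have h1 : mstProgram p val scale 1 = (findCenters val scale : LevelInstruction n N _) := by
    simp [mstProgram, program]
  have h2 : mstProgram p val scale 2 = (nameMpx : LevelInstruction n N _) := by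
    simp [mstProgram, program]
  have hcenter : ∀ u k, (mstStates p val scale x y 2 u k).center =
      center (fun u v => val (x u v)) ((drawsOf p scale y).delay k) u := by
    intro u k
    rw [mstStates, vertexRun_succ, vertexRun_succ, h0, h1, exec_findCenters hx]
    simp only [exec_drawDelays]
    rfl
  have hmpx : ∀ u k, mstStates p val scale x y 3 u k = { mstStates p val scale x y 2 u k with
      mpx := rep (mpxPartition (fun u v => val (x u v)) (drawsOf p scale y) k) u
      label := rep (mpxPartition (fun u v => val (x u v)) (drawsOf p scale y) k) u } := by
    intro u k
    rw [mstStates, vertexRun_succ, h2]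
    refine exec_nameMpx
      (fun k => mpxPartition (fun u v => val (x u v)) (drawsOf p scale y) k) (fun k u v => ?_) u k
    rw [mpxPartition_iff]
    simp only [hcenter, Fin.le_def]
  constructor
  · intro k u v
    unfold coarseLabel
    split_ifs with h
    · rw [hmpx, hmpx, Option.some_inj, rep_eq_rep_iff]
    -- At the top level `coarseLabel` is `none` everywhere, and no level lies above it, so the
    -- coarser partition is the one-set partition.
    · simp only [true_iff]
      rw [mpxPartition_iff]
      intro i hi
      omega
  · intro k u
    rw [hmpx]

theorem mstStates_leader {j : ℕ} (hj : j < p.leaderRounds) {i : ℕ} (hi : i ≤ 5) :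
    mstStates p val scale x y (3 + 5 * j + i) =
      execLeaderRound val p.α x (mstStates p val scale x y (3 + 5 * j))
        (fun i => y (3 + 5 * j + i)) i := by
  induction i with
  | zero => rfl
  | succ i ih =>
    have h : mstProgram p val scale (3 + 5 * j + i) =
        (leaderRound val p.α i : LevelInstruction n N _) := by
      unfold mstProgram program
      rw [if_neg (by omega), if_neg (by omega), if_neg (by omega), if_pos (by omega)]
      congr 1
      omega
    rw [← add_assoc, mstStates, vertexRun_succ, h, execLeaderRound, ← ih (by omega)]

theorem mstStates_join {i : ℕ} (hi : i ≤ 3) :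
    mstStates p val scale x y (3 + 5 * p.leaderRounds + i) =
      execJoin val p.α x (mstStates p val scale x y (3 + 5 * p.leaderRounds))
        (fun i => y (3 + 5 * p.leaderRounds + i)) i := by
  induction i with
  | zero => rfl
  | succ i ih =>
    have h : mstProgram p val scale (3 + 5 * p.leaderRounds + i) =
        (joinRound val p.α i : LevelInstruction n N _) := by
      unfold mstProgram program
      rw [if_neg (by omega), if_neg (by omega), if_neg (by omega), if_neg (by omega),
        if_pos (by omega)]
      congr 1
      omega
    rw [← add_assoc, mstStates, vertexRun_succ, h, execJoin, ← ih (by omega)]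

theorem mstProgram_boruvka {j : ℕ} (hj : j < p.boruvkaRounds) {i : ℕ} (hi : i < 5) :
    mstProgram p val scale (6 + 5 * p.leaderRounds + 5 * j + i) =
      (boruvkaRound val p.α i : LevelInstruction n N _) := by
  unfold mstProgram program
  rw [if_neg (by omega), if_neg (by omega), if_neg (by omega), if_neg (by omega),
    if_neg (by omega), if_pos (by omega)]
  congr 1
  omega

theorem mstStates_boruvka {j : ℕ} (hj : j < p.boruvkaRounds) {i : ℕ} (hi : i ≤ 5) :
    mstStates p val scale x y (6 + 5 * p.leaderRounds + 5 * j + i) =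
      execBoruvkaRound val p.α x (mstStates p val scale x y (6 + 5 * p.leaderRounds + 5 * j))
        (fun i => y (6 + 5 * p.leaderRounds + 5 * j + i)) i := by
  induction i with
  | zero => rfl
  | succ i ih =>
    rw [← add_assoc, mstStates, vertexRun_succ, mstProgram_boruvka hj (by omega), execBoruvkaRound,
      ← ih (by omega)]

theorem labelled_leader (hx : ∀ u v, x u v < N) {j : ℕ} (hj : j ≤ p.leaderRounds) :
    Labelled (mstStates p val scale x y (3 + 5 * j))
      (fun k => mpxPartition (fun u v => val (x u v)) (drawsOf p scale y) ((k : ℕ) + 1))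
      (fun k => iterateWith (leaderStep (canonicalChoices n)
          (edgesWithin (fun u v => val (x u v)) (p.α ^ (k : ℕ))
            (mpxPartition (fun u v => val (x u v)) (drawsOf p scale y) ((k : ℕ) + 1))))
        (mpxPartition (fun u v => val (x u v)) (drawsOf p scale y) k)
        (fun i u => (y (3 + 5 * i) u).2 k) j) := by
  induction j with
  | zero => exact labelled_start hx
  | succ j ih =>
    have := labelled_leaderRound (val := val) (α := p.α) (x := x) (ih (by omega))
      (fun i => y (3 + 5 * j + i))
    rw [← mstStates_leader (by omega) le_rfl] at this
    exact this

theorem nested_start (hx : ∀ u v, x u v < N) :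
    Nested (mstStates p val scale x y (6 + 5 * p.leaderRounds))
      (hierarchy (canonicalChoices n) (fun u v => val (x u v)) (drawsOf p scale y))
      (previousHierarchy (canonicalChoices n) (fun u v => val (x u v)) (drawsOf p scale y)) := by
  have := nested_execJoin (val := val) (α := p.α) (labelled_leader (y := y) (scale := scale) hx le_rfl)
    (fun i => y (3 + 5 * p.leaderRounds + i))
    (hierarchy (canonicalChoices n) (fun u v => val (x u v)) (drawsOf p scale y)) (fun k => by
      rw [← foldl_eq_iterateWith]
      rfl)
  rw [← mstStates_join le_rfl] at this
  have h : 3 + 5 * p.leaderRounds + 3 = 6 + 5 * p.leaderRounds := by ring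
  rw [h] at this
  exact this

/-- The state of the modified Borůvka algorithm at level `k` after `j` rounds. -/
abbrev boruvkaState (p : Params) (val : ℕ → ℝ) (scale : Fin (p.top + 1) → ℝ)
    (x : Fin n → Fin n → ℕ) (y : ℕ → Fin n → VertexSample N (p.top + 1)) (j : ℕ)
    (k : Fin (p.top + 1)) : Setoid (Fin n) × Finset (Sym2 (Fin n)) :=
  iterateWith (boruvkaStep (fun u v => val (x u v))
      (edgesWithin (fun u v => val (x u v)) (p.α ^ ((k : ℕ) + 1))
        (hierarchy (canonicalChoices n) (fun u v => val (x u v)) (drawsOf p scale y) k)))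
    (previousHierarchy (canonicalChoices n) (fun u v => val (x u v)) (drawsOf p scale y) k, ∅)
    (fun i u => (y (6 + 5 * p.leaderRounds + 5 * i) u).2 k) j

theorem nested_boruvka (hx : ∀ u v, x u v < N) {j : ℕ} (hj : j ≤ p.boruvkaRounds) :
    Nested (mstStates p val scale x y (6 + 5 * p.leaderRounds + 5 * j))
      (hierarchy (canonicalChoices n) (fun u v => val (x u v)) (drawsOf p scale y))
      (fun k => (boruvkaState p val scale x y j k).1) := by
  induction j with
  | zero => exact nested_start hx
  | succ j ih =>
    have := nested_boruvkaRound (val := val) (α := p.α) hx (ih (by omega))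
      (fun i => y (6 + 5 * p.leaderRounds + 5 * j + i))
      (fun k => (boruvkaState p val scale x y j k).2)
    rw [← mstStates_boruvka (by omega) le_rfl] at this
    exact this

theorem emitted_eq_empty {L : ℕ} {I : LevelInstruction n N L} {a : Fin n → VertexState n N L}
    (h : ∀ u v w s s', ¬ I.emit u v w s s') : I.emitted x a = ∅ := by
  ext e
  simp [Instruction.mem_emitted, h]

theorem emittedEdges_before {s : ℕ} (hs : s ≤ 6 + 5 * p.leaderRounds) :
    Grid.emittedEdges (mstProgram p val scale) x startState y s = ∅ := by
  induction s with
  | zero => exact emittedEdges_zero _ _ _ _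
  | succ s ih =>
    rw [emittedEdges_succ, ih (by omega), Finset.empty_union]
    apply emitted_eq_empty
    intro u v w t t'
    unfold mstProgram program
    split_ifs with h1 h2 h3 h4 h5
    · exact id
    · exact id
    · exact id
    · rcases (s - 3) % 5 with _ | _ | _ | _ | i
      · exact id
      · exact id
      · exact id
      · exact id
      · rintro ⟨h, -⟩
        cases h
    · rcases s - (3 + 5 * p.leaderRounds) with _ | _ | i <;> exact id
    · omega
    · omega

/-- Of the five instructions in a round only the last emits edges, and it emits them for all levels
together. -/
theorem emittedEdges_boruvka (hx : ∀ u v, x u v < N) {j : ℕ} (hj : j ≤ p.boruvkaRounds) :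
    Grid.emittedEdges (mstProgram p val scale) x startState y (6 + 5 * p.leaderRounds + 5 * j) =
      Finset.univ.biUnion fun k => (boruvkaState p val scale x y j k).2 := by
  induction j with
  | zero =>
    rw [mul_zero, add_zero, emittedEdges_before le_rfl]
    ext e
    simp [boruvkaState, iterateWith]
  | succ j ih =>
    have hnone : ∀ i ≤ 4, Grid.emittedEdges (mstProgram p val scale) x startState y
        (6 + 5 * p.leaderRounds + 5 * j + i) =
        Grid.emittedEdges (mstProgram p val scale) x startState y
          (6 + 5 * p.leaderRounds + 5 * j) := by
      intro i hi
      induction i with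
      | zero => rfl
      | succ i ih' =>
        rw [← add_assoc, emittedEdges_succ, ih' (by omega), mstProgram_boruvka (by omega) (by omega),
          emitted_eq_empty, Finset.union_empty]
        intro u v w t t'
        have : i = 0 ∨ i = 1 ∨ i = 2 ∨ i = 3 := by omega
        rcases this with rfl | rfl | rfl | rfl <;> exact id
    have h5 : 6 + 5 * p.leaderRounds + 5 * (j + 1) = 6 + 5 * p.leaderRounds + 5 * j + 4 + 1 := by
      ring
    have hem := emitted_boruvkaRound (val := val) (α := p.α) hx
      (nested_boruvka (val := val) (y := y) (scale := scale) hx (show j ≤ p.boruvkaRounds by omega))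
      (fun i => y (6 + 5 * p.leaderRounds + 5 * j + i))
    rw [← mstStates_boruvka (by omega) (by omega)] at hem
    rw [h5, emittedEdges_succ, hnone 4 le_rfl, ih (by omega), mstProgram_boruvka (by omega) (by omega),
      hem]
    ext e
    simp only [Finset.mem_union, Finset.mem_biUnion, Finset.mem_univ, true_and, ← exists_or]
    refine exists_congr fun k => ?_
    simp only [boruvkaState, iterateWith, boruvkaStep, Finset.mem_union, Finset.empty_union,
      add_zero]

/-- A pointwise identity in the samples: no probability enters, and `drawsOf` reads off the delays
and coins that the run has used. -/
theorem emittedEdges_eq_approxMST (hx : ∀ u v, x u v < N) :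
    Grid.emittedEdges (mstProgram p val scale) x startState y
        (7 + 5 * p.leaderRounds + 5 * p.boruvkaRounds) =
      approxMST (canonicalChoices n) (fun u v => val (x u v)) (drawsOf p scale y) := by
  have h : 7 + 5 * p.leaderRounds + 5 * p.boruvkaRounds =
      6 + 5 * p.leaderRounds + 5 * p.boruvkaRounds + 1 := by ring
  have hI : mstProgram p val scale (6 + 5 * p.leaderRounds + 5 * p.boruvkaRounds) =
      (outputLinks : LevelInstruction n N _) := by
    unfold mstProgram program
    rw [if_neg (by omega), if_neg (by omega), if_neg (by omega), if_neg (by omega),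
      if_neg (by omega), if_neg (by omega)]
  have hb : ∀ k, boruvkaState p val scale x y p.boruvkaRounds k =
      boruvka (fun u v => val (x u v)) (edgesWithin (fun u v => val (x u v)) (p.α ^ ((k : ℕ) + 1))
        (hierarchy (canonicalChoices n) (fun u v => val (x u v)) (drawsOf p scale y) k))
      (previousHierarchy (canonicalChoices n) (fun u v => val (x u v)) (drawsOf p scale y) k)
      ((drawsOf p scale y).boruvkaCoin k) := fun k =>
    (foldl_eq_iterateWith _ _ _ _).symm
  rw [h, emittedEdges_succ, hI, emittedEdges_boruvka hx le_rfl,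
    emitted_outputLinks (nested_boruvka hx le_rfl)]
  ext e
  simp only [Finset.mem_union, Finset.mem_biUnion, Finset.mem_univ, true_and, ← exists_or,
    approxMST, levelEdges, hb]

end Correct

/-! ## Selecting coordinates of product measures -/

/-- The preimage of a box is a box: coordinates outside the range of `e` are free and contribute
factor one, and injectivity puts at most one constraint on every other coordinate. -/
theorem map_pi_select {ι κ X Y : Type} [Fintype ι] [Fintype κ] [MeasurableSpace X]
    [MeasurableSpace Y] (μ : Measure X) [IsProbabilityMeasure μ] {e : κ → ι}
    (he : Function.Injective e) {g : X → Y} (hg : Measurable g) :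
    (Measure.pi fun _ : ι => μ).map (fun f j => g (f (e j))) = Measure.pi fun _ : κ => μ.map g := by
  have := Measure.isProbabilityMeasure_map (μ := μ) hg.aemeasurable
  refine (Measure.pi_eq fun s hs => ?_).symm
  have hm : Measurable fun (f : ι → X) (j : κ) => g (f (e j)) :=
    measurable_pi_lambda _ fun j => hg.comp (measurable_pi_apply _)
  rw [Measure.map_apply hm (MeasurableSet.univ_pi hs)]
  have hpre : (fun (f : ι → X) (j : κ) => g (f (e j))) ⁻¹' Set.univ.pi s =
      Set.univ.pi fun i => {z | ∀ j, e j = i → g z ∈ s j} := by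
    ext f
    simp only [Set.mem_preimage, Set.mem_univ_pi, Set.mem_ofPred_eq]
    exact ⟨fun h i j hj => hj ▸ h j, fun h j => h _ j rfl⟩
  rw [hpre, Measure.pi_pi]
  refine (Fintype.prod_of_injective e he _ _ (fun i hi => ?_) fun j => ?_).symm
  · have : {z | ∀ j, e j = i → g z ∈ s j} = Set.univ := by
      ext z
      simp only [Set.mem_ofPred_eq, Set.mem_univ, iff_true]
      exact fun j hj => absurd ⟨j, hj⟩ hi
    rw [this, measure_univ]
  · rw [Measure.map_apply hg (hs j)]
    congr 1
    ext z
    simp only [Set.mem_preimage, Set.mem_ofPred_eq]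
    exact ⟨fun h j' hj' => he hj' ▸ h, fun h => h j rfl⟩

/-! ## Exponential delays -/

/-- The exponential density never exceeds `r`. -/
theorem expMeasure_Icc_le {r : ℝ} (hr : 0 < r) (a b : ℝ) :
    expMeasure r (Set.Icc a b) ≤ ENNReal.ofReal (r * (b - a)) := by
  have h : expMeasure r = volume.withDensity (exponentialPDF r) := rfl
  rw [h, withDensity_apply _ measurableSet_Icc, ENNReal.ofReal_mul hr.le, ← Real.volume_Icc,
    ← setLIntegral_const]
  refine lintegral_mono fun x => ?_
  rw [exponentialPDF_eq]
  refine ENNReal.ofReal_le_ofReal ?_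
  split_ifs with hx
  · have : Real.exp (-(r * x)) ≤ 1 := Real.exp_le_one_iff.2 (by nlinarith)
    nlinarith
  · exact hr.le

theorem expMeasure_compl_Icc_le {r H : ℝ} (hr : 0 < r) (hH : 0 ≤ H) :
    (expMeasure r).real (Set.Icc 0 H)ᶜ ≤ Real.exp (-(r * H)) := by
  have := isProbabilityMeasure_expMeasure hr
  have h0 : (expMeasure r).real (Set.Iic 0) = 0 := by
    rw [← cdf_eq_real, cdf_expMeasure_eq hr]
    simp
  have h1 : (expMeasure r).real (Set.Iic H)ᶜ = Real.exp (-(r * H)) := by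
    rw [probReal_compl_eq_one_sub measurableSet_Iic, ← cdf_eq_real, cdf_expMeasure_eq hr,
      if_pos hH]
    ring
  calc (expMeasure r).real (Set.Icc 0 H)ᶜ
      ≤ (expMeasure r).real (Set.Iic 0 ∪ (Set.Iic H)ᶜ) := by
        refine measureReal_mono fun x hx => ?_
        by_contra h
        simp only [Set.mem_union, Set.mem_Iic, Set.mem_compl_iff, not_or, not_le, not_lt] at h
        exact hx ⟨h.1.le, h.2⟩
    _ ≤ _ := measureReal_union_le _ _
    _ = _ := by rw [h0, h1, zero_add]

/-- With `δ v'` fixed, the event confines `δ v` to an interval of length `2 * η`. Independence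
permits this conditioning. -/
theorem pi_expMeasure_near_le {n : ℕ} {r : ℝ} (hr : 0 < r) {v v' : Fin n} (hv : v ≠ v') (c η : ℝ)
    (hη : 0 ≤ η) :
    (Measure.pi fun _ : Fin n => expMeasure r).real {δ | |δ v - δ v' - c| ≤ η} ≤ 2 * (r * η) := by
  have := isProbabilityMeasure_expMeasure hr
  have hms : MeasurableSet {q : ℝ × ℝ | |q.1 - q.2 - c| ≤ η} :=
    measurableSet_le (by fun_prop) measurable_const
  have he : Function.Injective ![v, v'] := by
    intro i j hij
    fin_cases i <;> fin_cases j <;> simp_all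
  have hsel := map_pi_select (expMeasure r) he measurable_id
  rw [Measure.map_id] at hsel
  have hpair : (Measure.pi fun _ : Fin n => expMeasure r).map (fun δ => (δ v, δ v')) =
      (expMeasure r).prod (expMeasure r) := by
    rw [← (measurePreserving_finTwoArrow (expMeasure r)).map_eq, ← hsel,
      Measure.map_map (MeasurableEquiv.measurable _) (by fun_prop)]
    rfl
  have hle : (Measure.pi fun _ : Fin n => expMeasure r) {δ | |δ v - δ v' - c| ≤ η} ≤
      ENNReal.ofReal (2 * (r * η)) := by
    have h1 : {δ : Fin n → ℝ | |δ v - δ v' - c| ≤ η} =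
        (fun δ : Fin n → ℝ => (δ v, δ v')) ⁻¹' {q | |q.1 - q.2 - c| ≤ η} := rfl
    rw [h1, ← Measure.map_apply (by fun_prop) hms, hpair, Measure.prod_apply_symm hms]
    calc _ ≤ ∫⁻ _, ENNReal.ofReal (2 * (r * η)) ∂(expMeasure r) := by
          refine lintegral_mono fun b => ?_
          have h2 : (fun a => (a, b)) ⁻¹' {q : ℝ × ℝ | |q.1 - q.2 - c| ≤ η} =
              Set.Icc (b + c - η) (b + c + η) := by
            ext a
            simp only [Set.mem_preimage, Set.mem_ofPred_eq, abs_le, Set.mem_Icc]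
            constructor <;> rintro ⟨h3, h4⟩ <;> constructor <;> linarith
          rw [h2]
          refine (expMeasure_Icc_le hr _ _).trans (ENNReal.ofReal_le_ofReal (le_of_eq ?_))
          ring
      _ = _ := by simp
  exact ENNReal.toReal_le_of_le_ofReal (by positivity) hle

/-! ## Rounding the delays -/

/-- A real number rounded down to a multiple of `s`, coded by a number below `N`. -/
def roundDown (N : ℕ) [NeZero N] (s t : ℝ) : Fin N :=
  ⟨min ⌊t / s⌋₊ (N - 1), (min_le_right _ _).trans_lt (Nat.sub_lt (NeZero.pos N) one_pos)⟩

theorem measurable_roundDown (N : ℕ) [NeZero N] (s : ℝ) : Measurable (roundDown N s) := by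
  have h : Measurable fun t : ℝ => ⌊t / s⌋₊ := Nat.measurable_floor.comp (measurable_id.div_const s)
  refine measurable_to_countable' fun b => ?_
  have : roundDown N s ⁻¹' {b} = (fun t : ℝ => ⌊t / s⌋₊) ⁻¹' {m | min m (N - 1) = b} := by
    ext t
    simp [roundDown, Fin.ext_iff]
  rw [this]
  exact h (Set.to_countable _).measurableSet

theorem roundDown_spec {N : ℕ} [NeZero N] {s t : ℝ} (hs : 0 < s)
    (ht : t ∈ Set.Icc 0 (((N - 1 : ℕ) : ℝ) * s)) :
    s * (roundDown N s t : ℕ) ≤ t ∧ t < s * (roundDown N s t : ℕ) + s := by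
  have h1 : ⌊t / s⌋₊ ≤ N - 1 := by
    refine Nat.floor_le_of_le ?_
    rw [div_le_iff₀ hs]
    exact ht.2
  simp only [roundDown, min_eq_left h1]
  have h2 := Nat.floor_le (div_nonneg ht.1 hs.le)
  have h3 := Nat.lt_floor_add_one (t / s)
  rw [le_div_iff₀ hs] at h2
  rw [div_lt_iff₀ hs] at h3
  constructor <;> linarith

theorem center_le {n : ℕ} (w : Fin n → Fin n → ℝ) (d : Fin n → ℝ) (u v : Fin n) :
    w u (center w d u) - d (center w d u) ≤ w u v - d v := by
  have h : center w d u ∈ Finset.univ.filter fun v => ∀ v', w u v - d v ≤ w u v' - d v' :=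
    Finset.min'_mem _ _
  simp only [Finset.mem_filter, Finset.mem_univ, true_and] at h
  exact h v

/-- Off the near ties the true minimizer wins by more than `η`. Rounding down raises each shifted
distance by less than `η` and lowers none, so the winner stays strictly ahead. -/
theorem center_eq_center_of_near {n : ℕ} {w : Fin n → Fin n → ℝ} {d δ : Fin n → ℝ} {u : Fin n}
    {η : ℝ} (hd : ∀ v, d v ≤ δ v ∧ δ v < d v + η)
    (hgap : ∀ v v', v ≠ v' → ¬ |δ v - δ v' - (w u v - w u v')| ≤ η) :
    center w δ u = center w d u := by
  refine (center_eq_of fun v => ?_).symm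
  by_cases hv : v = center w δ u
  · rw [← hv]
  · rw [Prod.Lex.toLex_le_toLex]
    left
    have h1 := center_le w δ u v
    have h2 := hgap v _ hv
    rw [not_le, lt_abs] at h2
    have h3 := hd v
    have h4 := hd (center w δ u)
    simp only
    rcases h2 with h2 | h2 <;> linarith

/-! ## The law of the rounded draws -/

theorem prod_rotate {J U K M : Type} [Fintype J] [Fintype U] [Fintype K] [CommMonoid M]
    (f : J → U → K → M) : ∏ j, ∏ u, ∏ k, f j u k = ∏ k, ∏ j, ∏ u, f j u k := by
  simp_rw [Finset.prod_comm (s := (Finset.univ : Finset U)) (t := (Finset.univ : Finset K))]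
  exact Finset.prod_comm

section Law

variable (n N : ℕ) [NeZero N] (p : Params) (scale : Fin (p.top + 1) → ℝ)

instance : IsProbabilityMeasure fairCoin := by unfold fairCoin; infer_instance

/-- The rate of the delays at level `k`. -/
def delayRate (k : Fin (p.top + 1)) : ℝ := p.γ * Real.log n / p.α ^ (k : ℕ)

/-- The law of the sample of a vertex. -/
def vertexLaw : Measure (VertexSample N (p.top + 1)) :=
  (Measure.pi fun k => (expMeasure (delayRate n p k)).map (roundDown N (scale k))).prod
    (Measure.pi fun _ => fairCoin)

/-- The draws, with rounded delays. -/
abbrev RoundedDraws : Type :=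
  (Fin (p.top + 1) → Fin n → Fin N) × (Fin (p.top + 1) → Fin p.leaderRounds → Fin n → Bool) ×
    (Fin (p.top + 1) → Fin p.boruvkaRounds → Fin n → Bool)

/-- The times at which samples are used. -/
abbrev SampleTime : Type := Unit ⊕ Fin p.leaderRounds ⊕ Fin p.boruvkaRounds

/-- The draws given by the samples of the vertices. -/
def collectDraws (y : SampleTime p → Fin n → VertexSample N (p.top + 1)) : RoundedDraws n N p :=
  (fun k u => (y (Sum.inl ()) u).1 k, fun k j u => (y (Sum.inr (Sum.inl j)) u).2 k,
    fun k j u => (y (Sum.inr (Sum.inr j)) u).2 k)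

/-- Rounding of the delays. -/
def roundDraws (ω : (Fin (p.top + 1) → Fin n → ℝ) ×
      (Fin (p.top + 1) → Fin p.leaderRounds → Fin n → Bool) ×
      (Fin (p.top + 1) → Fin p.boruvkaRounds → Fin n → Bool)) : RoundedDraws n N p :=
  (fun k u => roundDown N (scale k) (ω.1 k u), ω.2)

theorem measurable_roundDraws : Measurable (roundDraws n N p scale) := by
  refine Measurable.prodMk ?_ measurable_snd
  refine measurable_pi_lambda _ fun k => measurable_pi_lambda _ fun u => ?_
  exact (measurable_roundDown N _).comp (by fun_prop)

theorem isProbabilityMeasure_vertexLaw (hrate : ∀ k, 0 < delayRate n p k) :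
    IsProbabilityMeasure (vertexLaw n N p scale) := by
  have h1 := fun k => isProbabilityMeasure_expMeasure (hrate k)
  have h2 := fun k => Measure.isProbabilityMeasure_map (μ := expMeasure (delayRate n p k))
    (measurable_roundDown N (scale k)).aemeasurable
  unfold vertexLaw
  infer_instance

/-- The target is countable, so singletons suffice. On them both laws factor over times, vertices
and levels; the unused half of each sample contributes one, and the remaining factors only need
reordering. -/
theorem map_collectDraws (hrate : ∀ k, 0 < delayRate n p k) :
    (Measure.pi fun _ : SampleTime p => Measure.pi fun _ : Fin n => vertexLaw n N p scale).map
      (collectDraws n N p) = (drawsMeasure n p).map (roundDraws n N p scale) := by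
  have h1 := fun k => isProbabilityMeasure_expMeasure (hrate k)
  have h2 := fun k => Measure.isProbabilityMeasure_map (μ := expMeasure (delayRate n p k))
    (measurable_roundDown N (scale k)).aemeasurable
  have h3 := isProbabilityMeasure_vertexLaw n N p scale hrate
  have h4 : ∀ k : Fin (p.top + 1),
      IsProbabilityMeasure (expMeasure (p.γ * Real.log n / p.α ^ (k : ℕ))) := h1
  have hm : Measurable (collectDraws n N p) := measurable_of_countable _
  refine Measure.ext_of_singleton fun z => ?_
  obtain ⟨d, l, b⟩ := z
  rw [Measure.map_apply hm (measurableSet_singleton _),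
    Measure.map_apply (measurable_roundDraws n N p scale) (measurableSet_singleton _)]
  have e1 : collectDraws n N p ⁻¹' {(d, l, b)} = Set.univ.pi fun t : SampleTime p =>
      Set.univ.pi fun u : Fin n => Sum.elim
        (fun _ => (Set.univ.pi fun k => {d k u}) ×ˢ Set.univ)
        (Sum.elim (fun j => Set.univ ×ˢ (Set.univ.pi fun k => {l k j u}))
          (fun j => Set.univ ×ˢ (Set.univ.pi fun k => {b k j u}))) t := by
    ext y
    simp only [collectDraws, Set.mem_preimage, Set.mem_singleton_iff, Prod.mk.injEq, funext_iff,
      Set.mem_univ_pi, Sum.forall, Sum.elim_inl, Sum.elim_inr, Set.mem_prod, Set.mem_univ,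
      and_true, true_and]
    constructor
    · rintro ⟨h1, h2, h3⟩
      exact ⟨fun _ u k => h1 k u, fun j u k => h2 k j u, fun j u k => h3 k j u⟩
    · rintro ⟨h1, h2, h3⟩
      exact ⟨fun k u => h1 () u k, fun k j u => h2 j u k, fun k j u => h3 j u k⟩
  have e2 : roundDraws n N p scale ⁻¹' {(d, l, b)} =
      (Set.univ.pi fun k => Set.univ.pi fun u => roundDown N (scale k) ⁻¹' {d k u}) ×ˢ
        ((Set.univ.pi fun k => Set.univ.pi fun j => Set.univ.pi fun u => {l k j u}) ×ˢ
        (Set.univ.pi fun k => Set.univ.pi fun j => Set.univ.pi fun u => {b k j u})) := by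
    ext ⟨δ, l', b'⟩
    simp only [roundDraws, Set.mem_preimage, Set.mem_singleton_iff, Prod.mk.injEq, funext_iff,
      Set.mem_univ_pi, Set.mem_prod]
  rw [e1, e2, Measure.pi_pi]
  simp only [Measure.pi_pi, Fintype.prod_sum_type, Sum.elim_inl, Sum.elim_inr, vertexLaw,
    Measure.prod_prod, measure_univ, one_mul, mul_one, drawsMeasure, Finset.univ_unique,
    Finset.prod_singleton]
  congr 1
  · rw [Finset.prod_comm]
    refine Finset.prod_congr rfl fun k _ => ?_
    refine Finset.prod_congr rfl fun u _ => ?_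
    rw [Measure.map_apply (measurable_roundDown N _) (measurableSet_singleton _)]
    rfl
  · congr 1 <;> exact prod_rotate _

theorem isProbabilityMeasure_drawsMeasure (hrate : ∀ k, 0 < delayRate n p k) :
    IsProbabilityMeasure (drawsMeasure n p) := by
  have h1 : ∀ k : Fin (p.top + 1),
      IsProbabilityMeasure (expMeasure (p.γ * Real.log n / p.α ^ (k : ℕ))) := fun k =>
    isProbabilityMeasure_expMeasure (hrate k)
  unfold drawsMeasure
  infer_instance

variable {n p}

/-- The delays of one level. -/
theorem measurePreserving_levelDelays (hrate : ∀ k, 0 < delayRate n p k) (k : Fin (p.top + 1)) :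
    MeasurePreserving (fun ω : (Fin (p.top + 1) → Fin n → ℝ) ×
      (Fin (p.top + 1) → Fin p.leaderRounds → Fin n → Bool) ×
      (Fin (p.top + 1) → Fin p.boruvkaRounds → Fin n → Bool) => ω.1 k) (drawsMeasure n p)
      (Measure.pi fun _ => expMeasure (delayRate n p k)) := by
  have h1 : ∀ k : Fin (p.top + 1),
      IsProbabilityMeasure (expMeasure (p.γ * Real.log n / p.α ^ (k : ℕ))) := fun k =>
    isProbabilityMeasure_expMeasure (hrate k)
  have h2 := measurePreserving_eval (fun k : Fin (p.top + 1) => Measure.pi fun _ : Fin n =>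
    expMeasure (p.γ * Real.log n / p.α ^ (k : ℕ))) k
  exact h2.comp measurePreserving_fst

/-- A union bound over levels, with `n` tail events for delays beyond the representable range and `n
^ 3` near-tie events indexed by a vertex and two possible centers. -/
theorem measure_center_ne_le (hγ : 0 < p.γ * Real.log n) (hα : 0 < p.α) {q : ℝ} (hq : 0 < q)
    (hscale : ∀ k, scale k = p.α ^ (k : ℕ) * q) (w : Fin n → Fin n → ℝ) :
    (drawsMeasure n p).real {ω | ∃ k u, center w (ω.1 k) u ≠
        center w (fun v => scale k * (roundDown N (scale k) (ω.1 k v) : ℕ)) u} ≤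
      (p.top + 1) * (n * Real.exp (-(p.γ * Real.log n * q * ((N - 1 : ℕ) : ℝ))) +
        n ^ 3 * (2 * (p.γ * Real.log n * q))) := by
  have hpow : ∀ k : Fin (p.top + 1), 0 < p.α ^ (k : ℕ) := fun k => pow_pos hα _
  have hrate : ∀ k, 0 < delayRate n p k := fun k => div_pos hγ (hpow k)
  have hs : ∀ k, 0 < scale k := fun k => by rw [hscale]; exact mul_pos (hpow k) hq
  -- The grid is proportional to `α ^ k` so that rate times grid width, and with it every bad-event
  -- bound, is the same at all levels.
  have hrs : ∀ k, delayRate n p k * scale k = p.γ * Real.log n * q := fun k => by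
    rw [hscale, delayRate]
    have := (hpow k).ne'
    field_simp
  have hpm := isProbabilityMeasure_drawsMeasure n p hrate
  let tail : Fin (p.top + 1) → Fin n → Set (Fin n → ℝ) := fun k v =>
    Function.eval v ⁻¹' (Set.Icc 0 (((N - 1 : ℕ) : ℝ) * scale k))ᶜ
  let near : Fin (p.top + 1) → Fin n × Fin n × Fin n → Set (Fin n → ℝ) := fun k t =>
    {δ | t.2.1 ≠ t.2.2 ∧ |δ t.2.1 - δ t.2.2 - (w t.1 t.2.1 - w t.1 t.2.2)| ≤ scale k}
  have htail : ∀ k v, (drawsMeasure n p).real ((fun ω => ω.1 k) ⁻¹' tail k v) ≤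
      Real.exp (-(p.γ * Real.log n * q * ((N - 1 : ℕ) : ℝ))) := by
    intro k v
    have := isProbabilityMeasure_expMeasure (hrate k)
    have hm : MeasurableSet (tail k v) := measurable_pi_apply v measurableSet_Icc.compl
    rw [(measurePreserving_levelDelays hrate k).measureReal_preimage hm.nullMeasurableSet,
      (measurePreserving_eval (fun _ : Fin n => expMeasure (delayRate n p k)) v).measureReal_preimage
        measurableSet_Icc.compl.nullMeasurableSet]
    refine (expMeasure_compl_Icc_le (hrate k) (by have := hs k; positivity)).trans (le_of_eq ?_)
    rw [← hrs k]
    ring_nf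
  have hnear : ∀ k t, (drawsMeasure n p).real ((fun ω => ω.1 k) ⁻¹' near k t) ≤
      2 * (p.γ * Real.log n * q) := by
    rintro k ⟨u, v, v'⟩
    have := isProbabilityMeasure_expMeasure (hrate k)
    by_cases hv : v = v'
    · have h0 : near k (u, v, v') = ∅ := by
        ext δ
        simp [near, hv]
      rw [h0, Set.preimage_empty, measureReal_empty]
      positivity
    · have h0 : near k (u, v, v') = {δ | |δ v - δ v' - (w u v - w u v')| ≤ scale k} := by
        ext δ
        simp [near, hv]
      have hm : MeasurableSet {δ : Fin n → ℝ | |δ v - δ v' - (w u v - w u v')| ≤ scale k} :=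
        measurableSet_le (by fun_prop) measurable_const
      rw [h0, (measurePreserving_levelDelays hrate k).measureReal_preimage hm.nullMeasurableSet,
        ← hrs k]
      exact pi_expMeasure_near_le (hrate k) hv _ (scale k) (hs k).le
  have hsub : {ω : (Fin (p.top + 1) → Fin n → ℝ) ×
      (Fin (p.top + 1) → Fin p.leaderRounds → Fin n → Bool) ×
      (Fin (p.top + 1) → Fin p.boruvkaRounds → Fin n → Bool) | ∃ k u, center w (ω.1 k) u ≠
        center w (fun v => scale k * (roundDown N (scale k) (ω.1 k v) : ℕ)) u} ⊆
      ⋃ k, (⋃ v, (fun ω => ω.1 k) ⁻¹' tail k v) ∪ ⋃ t, (fun ω => ω.1 k) ⁻¹' near k t := by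
    rintro ω ⟨k, u, hne⟩
    simp only [Set.mem_iUnion, Set.mem_union]
    refine ⟨k, ?_⟩
    by_contra hcon
    rw [not_or] at hcon
    obtain ⟨h1, h2⟩ := hcon
    refine hne (center_eq_center_of_near (η := scale k) (fun v => ?_) fun v v' hv hle => ?_)
    · refine roundDown_spec (hs k) ?_
      by_contra hv
      exact h1 ⟨v, hv⟩
    · exact h2 ⟨(u, v, v'), hv, hle⟩
  calc _ ≤ (drawsMeasure n p).real _ := measureReal_mono hsub
    _ ≤ ∑ k, (drawsMeasure n p).real _ := measureReal_iUnion_fintype_le _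
    _ ≤ ∑ _k : Fin (p.top + 1), (n * Real.exp (-(p.γ * Real.log n * q * ((N - 1 : ℕ) : ℝ))) +
        n ^ 3 * (2 * (p.γ * Real.log n * q))) := by
      refine Finset.sum_le_sum fun k _ => (measureReal_union_le _ _).trans (add_le_add ?_ ?_)
      · refine (measureReal_iUnion_fintype_le _).trans
          ((Finset.sum_le_sum fun v _ => htail k v).trans (le_of_eq ?_))
        simp
      · refine (measureReal_iUnion_fintype_le _).trans
          ((Finset.sum_le_sum fun t _ => hnear k t).trans (le_of_eq ?_))
        simp only [Finset.sum_const, Finset.card_univ, Fintype.card_prod, Fintype.card_fin,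
          nsmul_eq_mul]
        push_cast
        ring
    _ = _ := by
      simp only [Finset.sum_const, Finset.card_univ, Fintype.card_fin, nsmul_eq_mul]
      push_cast
      ring

/-- The output of the approximate MST algorithm depends on the delays only through the centers. -/
theorem approxMST_congr {ch : ArbitraryChoices n} {w : Fin n → Fin n → ℝ} {ω ω' : Draws n p}
    (hc : ∀ k u, center w (ω.delay k) u = center w (ω'.delay k) u)
    (hl : ω.leaderCoin = ω'.leaderCoin) (hb : ω.boruvkaCoin = ω'.boruvkaCoin) :
    approxMST ch w ω = approxMST ch w ω' := by
  have h1 : ∀ k, mpxPartition w ω k = mpxPartition w ω' k := fun k => by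
    ext u v
    rw [mpxPartition_iff, mpxPartition_iff]
    simp only [hc]
  have h2 : hierarchy ch w ω = hierarchy ch w ω' := by
    funext k
    simp only [hierarchy, h1, hl]
  have h3 : previousHierarchy ch w ω = previousHierarchy ch w ω' := by
    funext k
    simp only [previousHierarchy, h2]
  simp only [approxMST, levelEdges, h2, h3, hb]

theorem abs_measureReal_sub_le {Ω : Type} [MeasurableSpace Ω] {μ : Measure Ω} [IsFiniteMeasure μ]
    {s t b : Set Ω} (h : ∀ ω, ω ∉ b → (ω ∈ s ↔ ω ∈ t)) : |μ.real s - μ.real t| ≤ μ.real b := by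
  have key : ∀ s t : Set Ω, (∀ ω, ω ∉ b → (ω ∈ s ↔ ω ∈ t)) → μ.real s ≤ μ.real t + μ.real b :=
    fun s t h => (measureReal_mono fun ω hω => by
      by_cases hb : ω ∈ b
      · exact Or.inr hb
      · exact Or.inl ((h ω hb).1 hω)).trans (measureReal_union_le t b)
  have h1 := key s t h
  have h2 := key t s fun ω hω => (h ω hω).symm
  rw [abs_le]
  constructor <;> linarith

/-- Comparing the output distribution with that of an algorithm using rounded draws. -/
theorem abs_sub_approxMSTProb_le (hrate : ∀ k, 0 < delayRate n p k) {Ω : Type} [MeasurableSpace Ω]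
    {μ : Measure Ω} {Ψ : Ω → RoundedDraws n N p} (hΨ : Measurable Ψ)
    (hlaw : μ.map Ψ = (drawsMeasure n p).map (roundDraws n N p scale)) (ch : ArbitraryChoices n)
    (w : Fin n → Fin n → ℝ) (𝒯 : Set (Finset (Sym2 (Fin n)))) :
    |μ.real {ξ | approxMST ch w (⟨fun k u => scale k * ((Ψ ξ).1 k u : ℕ), (Ψ ξ).2.1, (Ψ ξ).2.2⟩ :
        Draws n p) ∈ 𝒯} - approxMSTProb p ch w 𝒯| ≤
      (drawsMeasure n p).real {ω | ∃ k u, center w (ω.1 k) u ≠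
        center w (fun v => scale k * (roundDown N (scale k) (ω.1 k v) : ℕ)) u} := by
  have hpm := isProbabilityMeasure_drawsMeasure n p hrate
  let F : Set (RoundedDraws n N p) := {z | approxMST ch w
    (⟨fun k u => scale k * (z.1 k u : ℕ), z.2.1, z.2.2⟩ : Draws n p) ∈ 𝒯}
  have hF : MeasurableSet F := (Set.to_countable F).measurableSet
  have h1 : μ.real (Ψ ⁻¹' F) = (drawsMeasure n p).real (roundDraws n N p scale ⁻¹' F) := by
    rw [← map_measureReal_apply hΨ hF, hlaw,
      map_measureReal_apply (measurable_roundDraws n N p scale) hF]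
  change |μ.real (Ψ ⁻¹' F) - _| ≤ _
  rw [h1]
  refine abs_measureReal_sub_le fun ω hω => ?_
  simp only [Set.mem_ofPred_eq, not_exists, not_not] at hω
  have : approxMST ch w (⟨fun k u => scale k * ((roundDraws n N p scale ω).1 k u : ℕ),
      (roundDraws n N p scale ω).2.1, (roundDraws n N p scale ω).2.2⟩ : Draws n p) =
      approxMST ch w ⟨ω.1, ω.2.1, ω.2.2⟩ :=
    approxMST_congr (fun k u => (hω k u).symm) rfl rfl
  change _ ∈ 𝒯 ↔ _ ∈ 𝒯
  rw [this]

/-- The law of rounded draws computed from uniform samples of the machines. -/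
theorem map_volume_collectDraws (hrate : ∀ k, 0 < delayRate n p k) {R M : ℕ}
    {sample : unitInterval → VertexSample N (p.top + 1)} (hsample : Measurable sample)
    (hlaw : (volume : Measure unitInterval).map sample = vertexLaw n N p scale)
    {time : SampleTime p → Fin R} (htime : Function.Injective time) {root : Fin n → Fin M}
    (hroot : Function.Injective root) :
    (volume : Measure (Fin R → Fin M → unitInterval)).map
        (fun ξ => collectDraws n N p fun t u => sample (ξ (time t) (root u))) =
      (drawsMeasure n p).map (roundDraws n N p scale) := by
  have h1 := map_pi_select (volume : Measure unitInterval) hroot hsample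
  have hg : Measurable fun (f : Fin M → unitInterval) (u : Fin n) => sample (f (root u)) :=
    measurable_pi_lambda _ fun u => hsample.comp (measurable_pi_apply _)
  have h2 := map_pi_select (Measure.pi fun _ : Fin M => (volume : Measure unitInterval)) htime hg
  rw [h1, hlaw] at h2
  have hm : Measurable fun (f : Fin R → Fin M → unitInterval) (t : SampleTime p) (u : Fin n) =>
      sample (f (time t) (root u)) :=
    measurable_pi_lambda _ fun t => hg.comp (measurable_pi_apply _)
  rw [← map_collectDraws n N p scale hrate, ← h2, Measure.map_map (measurable_of_countable _) hm]
  rfl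

end Law

/-! ## Choice of the parameters -/

theorem one_le_log {n : ℕ} (hn : 3 ≤ n) : 1 ≤ Real.log n := by
  have hn' : (3 : ℝ) ≤ n := by exact_mod_cast hn
  rw [Real.le_log_iff_exp_le (by linarith)]
  exact (Real.exp_one_lt_d9.le.trans (by norm_num)).trans hn'

/-- Since `log α ≥ log 2 ≥ 1 / 2`, the logarithm of `W` to base `α` is at most `2 * c * log n`. The
ceiling and the extra level cost at most `2 ≤ 2 * log n`. -/
theorem levels_le {n c : ℕ} (hn : 3 ≤ n) {p : Params} (hα : 2 ≤ p.α) (hW : 1 ≤ p.W)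
    (hWn : p.W ≤ (n : ℝ) ^ c) : ((p.top + 1 : ℕ) : ℝ) ≤ (2 * c + 2) * Real.log n := by
  have hlog := one_le_log hn
  have h2 : (0.5 : ℝ) ≤ Real.log 2 := by
    have := Real.log_two_gt_d9
    linarith
  have hα' : Real.log 2 ≤ Real.log p.α := Real.log_le_log (by norm_num) hα
  have hW' : Real.log p.W ≤ c * Real.log n := by
    rw [← Real.log_pow]
    exact Real.log_le_log (by linarith) hWn
  have h0 : 0 ≤ Real.log p.W := Real.log_nonneg hW
  have hnn : 0 ≤ Real.logb p.α p.W := div_nonneg h0 (by linarith)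
  have hle : Real.logb p.α p.W ≤ 2 * c * Real.log n := by
    rw [Real.logb, div_le_iff₀ (by linarith)]
    have hc : 0 ≤ (c : ℝ) * Real.log n := by positivity
    nlinarith
  have := Nat.ceil_lt_add_one hnn
  push_cast
  rw [Params.top]
  linarith

/-- The arity of the trees along which the rows of the grid are organized. -/
def arity (n h : ℕ) : ℕ := ⌈(n : ℝ) ^ ((h + 1 : ℕ) : ℝ)⁻¹⌉₊

theorem arity_bounds {n : ℕ} (hn : 1 ≤ n) (h : ℕ) :
    0 < arity n h ∧ n ≤ arity n h ^ h * arity n h ∧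
      (arity n h : ℝ) ≤ 2 * (n : ℝ) ^ ((h + 1 : ℕ) : ℝ)⁻¹ := by
  have hn' : (1 : ℝ) ≤ n := by exact_mod_cast hn
  have h1 : 1 ≤ (n : ℝ) ^ ((h + 1 : ℕ) : ℝ)⁻¹ := Real.one_le_rpow hn' (by positivity)
  refine ⟨Nat.ceil_pos.2 (by linarith), ?_, ?_⟩
  · rw [← pow_succ]
    have h2 : (n : ℝ) ≤ (arity n h : ℝ) ^ (h + 1) := by
      calc (n : ℝ) = ((n : ℝ) ^ ((h + 1 : ℕ) : ℝ)⁻¹) ^ (h + 1) :=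
            (Real.rpow_inv_natCast_pow (by linarith) (by omega)).symm
        _ ≤ _ := pow_le_pow_left₀ (by linarith) (Nat.le_ceil _) _
    exact_mod_cast h2
  · have := Nat.ceil_lt_add_one (a := (n : ℝ) ^ ((h + 1 : ℕ) : ℝ)⁻¹) (by linarith)
    unfold arity
    linarith

/-- The exponent `δ` is split in half: one half bounds the arity, the other absorbs the logarithmic
number of levels. -/
theorem space_le {n h c L : ℕ} {δ : ℝ} (hδ : 0 < δ) (hn : 3 ≤ n) (hh : 2 / δ ≤ ((h + 1 : ℕ) : ℝ))
    (hL : (L : ℝ) ≤ (2 * c + 2) * Real.log n) :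
    ((63 * arity n h * L : ℕ) : ℝ) ≤ 63 * 2 * (2 * c + 2) * (2 / δ) * (n : ℝ) ^ δ := by
  have hn' : (1 : ℝ) ≤ n := by exact_mod_cast (by omega : 1 ≤ n)
  obtain ⟨-, -, hB⟩ := arity_bounds (show 1 ≤ n by omega) h
  have h1 : (n : ℝ) ^ ((h + 1 : ℕ) : ℝ)⁻¹ ≤ (n : ℝ) ^ (δ / 2) := by
    refine Real.rpow_le_rpow_of_exponent_le hn' ?_
    rw [← inv_div]
    exact inv_anti₀ (by positivity) hh
  have h2 : Real.log n ≤ 2 / δ * (n : ℝ) ^ (δ / 2) := by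
    refine (Real.log_le_rpow_div (by linarith) (half_pos hδ)).trans (le_of_eq ?_)
    field_simp
  have h3 : (n : ℝ) ^ (δ / 2) * (n : ℝ) ^ (δ / 2) = (n : ℝ) ^ δ := by
    rw [← Real.rpow_add (by linarith), add_halves]
  have h4 : 0 ≤ Real.log n := Real.log_nonneg hn'
  push_cast
  calc (63 : ℝ) * arity n h * L
      ≤ 63 * (2 * (n : ℝ) ^ (δ / 2)) * ((2 * c + 2) * (2 / δ * (n : ℝ) ^ (δ / 2))) := by
        gcongr
        · exact hB.trans (by gcongr)
        · exact hL.trans (by gcongr)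
    _ = 63 * 2 * (2 * c + 2) * (2 / δ) * ((n : ℝ) ^ (δ / 2) * (n : ℝ) ^ (δ / 2)) := by ring
    _ = _ := by rw [h3]

/-- The machines and their entries give `n * B ^ (h + 1)`, which is `O(n ^ 2)` for fixed `h`; the
single factor `log n` comes from the levels. -/
theorem totalSpace_le {n h c L : ℕ} (hn : 3 ≤ n) (hL : (L : ℝ) ≤ (2 * c + 2) * Real.log n) :
    ((n * arity n h ^ h : ℕ) : ℝ) * ((63 * arity n h * L : ℕ) : ℝ) ≤
      63 * 2 ^ (h + 1) * (2 * c + 2) * ((n : ℝ) ^ 2 * Real.log n ^ 1) := by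
  have hn' : (1 : ℝ) ≤ n := by exact_mod_cast (by omega : 1 ≤ n)
  obtain ⟨-, -, hB⟩ := arity_bounds (show 1 ≤ n by omega) h
  have h1 : (arity n h : ℝ) ^ (h + 1) ≤ 2 ^ (h + 1) * n := by
    refine (pow_le_pow_left₀ (by positivity) hB _).trans (le_of_eq ?_)
    rw [mul_pow, Real.rpow_inv_natCast_pow (by linarith) (by omega)]
  have h4 : 0 ≤ Real.log n := Real.log_nonneg hn'
  push_cast
  calc (n : ℝ) * arity n h ^ h * (63 * arity n h * L) = 63 * n * arity n h ^ (h + 1) * L := by ring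
    _ ≤ 63 * n * (2 ^ (h + 1) * n) * ((2 * c + 2) * Real.log n) := by gcongr
    _ = _ := by ring

/-- The positive lower bound `Λ₀` on `Λ` absorbs additive constants into the factor. -/
theorem rounds_le {b Λ Λ₀ : ℝ} {r r' h : ℕ} (hΛ₀ : 0 < Λ₀) (hΛ : Λ₀ ≤ Λ) (hr : r ≤ b * Λ)
    (hr' : r' ≤ b * Λ) : (((7 + 5 * r + 5 * r') * (2 * h + 2) + 3 : ℕ) : ℝ) ≤
      ((7 / Λ₀ + 10 * b) * (2 * h + 2) + 3 / Λ₀) * Λ := by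
  have h1 : 1 ≤ Λ / Λ₀ := (one_le_div hΛ₀).2 hΛ
  push_cast
  calc ((7 : ℝ) + 5 * r + 5 * r') * (2 * h + 2) + 3
      ≤ (7 * (Λ / Λ₀) + 5 * (b * Λ) + 5 * (b * Λ)) * (2 * h + 2) + 3 * (Λ / Λ₀) := by
        gcongr <;> linarith
    _ = _ := by ring

/-- The factor `n ^ g` swallows the constants, and each `log n` costs at most a factor `n`. Near
ties give `n ^ (g + 5)` against `n ^ (A + g + 6)`. For the tail, `q * (N - 1) ≥ n ^ m ≥ (A + g + 3)
/ γ` makes the exponential at most `n ^ (-(A + g + 3))`, against a factor `n ^ (g + 2)`. Each part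
is at most `n ^ (-A) / n`, and `n ≥ 3` leaves room for both. -/
theorem error_le {n A c g m L : ℕ} {γ : ℝ} (hγ : 0 < γ) (hn : 3 ≤ n)
    (hL : (L : ℝ) ≤ (2 * c + 2) * Real.log n) (hg : 2 * c + 2 ≤ (3 : ℝ) ^ g)
    (hg' : 2 * γ * (2 * c + 2) ≤ (3 : ℝ) ^ g) (hm : (A + g + 3 : ℕ) / γ ≤ (3 : ℝ) ^ m) {N : ℕ}
    (hN : 2 * n ^ (A + g + 6 + m) ≤ N) :
    (L : ℝ) * (n * Real.exp (-(γ * Real.log n * ((n : ℝ) ^ (A + g + 6))⁻¹ * ((N - 1 : ℕ) : ℝ))) +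
      n ^ 3 * (2 * (γ * Real.log n * ((n : ℝ) ^ (A + g + 6))⁻¹))) ≤ ((n : ℝ) ^ A)⁻¹ := by
  have hn3 : (3 : ℝ) ≤ n := by exact_mod_cast hn
  have hn0 : (0 : ℝ) < n := by linarith
  have hlog := one_le_log hn
  have hlogn : Real.log n ≤ n := (Real.log_le_sub_one_of_pos hn0).trans (by linarith)
  have hpow : ∀ e : ℕ, (3 : ℝ) ^ e ≤ (n : ℝ) ^ e := fun e => pow_le_pow_left₀ (by norm_num) hn3 _
  have hNm : (n : ℝ) ^ (A + g + 6 + m) ≤ ((N - 1 : ℕ) : ℝ) := by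
    have h1 : 1 ≤ n ^ (A + g + 6 + m) := Nat.one_le_pow _ _ (by omega)
    have h2 : n ^ (A + g + 6 + m) ≤ N - 1 := by omega
    exact_mod_cast h2
  have hexp : Real.exp (-(γ * Real.log n * ((n : ℝ) ^ (A + g + 6))⁻¹ * ((N - 1 : ℕ) : ℝ))) ≤
      ((n : ℝ) ^ (A + g + 3))⁻¹ := by
    have h1 : (n : ℝ) ^ m ≤ ((n : ℝ) ^ (A + g + 6))⁻¹ * ((N - 1 : ℕ) : ℝ) := by
      rw [← div_eq_inv_mul, le_div_iff₀ (by positivity), ← pow_add, add_comm m]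
      exact hNm
    have h2 : ((A + g + 3 : ℕ) : ℝ) ≤ γ * (((n : ℝ) ^ (A + g + 6))⁻¹ * ((N - 1 : ℕ) : ℝ)) := by
      rw [div_le_iff₀ hγ] at hm
      nlinarith [hpow m]
    have h3 : ((n : ℝ) ^ (A + g + 3))⁻¹ = Real.exp (-((A + g + 3 : ℕ) * Real.log n)) := by
      rw [Real.exp_neg, ← Real.log_pow, Real.exp_log (by positivity)]
    rw [h3, Real.exp_le_exp]
    nlinarith
  have hL' : (L : ℝ) ≤ n ^ g * n := by
    refine hL.trans ?_
    have := hg.trans (hpow g)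
    gcongr
  have h1 : (L : ℝ) * (n * Real.exp (-(γ * Real.log n * ((n : ℝ) ^ (A + g + 6))⁻¹ *
      ((N - 1 : ℕ) : ℝ)))) ≤ ((n : ℝ) ^ A)⁻¹ * (n : ℝ)⁻¹ := by
    calc _ ≤ (n : ℝ) ^ g * n * (n * ((n : ℝ) ^ (A + g + 3))⁻¹) := by gcongr
      _ = _ := by
        rw [pow_add, pow_add]
        field_simp
  have h2 : (L : ℝ) * (n ^ 3 * (2 * (γ * Real.log n * ((n : ℝ) ^ (A + g + 6))⁻¹))) ≤
      ((n : ℝ) ^ A)⁻¹ * (n : ℝ)⁻¹ := by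
    calc _ ≤ (2 * c + 2) * Real.log n * (n ^ 3 * (2 * (γ * Real.log n *
          ((n : ℝ) ^ (A + g + 6))⁻¹))) := by gcongr
      _ = (2 * γ * (2 * c + 2)) * (Real.log n * Real.log n) * n ^ 3 *
          ((n : ℝ) ^ (A + g + 6))⁻¹ := by ring
      _ ≤ (n : ℝ) ^ g * (n * n) * n ^ 3 * ((n : ℝ) ^ (A + g + 6))⁻¹ := by
        have := hg'.trans (hpow g)
        gcongr
      _ = _ := by
        rw [pow_add, pow_add]
        field_simp
  have h3 : (n : ℝ)⁻¹ ≤ 3⁻¹ := inv_anti₀ (by norm_num) hn3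
  have h4 : 0 ≤ ((n : ℝ) ^ A)⁻¹ := by positivity
  rw [mul_add]
  nlinarith

/-! ## The main construction -/

section Main

variable {n N : ℕ} [NeZero N] (p : Params)

/-- The positions in the program at which samples are used. -/
def samplePosition : SampleTime p → Fin (7 + 5 * p.leaderRounds + 5 * p.boruvkaRounds)
  | Sum.inl _ => ⟨0, by omega⟩
  | Sum.inr (Sum.inl j) => ⟨3 + 5 * j, by omega⟩
  | Sum.inr (Sum.inr j) => ⟨6 + 5 * p.leaderRounds + 5 * j, by omega⟩

theorem samplePosition_injective : Function.Injective (samplePosition p) := by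
  rintro (i | i | i) (j | j | j) hij <;> simp only [samplePosition, Fin.mk.injEq] at hij <;>
    first
    | rfl
    | omega
    | (congr 2; omega)

theorem card_pi_le {α : Type} {b L e : ℕ} [Finite α] (h : Nat.card α ≤ b ^ e) {e' : ℕ}
    (hN : 1 ≤ b) (he : e ≤ e') : Nat.card (Fin L → α) ≤ b ^ (e' * L) := by
  rw [Nat.card_fun, Nat.card_eq_fintype_card (α := Fin L), Fintype.card_fin, pow_mul]
  exact Nat.pow_le_pow_left (h.trans (Nat.pow_le_pow_right hN he)) _

/-- Joins the deterministic and the probabilistic halves for any grid width `q`. The matrix values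
may be any function of the words, and nothing about a metric is needed for the simulation. -/
theorem exists_mpcAlgorithm (hn : 3 ≤ n) (hnN : n ≤ N) (hγ : 0 < p.γ) (hα : 0 < p.α) (h : ℕ)
    (val : ℕ → ℝ) {q : ℝ} (hq : 0 < q) :
    ∃ 𝒜 : MPCAlgorithm (n * arity n h ^ h),
      𝒜.rounds = (7 + 5 * p.leaderRounds + 5 * p.boruvkaRounds) * (2 * h + 2) + 3 ∧
      ∀ x : Fin n → Fin n → ℕ, (∀ u v, x u v < N) →
      ∀ place : Fin n × Fin n → Fin (n * arity n h ^ h),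
        (∀ i, 3 * (Finset.univ.filter fun e => place e = i).card ≤
          63 * arity n h * (p.top + 1)) →
      (∀ ξ, ∀ r ≤ 𝒜.rounds, (𝒜.run (initialMemory place x) ξ r).Fits
        (63 * arity n h * (p.top + 1)) N) ∧
      (∀ ξ, ∃ ω : Draws n p, (∀ i u, 0 ≤ ω.delay i u) ∧ 𝒜.output n (initialMemory place x) ξ =
        approxMST (canonicalChoices n) (fun u v => val (x u v)) ω) ∧
      ∀ 𝒯 : Set (Finset (Sym2 (Fin n))),
        |𝒜.outputProb n (initialMemory place x) 𝒯 -
          approxMSTProb p (canonicalChoices n) (fun u v => val (x u v)) 𝒯| ≤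
        ((p.top + 1 : ℕ) : ℝ) * (n * Real.exp (-(p.γ * Real.log n * q * ((N - 1 : ℕ) : ℝ))) +
          n ^ 3 * (2 * (p.γ * Real.log n * q))) := by
  set B := arity n h with hBdef
  obtain ⟨hB, hle, -⟩ := arity_bounds (show 1 ≤ n by omega) h
  have hlog := one_le_log hn
  have hγn : 0 < p.γ * Real.log n := by positivity
  have hrate : ∀ k, 0 < delayRate n p k := fun k => div_pos hγn (pow_pos hα _)
  let scale : Fin (p.top + 1) → ℝ := fun k => p.α ^ (k : ℕ) * q
  have hscale : ∀ k, 0 < scale k := fun k => mul_pos (pow_pos hα _) hq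
  have hprob := isProbabilityMeasure_vertexLaw n N p scale hrate
  -- Every probability law on a standard Borel space is an image of the uniform law on `[0,1]`; here
  -- the space is even finite.
  obtain ⟨sample, hsample, hlaw⟩ :=
    Measure.exists_measurable_map_eq (vertexLaw n N p scale)
  let g : Grid n B h N (VertexState n N (p.top + 1))
      (Fin (p.top + 1) → Option (Candidate n N)) (VertexSample N (p.top + 1)) :=
    { program := mstProgram p val scale
      start := startState
      blank := fun _ => none
      pos := hB
      bound_pos := by omega
      le_pow := hle }
  -- A level record has at most `N ^ 15` values (eight fields and a candidate worth seven words),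
  -- hence `D = 15 * L`. The constant is `63 = 3 + 30 + 30`, a multiple of three, so the later
  -- division of `S` by three is exact.
  have hS : 3 * B + 2 * (15 * (p.top + 1)) + B * (2 * (15 * (p.top + 1))) ≤
      63 * B * (p.top + 1) := by
    have h1 : B * 1 ≤ B * (p.top + 1) := Nat.mul_le_mul_left _ (by omega)
    have h2 : 1 * (p.top + 1) ≤ B * (p.top + 1) := Nat.mul_le_mul_right _ hB
    nlinarith
  obtain ⟨𝒜, time, root, hrounds, htime, hroot, h𝒜⟩ := g.exists_algorithm (D := 15 * (p.top + 1))
    (by omega) (by omega) hnN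
    (card_pi_le (LevelState.card_le (by omega) hnN) (by omega) le_rfl)
    (card_pi_le (Candidate.card_option_le (by omega) hnN) (by omega) (by omega))
    sample (fun s => hsample (Set.to_countable s).measurableSet) hS
    (7 + 5 * p.leaderRounds + 5 * p.boruvkaRounds)
  refine ⟨𝒜, hrounds, fun x hx place hplace => ?_⟩
  let y : (Fin 𝒜.rounds → Fin (n * B ^ h) → unitInterval) → ℕ → Fin n →
      VertexSample N (p.top + 1) := fun ξ t u =>
    sample (if ht : t < 7 + 5 * p.leaderRounds + 5 * p.boruvkaRounds then ξ (time ⟨t, ht⟩) (root u)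
      else 0)
  have hout : ∀ ξ, 𝒜.output n (initialMemory place x) ξ =
      approxMST (canonicalChoices n) (fun u v => val (x u v)) (drawsOf p scale (y ξ)) := fun ξ => by
    rw [(h𝒜 x hx place hplace ξ).2]
    exact emittedEdges_eq_approxMST hx
  refine ⟨fun ξ => (h𝒜 x hx place hplace ξ).1, fun ξ => ⟨drawsOf p scale (y ξ), fun i u => ?_,
    hout ξ⟩, fun 𝒯 => ?_⟩
  · exact mul_nonneg (hscale i).le (Nat.cast_nonneg _)
  · let Ψ : (Fin 𝒜.rounds → Fin (n * B ^ h) → unitInterval) → RoundedDraws n N p := fun ξ =>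
      collectDraws n N p fun t u => sample (ξ (time (samplePosition p t)) (root u))
    have hΨlaw := map_volume_collectDraws N scale hrate hsample hlaw
      (htime.comp (samplePosition_injective p)) hroot
    have hsamples : Measurable fun (ξ : Fin 𝒜.rounds → Fin (n * B ^ h) → unitInterval) t u =>
        sample (ξ (time (samplePosition p t)) (root u)) :=
      measurable_pi_lambda _ fun t => measurable_pi_lambda _ fun u => hsample.comp (by fun_prop)
    have hΨ : Measurable Ψ := (measurable_of_countable (collectDraws n N p)).comp hsamples
    have hdraws : ∀ ξ, drawsOf p scale (y ξ) =
        ⟨fun k u => scale k * ((Ψ ξ).1 k u : ℕ), (Ψ ξ).2.1, (Ψ ξ).2.2⟩ := by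
      intro ξ
      have h1 : y ξ 0 = fun u => sample (ξ (time (samplePosition p (Sum.inl ()))) (root u)) := by
        funext u
        simp only [y]
        rw [dif_pos (by omega)]
        rfl
      have h2 : ∀ j : Fin p.leaderRounds, y ξ (3 + 5 * j) = fun u =>
          sample (ξ (time (samplePosition p (Sum.inr (Sum.inl j)))) (root u)) := by
        intro j
        funext u
        simp only [y]
        rw [dif_pos (by omega)]
        rfl
      have h3 : ∀ j : Fin p.boruvkaRounds, y ξ (6 + 5 * p.leaderRounds + 5 * j) = fun u =>
          sample (ξ (time (samplePosition p (Sum.inr (Sum.inr j)))) (root u)) := by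
        intro j
        funext u
        simp only [y]
        rw [dif_pos (by omega)]
        rfl
      simp only [drawsOf, h1, h2, h3]
      rfl
    refine le_trans ?_ ((abs_sub_approxMSTProb_le N scale hrate hΨ hΨlaw (canonicalChoices n)
      (fun u v => val (x u v)) 𝒯).trans ((measure_center_ne_le N scale hγn hα hq (fun k => rfl)
      (fun u v => val (x u v))).trans (le_of_eq (by push_cast; rfl))))
    simp only [MPCAlgorithm.outputProb, hout, hdraws]
    exact le_rfl

end Main

end MetricMST

end

/-! ### Fixing the constants and concluding -/

open MetricMST in
theorem lemma4p9 (δ : ℝ) (hδ0 : 0 < δ) (hδ1 : δ < 1) (c : ℕ) (a b γ : ℝ) (ha : 0 < a)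
    (hb : 0 < b) (hγ : 0 < γ) (A : ℕ) :
    ∃ (C : ℝ) (k κ : ℕ), ∀ (n : ℕ), 3 ≤ n → ∀ (ε : ℝ), 0 < ε → ε ≤ 1 →
      ∀ (p : Params), p.Theta a b ε n → p.γ = γ → 1 ≤ p.W → p.W ≤ (n : ℝ) ^ c →
      -- the numerical value of a word
      ∀ (val : ℕ → ℝ),
      ∃ (M S : ℕ) (𝒜 : MPCAlgorithm M) (ch : ArbitraryChoices n),
        (𝒜.rounds : ℝ) ≤ C * (Real.log (1 / ε) + Real.log (Real.log n)) ∧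
        (S : ℝ) ≤ C * (n : ℝ) ^ δ ∧
        (M : ℝ) * S ≤ C * ((n : ℝ) ^ 2 * Real.log n ^ k) ∧
        -- there is room for the input
        n ^ 2 ≤ M * (S / 3) ∧
        ∀ (x : Fin n → Fin n → ℕ), (∀ u v, x u v < n ^ c) →
          IsMetricWithin (fun u v => val (x u v)) p.W →
        -- any initial distribution of the input that respects the local space
        ∀ (place : Fin n × Fin n → Fin M),
          (∀ i, 3 * (Finset.univ.filter fun e => place e = i).card ≤ S) →
        (∀ ξ, ∀ r ≤ 𝒜.rounds, (𝒜.run (initialMemory place x) ξ r).Fits S (n ^ κ)) ∧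
        (∀ ξ, ∃ ω : Draws n p, (∀ i u, 0 ≤ ω.delay i u) ∧
          𝒜.output n (initialMemory place x) ξ = approxMST ch (fun u v => val (x u v)) ω) ∧
        ∀ 𝒯 : Set (Finset (Sym2 (Fin n))),
          |𝒜.outputProb n (initialMemory place x) 𝒯 -
            approxMSTProb p ch (fun u v => val (x u v)) 𝒯| ≤ ((n : ℝ) ^ A)⁻¹ := by
  obtain ⟨g₁, hg₁⟩ := pow_unbounded_of_one_lt (2 * c + 2 : ℝ) (by norm_num : (1 : ℝ) < 3)
  obtain ⟨g₂, hg₂⟩ := pow_unbounded_of_one_lt (2 * γ * (2 * c + 2)) (by norm_num : (1 : ℝ) < 3)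
  have hmono : ∀ i j : ℕ, i ≤ j → (3 : ℝ) ^ i ≤ 3 ^ j := fun i j hij =>
    pow_le_pow_right₀ (by norm_num) hij
  set g := max g₁ g₂ with hgdef
  have hg : 2 * c + 2 ≤ (3 : ℝ) ^ g := hg₁.le.trans (hmono _ _ (le_max_left _ _))
  have hg' : 2 * γ * (2 * c + 2) ≤ (3 : ℝ) ^ g := hg₂.le.trans (hmono _ _ (le_max_right _ _))
  obtain ⟨m, hm⟩ := pow_unbounded_of_one_lt ((A + g + 3 : ℕ) / γ) (by norm_num : (1 : ℝ) < 3)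
  -- This depth makes the arity `O(n ^ (δ / 2))`.
  set h := ⌈2 / δ⌉₊ with hh
  have hhle : 2 / δ ≤ ((h + 1 : ℕ) : ℝ) := by
    push_cast
    exact (Nat.le_ceil _).trans (by linarith)
  -- The least value of `log (1 / ε) + log log n` in the allowed range; it is positive because `3 >
  -- e`.
  set Λ₀ := Real.log (Real.log 3) with hΛ₀
  have hlog3 : 1 < Real.log 3 := by
    rw [Real.lt_log_iff_exp_lt (by norm_num)]
    exact Real.exp_one_lt_d9.trans (by norm_num)
  have hΛ₀pos : 0 < Λ₀ := Real.log_pos hlog3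
  set C₁ := (7 / Λ₀ + 10 * b) * (2 * h + 2) + 3 / Λ₀ with hC₁
  set C₂ := 63 * 2 * (2 * c + 2) * (2 / δ) with hC₂
  set C₃ : ℝ := 63 * 2 ^ (h + 1) * (2 * c + 2) with hC₃
  have hC₁0 : 0 ≤ C₁ := by positivity
  have hC₂0 : 0 ≤ C₂ := by positivity
  have hC₃0 : 0 ≤ C₃ := by positivity
  -- In the word exponent, `A + g + 6` compensates the grid width, `m` pushes the delay range past
  -- the tail, `+ 1` provides the factor two that makes `N - 1` large enough, and `c` makes room for
  -- the input words.
  refine ⟨C₁ + C₂ + C₃, 1, A + g + 6 + m + 1 + c, fun n hn ε hε hε1 p hp hpγ hW hWn val => ?_⟩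
  have hn3 : (3 : ℝ) ≤ n := by exact_mod_cast hn
  have hn1 : 1 ≤ n := by omega
  set N := n ^ (A + g + 6 + m + 1 + c) with hN
  have : NeZero N := ⟨by positivity⟩
  have hnN : n ≤ N := Nat.le_self_pow (by omega) n
  have hcN : n ^ c ≤ N := Nat.pow_le_pow_right hn1 (by omega)
  have hN2 : 2 * n ^ (A + g + 6 + m) ≤ N := by
    calc 2 * n ^ (A + g + 6 + m) ≤ n * n ^ (A + g + 6 + m) := Nat.mul_le_mul_right _ (by omega)
      _ = n ^ (A + g + 6 + m + 1) := (pow_succ' _ _).symm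
      _ ≤ N := Nat.pow_le_pow_right hn1 (by omega)
  have hL := levels_le hn hp.two_le hW hWn
  have hΛ : Λ₀ ≤ Real.log (1 / ε) + Real.log (Real.log n) := by
    have h1 : 0 ≤ Real.log (1 / ε) := Real.log_nonneg (by rw [le_div_iff₀ hε]; linarith)
    have h2 : Λ₀ ≤ Real.log (Real.log n) :=
      Real.log_le_log (by linarith) (Real.log_le_log (by norm_num) hn3)
    linarith
  have hα : 0 < p.α := by linarith [hp.two_le]
  obtain ⟨𝒜, hrounds, h𝒜⟩ := exists_mpcAlgorithm (N := N) p hn hnN (by rw [hpγ]; exact hγ) hα h val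
    (q := ((n : ℝ) ^ (A + g + 6))⁻¹) (by positivity)
  refine ⟨n * arity n h ^ h, 63 * arity n h * (p.top + 1), 𝒜, canonicalChoices n, ?_, ?_, ?_, ?_,
    fun x hx _ place hplace => ?_⟩
  · rw [hrounds]
    refine (rounds_le hΛ₀pos hΛ hp.leaderRounds_le hp.boruvkaRounds_le).trans ?_
    exact mul_le_mul_of_nonneg_right (by linarith) (by linarith)
  · refine (space_le hδ0 hn hhle hL).trans ?_
    exact mul_le_mul_of_nonneg_right (by linarith) (by positivity)
  · refine (totalSpace_le hn hL).trans ?_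
    have := one_le_log hn
    exact mul_le_mul_of_nonneg_right (by linarith) (by positivity)
  · obtain ⟨hB, hle, -⟩ := arity_bounds hn1 h
    have h1 : 63 * arity n h * (p.top + 1) / 3 = 21 * arity n h * (p.top + 1) := by
      rw [show 63 * arity n h * (p.top + 1) = 3 * (21 * arity n h * (p.top + 1)) by ring]
      exact Nat.mul_div_cancel_left _ (by norm_num)
    rw [h1]
    calc n ^ 2 = n * n * 1 := by ring
      _ ≤ n * (arity n h ^ h * arity n h) * (21 * (p.top + 1)) := by gcongr; omega
      _ = _ := by ring
  · obtain ⟨h1, h2, h3⟩ := h𝒜 x (fun u v => (hx u v).trans_le hcN) place hplace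
    refine ⟨h1, h2, fun 𝒯 => (h3 𝒯).trans ?_⟩
    rw [hpγ]
    exact error_le hγ hn hL hg hg' hm.le hN2
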